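/- An overpartition of a nonnegative integer $n$ is a partition of $n$ in which the first occurrence of each distinct part may be overlined. Let $\overline{p}(n)$ denote the number of overpartitions of $n$, and for $n\ge 1$ put $$u_n=\frac{\overline{p}(n-1)\,\overline{p}(n+1)}{\overline{p}(n)^2}.$$ For a sequence $\gamma=(\gamma_k)_{k\ge 0}$ of real numbers let $J_\gamma^{d,n}(X)=\sum_{j=0}^{d}\binom{d}{j}\gamma_{n+j}X^j$ be its Jensen polynomial of degree $d$ and shift $n$. A real polynomial is called hyperbolic if all of its complex zeros are real. (1) For every $n\ge 16$ the third-order Turán inequality $$4(1-u_n)(1-u_{n+1})-(1-u_nu_{n+1})^2>0$$ holds. (2) For every $n\ge 1$, the inequality in (1) holds for $n$ if and only if the Jensen polynomial $J_{\overline{p}}^{3,n-1}$ has three distinct real zeros. (3) Consequently, for every $n\ge 16$ the Jensen polynomial $J_{\overline{p}}^{3,n}$ is hyperbolic. -/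

import Mathlib

open Polynomial

/-- An overpartition of `n`: a partition of `n` in which the first occurrence of each distinct part
may be overlined. It is recorded as the partition together with the set of those distinct parts
whose first occurrence is overlined. -/
abbrev Overpartition (n : ℕ) : Type :=
  Σ lam : n.Partition, {s : Finset ℕ // s ∈ lam.parts.toFinset.powerset}

/-- The overpartition function: the number of overpartitions of `n`. -/
def overpartitionCount (n : ℕ) : ℕ := Fintype.card (Overpartition n)

/-- `u n = p̄(n-1) p̄(n+1) / p̄(n)^2`, used for `n ≥ 1` only. -/
noncomputable def overpartitionRatio (n : ℕ) : ℝ :=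
  ((overpartitionCount (n - 1) : ℝ) * (overpartitionCount (n + 1) : ℝ)) /
    (overpartitionCount n : ℝ) ^ 2

/-- The Jensen polynomial of degree `d` and shift `n` of a sequence `γ`:
`∑_{j=0}^{d} (d choose j) γ(n+j) X^j`. -/
noncomputable def jensenPolynomial (γ : ℕ → ℝ) (d n : ℕ) : ℝ[X] :=
  ∑ j ∈ Finset.range (d + 1), C ((d.choose j : ℝ) * γ (n + j)) * X ^ j

/-- A real polynomial is hyperbolic if all of its complex zeros are real. -/
def IsHyperbolic (p : ℝ[X]) : Prop :=
  ∀ z : ℂ, aeval z p = 0 → z.im = 0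

/-!
The Turán inequality compares four consecutive values of the overpartition function, and it holds
because `log p̄(n)` is, up to a negligible error, a smooth function of `n` whose second difference
has order `n ^ (-3/2)` while its third difference has the smaller order `n ^ (-5/2)`. With
`a = 1 - u_n` and `b = 1 - u_{n+1}` the expression in question is
`a * b * (2 * a + 2 * b - a * b) - (a - b) ^ 2`; the first term has order `n ^ (-9/2)` and the
second only `n ^ (-5)`.

The smooth approximation comes from the circle method with explicit constants. By Gauss's product
formula (`PowerSeries.overpartitionSeries_mul_thetaSeries`, `tendsto_prod_theta4`) the generating
function of the overpartition numbers is the reciprocal of `θ₄(q) = ∑ (-1)^m q^(m²)`, so `p̄(n)` is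
a Cauchy integral of `1 / θ₄(exp (-t))` along a vertical segment `re t = σ`
(`overpartitionCount_eq_integral`). Near the real axis the functional equation of the Jacobi theta
function shows that `1 / θ₄(exp (-t))` is `√t * exp ((π/2)² / t) / (2 √π)` up to a bounded error
(`norm_inv_theta4_sub_le`), and the integral of this main part against `exp (n * t)` is, up to small
terms, an inverse Laplace transform in closed form (`norm_integral_csqrt_sub_le`). Away from the
real axis, `|θ₄(q)|` exceeds `θ₄(|q|)` by an explicit factor (`theta4_lower_bound`), which makes the
integrand exponentially smaller. The result is `overpartitionCount_approx`, valid for `n ≥ 34²`,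
whose relative error is far below `n ^ (-5/2)`.

In the range `16 ≤ n ≤ 1223` the inequality is verified by evaluating the recurrence
`p̄(n) = 2 * (p̄(n-1) - p̄(n-4) + p̄(n-9) - ⋯)`, which is again the identity `p̄ * θ₄ = 1`.

The statements on the Jensen polynomial hold because its discriminant is, up to a positive factor,
the Turán expression, and a real cubic with positive discriminant has three distinct real roots.
-/

open Filter Topology MeasureTheory

/-! ### Gauss's identity for the product of `(1 - q ^ k) / (1 + q ^ k)` -/

/-- The increment, on passing from `n` to `n + 1`, of the right-hand side of `gauss_finite`, with
the sum cut off at `m` terms. The elements `d k` stand for the inverses of `1 + q ^ k`; this lets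
the identity apply to power series and to complex numbers alike. -/
theorem gauss_telescope {R : Type*} [CommRing R] (q : R) (d : ℕ → R)
    (hd : ∀ k, 1 ≤ k → d k * (1 + q ^ k) = 1) (n m : ℕ) (hm : m ≤ n) :
    (∏ k ∈ Finset.Ioc 0 (n + 1), (1 - q ^ k) * d k) - (∏ k ∈ Finset.Ioc 0 n, (1 - q ^ k) * d k)
      + 2 * ∑ s ∈ Finset.range m, (-1) ^ (s + 1) * d (s + 1) *
        ((∏ k ∈ Finset.Ioc (s + 1) (n + 1), (1 - q ^ k) * d k) * q ^ ((s + 1) * (n + 2))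
          - (∏ k ∈ Finset.Ioc (s + 1) n, (1 - q ^ k) * d k) * q ^ ((s + 1) * (n + 1)))
      = - (2 * (-1) ^ m * (∏ k ∈ Finset.Ioc m n, (1 - q ^ k) * d k) * q ^ ((m + 1) * (n + 1))
          * d (n + 1)) := by
  have hN := hd (n + 1) (by omega)
  have top (s : ℕ) (hs : s ≤ n) : (∏ k ∈ Finset.Ioc s (n + 1), (1 - q ^ k) * d k)
      = (∏ k ∈ Finset.Ioc s n, (1 - q ^ k) * d k) * ((1 - q ^ (n + 1)) * d (n + 1)) :=
    Finset.prod_Ioc_succ_top hs _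
  induction m with
  | zero =>
    rw [top 0 (by omega)]
    simp only [Finset.range_zero, Finset.sum_empty, pow_zero, zero_add, one_mul, mul_zero, add_zero]
    linear_combination (∏ k ∈ Finset.Ioc 0 n, (1 - q ^ k) * d k) * hN
  | succ m ih =>
    have h1 := hd (m + 1) (by omega)
    have hb : (∏ k ∈ Finset.Ioc m n, (1 - q ^ k) * d k)
        = ((1 - q ^ (m + 1)) * d (m + 1)) * ∏ k ∈ Finset.Ioc (m + 1) n, (1 - q ^ k) * d k := by
      rw [← Finset.prod_Ioc_consecutive _ (Nat.le_succ m) hm]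
      simp
    have ih' := ih (by omega)
    rw [hb] at ih'
    rw [Finset.sum_range_succ, mul_add, ← add_assoc, ih', top (m + 1) hm]
    have e1 : q ^ ((m + 1) * (n + 2)) = q ^ ((m + 1) * (n + 1)) * q ^ (m + 1) := by ring
    have e2 : q ^ ((m + 1 + 1) * (n + 1)) = q ^ ((m + 1) * (n + 1)) * q ^ (n + 1) := by ring
    rw [e1, e2]
    have e3 : (-1 : R) ^ (m + 1) = - (-1) ^ m := by ring
    rw [e3]
    generalize q ^ ((m + 1) * (n + 1)) = z at *
    generalize q ^ (m + 1) = x at *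
    generalize q ^ (n + 1) = y at *
    generalize (∏ k ∈ Finset.Ioc (m + 1) n, (1 - q ^ k) * d k) = r at *
    linear_combination 2 * (-1) ^ m * r * z * (- d (m + 1) * hN + y * d (n + 1) * h1)

/-- A finite form of Gauss's identity `1 + 2 ∑ (-1) ^ s q ^ (s²) = ∏ (1 - q ^ k) / (1 + q ^ k)`. The
last sum on the right is divisible by `q ^ (n + 1)` and is the error of truncation. -/
theorem gauss_finite {R : Type*} [CommRing R] (q : R) (d : ℕ → R)
    (hd : ∀ k, 1 ≤ k → d k * (1 + q ^ k) = 1) (n : ℕ) :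
    1 + 2 * ∑ s ∈ Finset.range n, (-1) ^ (s + 1) * q ^ ((s + 1) ^ 2)
      = (∏ k ∈ Finset.Ioc 0 n, (1 - q ^ k) * d k)
        + 2 * ∑ s ∈ Finset.range n, (-1) ^ (s + 1) * d (s + 1) *
          (∏ k ∈ Finset.Ioc (s + 1) n, (1 - q ^ k) * d k) * q ^ ((s + 1) * (n + 1)) := by
  induction n with
  | zero => simp
  | succ n ih =>
    have h := gauss_telescope q d hd n n le_rfl
    have hN := hd (n + 1) (by omega)
    rw [Finset.sum_range_succ, mul_add, ← add_assoc, ih, Finset.sum_range_succ (n := n)]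
    simp only [Finset.Ioc_self, Finset.prod_empty, mul_one] at h ⊢
    simp only [mul_sub, Finset.sum_sub_distrib, ← mul_assoc] at h
    have e1 : q ^ ((n + 1) * (n + 1 + 1)) = q ^ ((n + 1) ^ 2) * q ^ (n + 1) := by ring
    have e2 : q ^ ((n + 1) * (n + 1)) = q ^ ((n + 1) ^ 2) := by ring
    rw [e1]
    rw [e2] at h
    generalize q ^ ((n + 1) ^ 2) = z at *
    linear_combination -h - 2 * (-1) ^ (n + 1) * z * hN

/-! ### The generating function of overpartitions -/

theorem overpartitionCount_eq_sum (n : ℕ) :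
    overpartitionCount n = ∑ p : n.Partition, p.parts.toFinsupp.prod (fun _ _ => 2) := by
  unfold overpartitionCount
  rw [Fintype.card_sigma]
  refine Finset.sum_congr rfl fun p _ => ?_
  simp [Finsupp.prod]

namespace PowerSeries

open WithPiTopology

/-- The formal power series `∑ (-1) ^ m q ^ (m²)`, summed over all integers `m`. The sign is
written as `(-1) ^ (m²)`, which is the same. -/
noncomputable def thetaSeries : PowerSeries ℤ :=
  PowerSeries.mk fun m => if m = 0 then 1 else if IsSquare m then 2 * (-1) ^ m else 0

/-- The generating function of the overpartition function. -/
noncomputable def overpartitionSeries : PowerSeries ℤ :=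
  PowerSeries.mk fun n => (overpartitionCount n : ℤ)

theorem overpartitionSeries_eq_genFun :
    overpartitionSeries = Nat.Partition.genFun (R := ℤ) (fun _ _ => 2) := by
  ext n
  simp [overpartitionSeries, overpartitionCount_eq_sum, Finsupp.prod]

/-- Each factor of the Euler product is
`1 + 2 q ^ i + 2 q ^ (2 i) + ⋯ = (1 + q ^ i) / (1 - q ^ i)`. -/
theorem genFun_factor (i : ℕ) :
    ((1 : PowerSeries ℤ) + ∑' j, (2 : ℤ) • (X : PowerSeries ℤ) ^ ((i + 1) * (j + 1)))
      * (1 - X ^ (i + 1)) = 1 + X ^ (i + 1) := by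
  have h0 : constantCoeff ((X : PowerSeries ℤ) ^ (i + 1)) = 0 := by simp
  have hs := summable_pow_of_constantCoeff_eq_zero h0
  have h1 := tsum_pow_mul_one_sub_of_constantCoeff_eq_zero h0
  have h2 : ∑' j, (2 : ℤ) • (X : PowerSeries ℤ) ^ ((i + 1) * (j + 1))
      = (2 * X ^ (i + 1)) * ∑' j, (X ^ (i + 1)) ^ j := by
    rw [← hs.tsum_mul_left]
    refine tsum_congr fun j => ?_
    rw [zsmul_eq_mul, pow_mul, pow_succ]
    push_cast
    ring
  rw [h2]
  linear_combination (2 * X ^ (i + 1)) * h1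

theorem coeff_thetaSeries_partial {m n : ℕ} (h : m ≤ n) :
    coeff m (1 + 2 * ∑ s ∈ Finset.range n, (-1) ^ (s + 1) * (X : PowerSeries ℤ) ^ ((s + 1) ^ 2))
      = coeff m thetaSeries := by
  have hc (s : ℕ) : (-1) ^ (s + 1) * (X : PowerSeries ℤ) ^ ((s + 1) ^ 2)
      = C ((-1) ^ (s + 1)) * X ^ ((s + 1) ^ 2) := by simp
  have h2 : (2 : PowerSeries ℤ) = C 2 := by simp
  simp only [hc, h2, thetaSeries, coeff_mk, map_add, coeff_C_mul, map_sum, coeff_X_pow, coeff_one]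
  by_cases hm : m = 0
  · subst hm
    simp only [if_true, add_eq_left, mul_eq_zero, OfNat.ofNat_ne_zero, false_or]
    exact Finset.sum_eq_zero fun x _ => by
      rw [if_neg (by positivity : (0 : ℕ) < (x + 1) ^ 2).ne, mul_zero]
  by_cases hsq : IsSquare m
  · obtain ⟨r, rfl⟩ := hsq
    obtain ⟨r, rfl⟩ : ∃ k, r = k + 1 := Nat.exists_eq_succ_of_ne_zero (by rintro rfl; simp at hm)
    rw [Finset.sum_eq_single r]
    · have : ((-1 : ℤ)) ^ ((r + 1) * (r + 1)) = (-1) ^ (r + 1) := by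
        rcases Nat.even_or_odd (r + 1) with h | h
        · rw [h.neg_one_pow, (h.mul_right _).neg_one_pow]
        · rw [h.neg_one_pow, (h.mul h).neg_one_pow]
      simp [this, sq]
    · intro b _ hb
      rw [if_neg, mul_zero]
      intro h
      rw [← sq] at h
      exact hb (by have := Nat.pow_left_injective (n := 2) (by norm_num) h; omega)
    · intro hr
      simp only [Finset.mem_range, not_lt] at hr
      nlinarith
  · rw [if_neg hm, if_neg hm, if_neg hsq, Finset.sum_eq_zero, mul_zero, add_zero]
    intro s _
    rw [if_neg, mul_zero]
    rintro rfl
    exact hsq ⟨s + 1, sq _⟩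

/-- The generating function of the overpartition numbers is the reciprocal of the theta series. -/
theorem overpartitionSeries_mul_thetaSeries : overpartitionSeries * thetaSeries = 1 := by
  have hu (k : ℕ) (hk : 1 ≤ k) : ∃ d : PowerSeries ℤ, d * (1 + X ^ k) = 1 := by
    have : IsUnit (1 + (X : PowerSeries ℤ) ^ k) := by
      rw [isUnit_iff_constantCoeff]
      simp [show k ≠ 0 by omega]
    obtain ⟨d, hd⟩ := this.exists_left_inv
    exact ⟨d, hd⟩
  choose! d hd using hu
  have hP := (Nat.Partition.hasProd_genFun (R := ℤ) (fun _ _ => 2)).tendsto_prod_nat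
  rw [← overpartitionSeries_eq_genFun, tendsto_iff_coeff_tendsto] at hP
  -- Modulo `X ^ m` both series agree with finite truncations, to which `gauss_finite` applies.
  have key (m : ℕ) : X ^ m ∣ overpartitionSeries * thetaSeries - 1 := by
    have hev : ∀ᶠ N in Filter.atTop, ∀ j ∈ Finset.range m, coeff j (∏ i ∈ Finset.range N,
        ((1 : PowerSeries ℤ) + ∑' j, (2 : ℤ) • (X : PowerSeries ℤ) ^ ((i + 1) * (j + 1))))
          = coeff j overpartitionSeries := by
      rw [Filter.eventually_all_finset]
      intro j _
      exact (hP j).eventually_mem (by simp : {coeff j overpartitionSeries} ∈ _)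
    obtain ⟨N, hN, hmN⟩ := (hev.and (Filter.eventually_ge_atTop m)).exists
    set Q := ∏ i ∈ Finset.range N,
        ((1 : PowerSeries ℤ) + ∑' j, (2 : ℤ) • (X : PowerSeries ℤ) ^ ((i + 1) * (j + 1))) with hQ
    have hQR : Q * ∏ k ∈ Finset.Ioc 0 N, (1 - X ^ k) * d k = 1 := by
      have : ∏ k ∈ Finset.Ioc 0 N, (1 - X ^ k) * d k
          = ∏ i ∈ Finset.range N, (1 - X ^ (i + 1)) * d (i + 1) := by
        rw [Finset.range_eq_Ico, Finset.prod_Ico_add' (fun k => (1 - X ^ k) * d k) 0 N 1]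
        rfl
      rw [this, hQ, ← Finset.prod_mul_distrib]
      refine Finset.prod_eq_one fun i _ => ?_
      rw [← mul_assoc, genFun_factor, mul_comm]
      exact hd _ (by omega)
    have h1 : X ^ m ∣ overpartitionSeries - Q := by
      rw [X_pow_dvd_iff]
      intro j hj
      rw [map_sub, hN j (Finset.mem_range.2 hj), sub_self]
    have hG := gauss_finite (X : PowerSeries ℤ) d hd N
    set S := 1 + 2 * ∑ s ∈ Finset.range N, (-1) ^ (s + 1) * (X : PowerSeries ℤ) ^ ((s + 1) ^ 2)
      with hS
    have h2 : X ^ m ∣ thetaSeries - S := by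
      rw [X_pow_dvd_iff]
      intro j hj
      rw [map_sub, hS, coeff_thetaSeries_partial (by omega), sub_self]
    have h3 : X ^ m ∣ S - ∏ k ∈ Finset.Ioc 0 N, (1 - X ^ k) * d k := by
      rw [hG, add_sub_cancel_left]
      refine Dvd.dvd.mul_left (Finset.dvd_sum fun s _ => Dvd.dvd.mul_left ?_ _) _
      exact pow_dvd_pow _ (by nlinarith)
    have e : overpartitionSeries * thetaSeries - 1
        = (overpartitionSeries - Q) * thetaSeries + (thetaSeries - S) * Q
          + (S - ∏ k ∈ Finset.Ioc 0 N, (1 - X ^ k) * d k) * Q := by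
      linear_combination hQR
    rw [e]
    exact dvd_add (dvd_add (h1.mul_right _) (h2.mul_right _)) (h3.mul_right _)
  ext n
  have := (X_pow_dvd_iff.1 (key (n + 1))) n (by omega)
  rw [map_sub, sub_eq_zero] at this
  exact this

theorem overpartitionCount_zero : overpartitionCount 0 = 1 := by
  simp [overpartitionCount_eq_sum]

/-- The recurrence `p̄(n) = 2 * (p̄(n-1) - p̄(n-4) + p̄(n-9) - ⋯)`. Any `K` with `n < (K + 1) ^ 2`
exhausts the squares, and the guard excludes truncated subtraction. -/
theorem overpartitionCount_recurrence {n : ℕ} (hn : 1 ≤ n) {K : ℕ} (hK : n < (K + 1) ^ 2) :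
    (overpartitionCount n : ℤ) = 2 * ∑ k ∈ Finset.range K,
      if (k + 1) ^ 2 ≤ n then (-1) ^ k * (overpartitionCount (n - (k + 1) ^ 2) : ℤ) else 0 := by
  have h := congrArg (coeff n) overpartitionSeries_mul_thetaSeries
  have hS : coeff n (overpartitionSeries * thetaSeries) = coeff n (overpartitionSeries *
      (1 + 2 * ∑ s ∈ Finset.range (n + K), (-1) ^ (s + 1) * (X : PowerSeries ℤ) ^ ((s + 1) ^ 2)))
      := by
    rw [coeff_mul, coeff_mul]
    refine Finset.sum_congr rfl fun p hp => ?_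
    rw [coeff_thetaSeries_partial]
    have := Finset.HasAntidiagonal.mem_antidiagonal.1 hp
    omega
  rw [hS, mul_add, map_add, mul_one, coeff_one, if_neg (by omega)] at h
  have h2 : overpartitionSeries * (2 * ∑ s ∈ Finset.range (n + K),
      (-1) ^ (s + 1) * (X : PowerSeries ℤ) ^ ((s + 1) ^ 2))
      = ∑ s ∈ Finset.range (n + K),
        C (2 * (-1) ^ (s + 1)) * (overpartitionSeries * X ^ ((s + 1) ^ 2)) := by
    rw [Finset.mul_sum, Finset.mul_sum]
    refine Finset.sum_congr rfl fun s _ => ?_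
    simp only [map_mul, map_pow, map_neg, map_one, map_ofNat]
    ring
  rw [h2, map_sum] at h
  simp only [coeff_C_mul, coeff_mul_X_pow'] at h
  have h3 : coeff n overpartitionSeries = (overpartitionCount n : ℤ) := by
    simp [overpartitionSeries]
  rw [h3] at h
  have h4 : ∑ k ∈ Finset.range K,
      (if (k + 1) ^ 2 ≤ n then (-1) ^ k * (overpartitionCount (n - (k + 1) ^ 2) : ℤ) else 0)
      = ∑ k ∈ Finset.range (n + K),
      (if (k + 1) ^ 2 ≤ n then (-1) ^ k * (overpartitionCount (n - (k + 1) ^ 2) : ℤ) else 0) := by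
    refine Finset.sum_subset (Finset.range_mono (by omega)) fun k _ hk => ?_
    rw [if_neg]
    simp only [Finset.mem_range, not_lt] at hk
    nlinarith [Nat.pow_le_pow_left (Nat.succ_le_succ hk) 2]
  rw [h4, Finset.mul_sum, eq_neg_of_add_eq_zero_left h, ← Finset.sum_neg_distrib]
  refine Finset.sum_congr rfl fun k _ => ?_
  by_cases hk : (k + 1) ^ 2 ≤ n
  · rw [if_pos hk, if_pos hk]
    simp only [overpartitionSeries, coeff_mk]
    ring
  · rw [if_neg hk, if_neg hk, mul_zero, mul_zero, neg_zero]

end PowerSeries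

/-! ### Verification of the Turán inequality in a finite range

The values of the overpartition function are packed into one natural number with digits in base
`2 ^ 160`. The functions are written with `Nat.rec` and the primitive operations on `Nat`, which
the kernel evaluates directly on numerals. -/

/-- The `j`-th digit of `T` in base `2 ^ 160`. -/
def digit (T j : ℕ) : ℕ := Nat.mod (Nat.div T (Nat.pow 2 (Nat.mul 160 j))) (Nat.pow 2 160)

/-- The sum of the digits of `T` at the positions `n - k ^ 2`, `n - (k + 2) ^ 2`, …, over at most
`f` terms and as long as the square does not exceed `n`. -/
def strideSum (T n : ℕ) (f : ℕ) : ℕ → ℕ :=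
  Nat.rec (fun _ => 0) (fun _ ih k => bif Nat.ble (Nat.mul k k) n then
    Nat.add (digit T (Nat.sub n (Nat.mul k k))) (ih (Nat.add k 2)) else 0) f

/-- `evalThen x f` is `f x`. The recursion on `x` makes the kernel reduce `x` to a numeral before it
substitutes it into `f`. -/
def evalThen (x : ℕ) (f : ℕ → Bool) : Bool := Nat.rec (f 0) (fun m _ => f (Nat.succ m)) x

/-- The Turán inequality for the consecutive values `a`, `b`, `c`, `d`, together with the
inequalities that make the truncated subtractions in it exact. -/
def turanTest (a b c d : ℕ) : Bool :=
  and (Nat.blt (Nat.mul a c) (Nat.mul b b)) (and (Nat.blt (Nat.mul b d) (Nat.mul c c))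
    (and (Nat.ble (Nat.mul a d) (Nat.mul b c))
    (Nat.blt (Nat.pow (Nat.sub (Nat.mul b c) (Nat.mul a d)) 2)
      (Nat.mul 4 (Nat.mul (Nat.sub (Nat.mul b b) (Nat.mul a c))
        (Nat.sub (Nat.mul c c) (Nat.mul b d)))))))

/-- Starting from the packed values `T` below `n`, computes `f` further values by the recurrence and
applies `turanTest` to the last four values at each step from `n = 18` on. -/
def verify (f : ℕ) : ℕ → ℕ → Bool :=
  Nat.rec (fun _ _ => true) (fun _ ih n T =>
    evalThen (Nat.sub (Nat.mul 2 (strideSum T n 21 1)) (Nat.mul 2 (strideSum T n 21 2))) fun c =>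
      and (Nat.blt c (Nat.pow 2 160)) 
        (evalThen (Nat.add T (Nat.mul c (Nat.pow 2 (Nat.mul 160 n)))) fun T' =>
          and (or (Nat.ble n 17)
            (turanTest (digit T' (Nat.sub n 3)) (digit T' (Nat.sub n 2))
              (digit T' (Nat.sub n 1)) c))
          (ih (Nat.succ n) T'))) f

theorem verify_true : verify 1225 1 1 = true := by decide +kernel

theorem evalThen_eq (x : ℕ) (f : ℕ → Bool) : evalThen x f = f x := by
  cases x <;> rfl

theorem digit_def (T j : ℕ) : digit T j = T / 2 ^ (160 * j) % 2 ^ 160 := rfl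

theorem strideSum_zero (T n k : ℕ) : strideSum T n 0 k = 0 := rfl

theorem strideSum_succ (T n f k : ℕ) : strideSum T n (f + 1) k
    = if k ^ 2 ≤ n then digit T (n - k ^ 2) + strideSum T n f (k + 2) else 0 := by
  have : strideSum T n (f + 1) k = bif Nat.ble (k * k) n then
    digit T (n - k * k) + strideSum T n f (k + 2) else 0 := rfl
  rw [this, sq]
  by_cases h : k * k ≤ n
  · rw [Nat.ble_eq_true_of_le h, if_pos h, cond_true]
  · rw [if_neg h, show Nat.ble (k * k) n = false by rwa [Bool.eq_false_iff, Ne, Nat.ble_eq],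
      cond_false]

theorem strideSum_eq (T n f k : ℕ) : strideSum T n f k
    = ∑ i ∈ Finset.range f, if (k + 2 * i) ^ 2 ≤ n then digit T (n - (k + 2 * i) ^ 2) else 0 := by
  induction f generalizing k with
  | zero => simp [strideSum_zero]
  | succ f ih =>
    rw [strideSum_succ, Finset.sum_range_succ']
    have e (i : ℕ) : k + 2 * (i + 1) = k + 2 + 2 * i := by ring
    by_cases h : k ^ 2 ≤ n
    · simp only [h, if_true, e, ih, mul_zero, add_zero]
      rw [add_comm]
    · rw [if_neg h, Finset.sum_eq_zero, mul_zero, add_zero, if_neg h]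
      intro i _
      rw [if_neg]
      intro h2
      exact h ((Nat.pow_le_pow_left (by omega) 2).trans h2)

theorem verify_succ (f n T : ℕ) : verify (f + 1) n T =
    ((2 * strideSum T n 21 1 - 2 * strideSum T n 21 2).blt (2 ^ 160) &&
      ((n.ble 17 ||
          turanTest
            (digit (T + (2 * strideSum T n 21 1 - 2 * strideSum T n 21 2) * 2 ^ (160 * n)) (n - 3))
            (digit (T + (2 * strideSum T n 21 1 - 2 * strideSum T n 21 2) * 2 ^ (160 * n)) (n - 2))
            (digit (T + (2 * strideSum T n 21 1 - 2 * strideSum T n 21 2) * 2 ^ (160 * n)) (n - 1))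
            (2 * strideSum T n 21 1 - 2 * strideSum T n 21 2)) &&
        verify f (n + 1)
          (T + (2 * strideSum T n 21 1 - 2 * strideSum T n 21 2) * 2 ^ (160 * n)))) := by
  rw [← evalThen_eq (2 * strideSum T n 21 1 - 2 * strideSum T n 21 2) fun c =>
      c.blt (2 ^ 160) &&
        ((n.ble 17 || turanTest (digit (T + c * 2 ^ (160 * n)) (n - 3))
          (digit (T + c * 2 ^ (160 * n)) (n - 2)) (digit (T + c * 2 ^ (160 * n)) (n - 1)) c) &&
          verify f (n + 1) (T + c * 2 ^ (160 * n)))]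
  have (c : ℕ) := evalThen_eq (T + c * 2 ^ (160 * n)) fun T' =>
          (n.ble 17 || turanTest (digit T' (n - 3)) (digit T' (n - 2)) (digit T' (n - 1)) c) &&
          verify f (n + 1) T'
  simp only [← this]
  rfl

theorem sum_range_two_mul {M : Type*} [AddCommMonoid M] (g : ℕ → M) (m : ℕ) :
    ∑ k ∈ Finset.range (2 * m), g k
      = ∑ i ∈ Finset.range m, g (2 * i) + ∑ i ∈ Finset.range m, g (2 * i + 1) := by
  induction m with
  | zero => simp
  | succ m ih =>
    rw [show 2 * (m + 1) = 2 * m + 1 + 1 by ring, Finset.sum_range_succ, Finset.sum_range_succ, ih,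
      Finset.sum_range_succ, Finset.sum_range_succ]
    abel

/-- The digits of `T` are the values of the overpartition function below `n`. -/
def EncodesBelow (n T : ℕ) : Prop :=
  T < 2 ^ (160 * n) ∧ ∀ j < n, digit T j = overpartitionCount j

/-- The number that `verify` computes from the packed values is the next value. The two
sums of 21 terms cover the squares up to `42 ^ 2 = 1764`. -/
theorem EncodesBelow.next {n T : ℕ} (hn : 1 ≤ n) (hn' : n < 1764) (h : EncodesBelow n T) :
    2 * strideSum T n 21 1 - 2 * strideSum T n 21 2 = overpartitionCount n := by
  have h1 := PowerSeries.overpartitionCount_recurrence hn (K := 42) (by omega)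
  have h2 : ∑ k ∈ Finset.range 42,
      (if (k + 1) ^ 2 ≤ n then (-1) ^ k * (overpartitionCount (n - (k + 1) ^ 2) : ℤ) else 0)
      = (strideSum T n 21 1 : ℤ) - strideSum T n 21 2 := by
    rw [show 42 = 2 * 21 by norm_num, sum_range_two_mul, strideSum_eq, strideSum_eq, Nat.cast_sum,
      Nat.cast_sum, sub_eq_add_neg, ← Finset.sum_neg_distrib]
    congr 1 <;> refine Finset.sum_congr rfl fun i _ => ?_
    · rw [show 1 + 2 * i = 2 * i + 1 by ring]
      split_ifs
      · rw [h.2 _ (Nat.sub_lt hn (by positivity)), (even_two_mul i).neg_one_pow, one_mul]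
      · rfl
    · rw [show 2 + 2 * i = 2 * i + 1 + 1 by ring]
      split_ifs
      · rw [h.2 _ (Nat.sub_lt hn (by positivity)), (odd_two_mul_add_one i).neg_one_pow, neg_one_mul]
      · rfl
  rw [h2] at h1
  omega

theorem digit_add_of_lt {n T c j : ℕ} (hj : j < n) :
    digit (T + c * 2 ^ (160 * n)) j = digit T j := by
  obtain ⟨i, rfl⟩ := Nat.exists_eq_add_of_lt hj
  rw [digit_def, digit_def]
  have : c * 2 ^ (160 * (j + i + 1)) = (c * 2 ^ (160 * i) * 2 ^ 160) * 2 ^ (160 * j) := by ring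
  rw [this, Nat.add_mul_div_right _ _ (by positivity), Nat.add_mul_mod_self_right]

theorem digit_add_self {n T c : ℕ} (hT : T < 2 ^ (160 * n)) (hc : c < 2 ^ 160) :
    digit (T + c * 2 ^ (160 * n)) n = c := by
  rw [digit_def, Nat.add_mul_div_right _ _ (by positivity), Nat.div_eq_of_lt hT, zero_add,
    Nat.mod_eq_of_lt hc]

theorem EncodesBelow.step {n T c : ℕ} (h : EncodesBelow n T) (hc : c = overpartitionCount n)
    (hc' : c < 2 ^ 160) : EncodesBelow (n + 1) (T + c * 2 ^ (160 * n)) := by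
  refine ⟨?_, fun j hj => ?_⟩
  · have h1 := h.1
    rw [mul_add, pow_add, mul_one]
    calc T + c * 2 ^ (160 * n) < 2 ^ (160 * n) + c * 2 ^ (160 * n) := by omega
      _ = (c + 1) * 2 ^ (160 * n) := by ring
      _ ≤ 2 ^ 160 * 2 ^ (160 * n) := Nat.mul_le_mul_right _ hc'
      _ = _ := mul_comm _ _
  · rcases (Nat.lt_succ_iff.1 hj).lt_or_eq with hj | rfl
    · rw [digit_add_of_lt hj, h.2 j hj]
    · rw [digit_add_self h.1 hc', hc]

theorem verify_sound (f n T : ℕ) (hn : 1 ≤ n) (hf : n + f ≤ 1764) (h : EncodesBelow n T)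
    (hv : verify f n T = true) (m : ℕ) (hm : 18 ≤ m) (hnm : n ≤ m) (hmf : m < n + f) :
    turanTest (overpartitionCount (m - 3)) (overpartitionCount (m - 2))
      (overpartitionCount (m - 1)) (overpartitionCount m) = true := by
  induction f generalizing n T with
  | zero => omega
  | succ f ih =>
    rw [verify_succ, h.next hn (by omega)] at hv
    simp only [Bool.and_eq_true, Bool.or_eq_true, Nat.blt_eq, Nat.ble_eq] at hv
    obtain ⟨hc, ht, hrest⟩ := hv
    have h' := h.step rfl hc
    rcases hnm.lt_or_eq with hlt | rfl
    · exact ih (n + 1) _ (by omega) (by omega) h' hrest hlt (by omega)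
    · rcases ht with ht | ht
      · omega
      · rwa [h'.2 _ (by omega), h'.2 _ (by omega), h'.2 _ (by omega)] at ht

theorem turanTest_eq_true {a b c d : ℕ} (h : turanTest a b c d = true) :
    (0 : ℝ) < 4 * ((b : ℝ) ^ 2 - a * c) * ((c : ℝ) ^ 2 - b * d) - ((b : ℝ) * c - a * d) ^ 2 := by
  have h' : (a * c).blt (b * b) && ((b * d).blt (c * c) && ((a * d).ble (b * c) &&
    ((b * c - a * d) ^ 2).blt (4 * ((b * b - a * c) * (c * c - b * d))))) := h
  simp only [Bool.and_eq_true, Nat.blt_eq, Nat.ble_eq] at h'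
  obtain ⟨h1, h2, h3, h4⟩ := h'
  have h5 : (((b * c - a * d) ^ 2 : ℕ) : ℝ)
      < ((4 * ((b * b - a * c) * (c * c - b * d)) : ℕ) : ℝ) := by exact_mod_cast h4
  push_cast [Nat.cast_sub h1.le, Nat.cast_sub h2.le, Nat.cast_sub h3] at h5
  nlinarith [h5]

theorem overpartitionCount_turan_of_lt (n : ℕ) (hn : 16 ≤ n) (hn' : n ≤ 1223) :
    (0 : ℝ) < 4 * ((overpartitionCount n : ℝ) ^ 2
        - overpartitionCount (n - 1) * overpartitionCount (n + 1))
      * ((overpartitionCount (n + 1) : ℝ) ^ 2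
        - overpartitionCount n * overpartitionCount (n + 2))
      - ((overpartitionCount n : ℝ) * overpartitionCount (n + 1)
        - overpartitionCount (n - 1) * overpartitionCount (n + 2)) ^ 2 := by
  have h0 : EncodesBelow 1 1 := by
    refine ⟨by norm_num, fun j hj => ?_⟩
    obtain rfl : j = 0 := by omega
    rw [PowerSeries.overpartitionCount_zero, digit_def]
    norm_num
  have h := verify_sound 1225 1 1 le_rfl (by norm_num) h0 verify_true (n + 2) (by omega) (by omega)
    (by omega)
  exact turanTest_eq_true h

/-! ### Real roots of cubic polynomials -/

theorem jensenPolynomial_three (γ : ℕ → ℝ) (n : ℕ) :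
    jensenPolynomial γ 3 n = (⟨γ (n + 3), 3 * γ (n + 2), 3 * γ (n + 1), γ n⟩ : Cubic ℝ).toPoly := by
  simp only [jensenPolynomial, Finset.sum_range_succ, Finset.range_zero, Finset.sum_empty,
    Cubic.toPoly]
  norm_num [Nat.choose]
  ring

theorem exists_root_cubic {a b c d : ℝ} (ha : 0 < a) :
    ∃ r : ℝ, a * r ^ 3 + b * r ^ 2 + c * r + d = 0 := by
  have hcont : Continuous fun r : ℝ => a * r ^ 3 + b * r ^ 2 + c * r + d := by fun_prop
  set M : ℝ := 1 + (|b| + |c| + |d|) / a with hM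
  have hS : a * (M - 1) = |b| + |c| + |d| := by rw [hM]; field_simp; ring
  have hM1 : 1 ≤ M := by
    have : 0 ≤ (|b| + |c| + |d|) / a := by positivity
    linarith
  have hM2 : 1 ≤ M ^ 2 := by nlinarith
  have hMM : M ≤ M ^ 2 := by nlinarith
  have hb := abs_le.1 (le_refl |b|)
  have hc := abs_le.1 (le_refl |c|)
  have hd := abs_le.1 (le_refl |d|)
  have hb0 := abs_nonneg b
  have hc0 := abs_nonneg c
  have hd0 := abs_nonneg d
  have h3 : a * M ^ 3 = a * M ^ 2 + (|b| + |c| + |d|) * M ^ 2 := by rw [← hS]; ring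
  have haM : 0 < a * M ^ 2 := by positivity
  have p1 : -|b| * M ^ 2 ≤ b * M ^ 2 ∧ b * M ^ 2 ≤ |b| * M ^ 2 :=
    ⟨by nlinarith, by nlinarith⟩
  have p2 : -|c| * M ^ 2 ≤ c * M ∧ c * M ≤ |c| * M ^ 2 := by
    constructor <;> nlinarith [mul_le_mul_of_nonneg_left hMM hc0]
  have p3 : -|d| * M ^ 2 ≤ d ∧ d ≤ |d| * M ^ 2 := by
    constructor <;> nlinarith [mul_le_mul_of_nonneg_left hM2 hd0]
  have hneg : a * (-M) ^ 3 + b * (-M) ^ 2 + c * (-M) + d ≤ 0 := by nlinarith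
  have hpos : 0 ≤ a * M ^ 3 + b * M ^ 2 + c * M + d := by nlinarith
  obtain ⟨r, -, hr⟩ := intermediate_value_Icc (by linarith : -M ≤ M) hcont.continuousOn
    ⟨hneg, hpos⟩
  exact ⟨r, hr⟩

theorem exists_roots_of_disc_pos {a b c d : ℝ} (ha : 0 < a)
    (h : 0 < b ^ 2 * c ^ 2 - 4 * a * c ^ 3 - 4 * b ^ 3 * d - 27 * a ^ 2 * d ^ 2
      + 18 * a * b * c * d) :
    ∃ x y z : ℝ, x < y ∧ y < z ∧
      ∀ w ∈ ({x, y, z} : Set ℝ), a * w ^ 3 + b * w ^ 2 + c * w + d = 0 := by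
  -- Split off one real root `r`; the discriminant of the cubic is the discriminant of the remaining
  -- quadratic factor `a w² + e w + f` times the square of its value at `r`.
  obtain ⟨r, hr⟩ := exists_root_cubic (b := b) (c := c) (d := d) ha
  obtain rfl : d = -(a * r ^ 3 + b * r ^ 2 + c * r) := by linarith
  obtain ⟨e, rfl⟩ : ∃ e, b = e - a * r := ⟨b + a * r, by ring⟩
  obtain ⟨f, rfl⟩ : ∃ f, c = f - e * r := ⟨c + e * r, by ring⟩
  have h1 : 0 < (e ^ 2 - 4 * a * f) * (a * r ^ 2 + e * r + f) ^ 2 := by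
    refine h.trans_eq ?_
    ring
  have hq : a * r ^ 2 + e * r + f ≠ 0 := by
    intro h0
    simp [h0] at h1
  have hD : 0 < e ^ 2 - 4 * a * f := pos_of_mul_pos_left h1 (sq_nonneg _)
  set s := √(e ^ 2 - 4 * a * f) with hs
  have hs2 : s ^ 2 = e ^ 2 - 4 * a * f := Real.sq_sqrt hD.le
  have hs0 : 0 < s := Real.sqrt_pos.2 hD
  set u := (-e - s) / (2 * a) with hu
  set v := (-e + s) / (2 * a) with hv
  have huv : u < v := by
    rw [hu, hv]
    gcongr
    linarith
  have e1 : a * (u + v) = -e := by rw [hu, hv]; field_simp; ring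
  have e2 : a * (u * v) = f := by
    rw [hu, hv]; field_simp; linear_combination -hs2
  have qu : a * u ^ 2 + e * u + f = 0 := by rw [← e2, show e = -(a * (u + v)) by linarith]; ring
  have qv : a * v ^ 2 + e * v + f = 0 := by rw [← e2, show e = -(a * (u + v)) by linarith]; ring
  have fac (w : ℝ) : a * w ^ 3 + (e - a * r) * w ^ 2 + (f - e * r) * w
      + -(a * r ^ 3 + (e - a * r) * r ^ 2 + (f - e * r) * r)
      = (w - r) * (a * w ^ 2 + e * w + f) := by ring
  simp only [fac, Set.mem_insert_iff, Set.mem_singleton_iff, forall_eq_or_imp, forall_eq]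
  have hur : u ≠ r := fun h0 => hq (h0 ▸ qu)
  have hvr : v ≠ r := fun h0 => hq (h0 ▸ qv)
  rcases lt_or_gt_of_ne hur with h1 | h1
  · rcases lt_or_gt_of_ne hvr with h2 | h2
    · exact ⟨u, v, r, huv, h2, by simp [qu], by simp [qv], by simp⟩
    · exact ⟨u, r, v, h1, h2, by simp [qu], by simp, by simp [qv]⟩
  · exact ⟨r, u, v, h1, huv, by simp, by simp [qu], by simp [qv]⟩

/-- Vieta's formulas for a cubic with three distinct roots. -/
theorem cubic_eq_of_roots {a b c d x y z : ℝ} (hxy : x < y) (hyz : y < z)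
    (hx : a * x ^ 3 + b * x ^ 2 + c * x + d = 0) (hy : a * y ^ 3 + b * y ^ 2 + c * y + d = 0)
    (hz : a * z ^ 3 + b * z ^ 2 + c * z + d = 0) :
    b = -a * (x + y + z) ∧ c = a * (x * y + x * z + y * z) ∧ d = -a * (x * y * z) := by
  have h1 : a * (x ^ 2 + x * y + y ^ 2) + b * (x + y) + c = 0 := by
    refine mul_left_cancel₀ (sub_ne_zero.2 hxy.ne) ?_
    linear_combination hx - hy
  have h2 : a * (y ^ 2 + y * z + z ^ 2) + b * (y + z) + c = 0 := by
    refine mul_left_cancel₀ (sub_ne_zero.2 hyz.ne) ?_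
    linear_combination hy - hz
  have h3 : b = -a * (x + y + z) := by
    refine mul_left_cancel₀ (sub_ne_zero.2 (hxy.trans hyz).ne) ?_
    linear_combination h1 - h2
  have h4 : c = a * (x * y + x * z + y * z) := by
    rw [h3] at h1
    linear_combination h1
  refine ⟨h3, h4, ?_⟩
  rw [h3, h4] at hx
  linear_combination hx

theorem disc_pos_iff_roots {a b c d : ℝ} (ha : 0 < a) :
    0 < b ^ 2 * c ^ 2 - 4 * a * c ^ 3 - 4 * b ^ 3 * d - 27 * a ^ 2 * d ^ 2 + 18 * a * b * c * d ↔
    ∃ x y z : ℝ, x < y ∧ y < z ∧ (⟨a, b, c, d⟩ : Cubic ℝ).toPoly.IsRoot x ∧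
      (⟨a, b, c, d⟩ : Cubic ℝ).toPoly.IsRoot y ∧ (⟨a, b, c, d⟩ : Cubic ℝ).toPoly.IsRoot z := by
  have ev (w : ℝ) : (⟨a, b, c, d⟩ : Cubic ℝ).toPoly.IsRoot w
      ↔ a * w ^ 3 + b * w ^ 2 + c * w + d = 0 := by
    simp [Cubic.toPoly, IsRoot]
  simp only [ev]
  constructor
  · intro h
    obtain ⟨x, y, z, hxy, hyz, hr⟩ := exists_roots_of_disc_pos ha h
    exact ⟨x, y, z, hxy, hyz, hr x (by simp), hr y (by simp), hr z (by simp)⟩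
  · rintro ⟨x, y, z, hxy, hyz, hx, hy, hz⟩
    obtain ⟨rfl, rfl, rfl⟩ := cubic_eq_of_roots hxy hyz hx hy hz
    have : 0 < a ^ 4 * ((y - x) * (z - y) * (z - x)) ^ 2 := by
      have := sub_pos.2 hxy
      have := sub_pos.2 hyz
      have := sub_pos.2 (hxy.trans hyz)
      positivity
    refine this.trans_eq ?_
    ring

theorem isHyperbolic_of_roots {a b c d x y z : ℝ} (ha : 0 < a) (hxy : x < y) (hyz : y < z)
    (hx : (⟨a, b, c, d⟩ : Cubic ℝ).toPoly.IsRoot x) (hy : (⟨a, b, c, d⟩ : Cubic ℝ).toPoly.IsRoot y)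
    (hz : (⟨a, b, c, d⟩ : Cubic ℝ).toPoly.IsRoot z) :
    IsHyperbolic (⟨a, b, c, d⟩ : Cubic ℝ).toPoly := by
  have ev (w : ℝ) : (⟨a, b, c, d⟩ : Cubic ℝ).toPoly.IsRoot w
      ↔ a * w ^ 3 + b * w ^ 2 + c * w + d = 0 := by
    simp [Cubic.toPoly, IsRoot]
  rw [ev] at hx hy hz
  obtain ⟨rfl, rfl, rfl⟩ := cubic_eq_of_roots hxy hyz hx hy hz
  intro w hw
  have h : (a : ℂ) * ((w - x) * (w - y) * (w - z)) = 0 := by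
    rw [← hw]
    simp [Cubic.toPoly]
    ring
  simp only [mul_eq_zero, Complex.ofReal_eq_zero, ha.ne', false_or, sub_eq_zero] at h
  rcases h with (rfl | rfl) | rfl <;> simp

/-- The Turán expression in terms of ratios and, after clearing denominators, in terms of the
values themselves. -/
theorem ratio_turan_eq {p₀ p₁ p₂ p₃ : ℝ} (h₁ : 0 < p₁) (h₂ : 0 < p₂) :
    4 * (1 - p₀ * p₂ / p₁ ^ 2) * (1 - p₁ * p₃ / p₂ ^ 2)
        - (1 - p₀ * p₂ / p₁ ^ 2 * (p₁ * p₃ / p₂ ^ 2)) ^ 2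
      = (4 * (p₁ ^ 2 - p₀ * p₂) * (p₂ ^ 2 - p₁ * p₃) - (p₁ * p₂ - p₀ * p₃) ^ 2)
        / (p₁ ^ 2 * p₂ ^ 2) := by
  field_simp

/-! ### The theta function and its product formula -/

/-- Jacobi's `θ₄` as a function of the nome: `∑ (-1) ^ m q ^ (m²)` over all integers `m`, for
`‖q‖ < 1`. -/
noncomputable def theta4 (q : ℂ) : ℂ := 1 + 2 * ∑' s : ℕ, (-1) ^ (s + 1) * q ^ ((s + 1) ^ 2)

theorem summable_theta4 {q : ℂ} (hq : ‖q‖ < 1) :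
    Summable fun s : ℕ => (-1) ^ (s + 1) * q ^ ((s + 1) ^ 2) := by
  refine Summable.of_norm_bounded (g := fun s : ℕ => ‖q‖ ^ s)
    (summable_geometric_of_lt_one (norm_nonneg _) hq) fun s => ?_
  rw [norm_mul, norm_pow, norm_neg, norm_one, one_pow, one_mul, norm_pow]
  exact pow_le_pow_of_le_one (norm_nonneg _) hq.le (by nlinarith)

theorem one_sub_norm_pow_le {q : ℂ} {k : ℕ} : 1 - ‖q‖ ^ k ≤ ‖1 + q ^ k‖ := by
  have := norm_sub_norm_le (1 : ℂ) (-(q ^ k))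
  simpa using this

theorem norm_factor_le {q : ℂ} (hq : ‖q‖ < 1) {k : ℕ} (hk : 1 ≤ k) :
    ‖(1 - q ^ k) * (1 + q ^ k)⁻¹‖ ≤ Real.exp (2 / (1 - ‖q‖) * ‖q‖ ^ k) := by
  have h0 := norm_nonneg q
  have h1 : ‖q‖ ^ k ≤ ‖q‖ := pow_le_of_le_one h0 hq.le (by omega)
  have h2 : (0 : ℝ) < 1 - ‖q‖ := by linarith
  have h3 : 0 ≤ ‖q‖ ^ k := by positivity
  have h4 : ‖1 - q ^ k‖ ≤ 1 + ‖q‖ ^ k := by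
    have := norm_sub_le (1 : ℂ) (q ^ k)
    simpa using this
  have h5 := one_sub_norm_pow_le (q := q) (k := k)
  rw [norm_mul, norm_inv, ← div_eq_mul_inv]
  calc ‖1 - q ^ k‖ / ‖1 + q ^ k‖ ≤ (1 + ‖q‖ ^ k) / (1 - ‖q‖ ^ k) := by
        gcongr; linarith
    _ = 1 + 2 * ‖q‖ ^ k / (1 - ‖q‖ ^ k) := by
        have : 1 - ‖q‖ ^ k ≠ 0 := by linarith
        field_simp; ring
    _ ≤ 1 + 2 * ‖q‖ ^ k / (1 - ‖q‖) := by gcongr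
    _ = 2 / (1 - ‖q‖) * ‖q‖ ^ k + 1 := by ring
    _ ≤ _ := Real.add_one_le_exp _

theorem norm_prod_factor_le {q : ℂ} (hq : ‖q‖ < 1) (s n : ℕ) :
    ‖∏ k ∈ Finset.Ioc s n, (1 - q ^ k) * (1 + q ^ k)⁻¹‖
      ≤ Real.exp (2 / (1 - ‖q‖) * (1 - ‖q‖)⁻¹) := by
  have h2 : (0 : ℝ) < 1 - ‖q‖ := by linarith
  rw [norm_prod]
  calc ∏ k ∈ Finset.Ioc s n, ‖(1 - q ^ k) * (1 + q ^ k)⁻¹‖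
      ≤ ∏ k ∈ Finset.Ioc s n, Real.exp (2 / (1 - ‖q‖) * ‖q‖ ^ k) :=
        Finset.prod_le_prod (fun _ _ => norm_nonneg _) fun k hk =>
          norm_factor_le hq (by have := (Finset.mem_Ioc.1 hk).1; omega)
    _ = Real.exp (2 / (1 - ‖q‖) * ∑ k ∈ Finset.Ioc s n, ‖q‖ ^ k) := by
        rw [← Real.exp_sum, Finset.mul_sum]
    _ ≤ _ := by
        gcongr
        rw [← tsum_geometric_of_lt_one (norm_nonneg q) hq]
        exact (summable_geometric_of_lt_one (norm_nonneg q) hq).sum_le_tsum _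
          fun _ _ => by positivity

theorem one_add_pow_ne_zero {q : ℂ} (hq : ‖q‖ < 1) {k : ℕ} (hk : 1 ≤ k) : 1 + q ^ k ≠ 0 := by
  intro h
  have h1 : ‖q‖ ^ k < 1 := pow_lt_one₀ (norm_nonneg _) hq (by omega)
  have := one_sub_norm_pow_le (q := q) (k := k)
  rw [h, norm_zero] at this
  linarith

/-- Gauss's product formula for `θ₄`. -/
theorem tendsto_prod_theta4 {q : ℂ} (hq : ‖q‖ < 1) :
    Tendsto (fun n => ∏ k ∈ Finset.Ioc 0 n, (1 - q ^ k) * (1 + q ^ k)⁻¹) atTop (𝓝 (theta4 q)) := by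
  have h2 : (0 : ℝ) < 1 - ‖q‖ := by linarith
  have hG (n : ℕ) := gauss_finite q (fun k => (1 + q ^ k)⁻¹)
    (fun k hk => inv_mul_cancel₀ (one_add_pow_ne_zero hq hk)) n
  have hS : Tendsto (fun n => 1 + 2 * ∑ s ∈ Finset.range n, (-1) ^ (s + 1) * q ^ ((s + 1) ^ 2))
      atTop (𝓝 (theta4 q)) :=
    ((summable_theta4 hq).hasSum.tendsto_sum_nat.const_mul 2).const_add 1
  set B := Real.exp (2 / (1 - ‖q‖) * (1 - ‖q‖)⁻¹) with hB
  have hE : Tendsto (fun n : ℕ => 2 * ∑ s ∈ Finset.range n, (-1) ^ (s + 1) * (1 + q ^ (s + 1))⁻¹ *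
      (∏ k ∈ Finset.Ioc (s + 1) n, (1 - q ^ k) * (1 + q ^ k)⁻¹) * q ^ ((s + 1) * (n + 1)))
      atTop (𝓝 0) := by
    have hlim : Tendsto (fun n : ℕ => 2 * ((1 - ‖q‖)⁻¹ * B) * (n * ‖q‖ ^ n)) atTop (𝓝 0) := by
      simpa using (tendsto_self_mul_const_pow_of_lt_one (norm_nonneg q) hq).const_mul
        (2 * ((1 - ‖q‖)⁻¹ * B))
    refine squeeze_zero_norm (fun n => ?_) hlim
    rw [norm_mul, Complex.norm_ofNat, mul_assoc 2]
    gcongr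
    refine (norm_sum_le _ _).trans ?_
    calc _ ≤ ∑ s ∈ Finset.range n, ((1 - ‖q‖)⁻¹ * B) * ‖q‖ ^ n := by
          refine Finset.sum_le_sum fun s _ => ?_
          rw [norm_mul, norm_mul, norm_mul, norm_pow, norm_neg, norm_one, one_pow, one_mul,
            norm_inv, norm_pow]
          have h5 := one_sub_norm_pow_le (q := q) (k := s + 1)
          have h1 : ‖q‖ ^ (s + 1) ≤ ‖q‖ := pow_le_of_le_one (norm_nonneg _) hq.le (by omega)
          gcongr ?_ * ?_ * ?_
          · exact inv_anti₀ h2 (by linarith)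
          · exact norm_prod_factor_le hq _ _
          · exact pow_le_pow_of_le_one (norm_nonneg _) hq.le (by nlinarith)
      _ = _ := by
          rw [Finset.sum_const, Finset.card_range, nsmul_eq_mul]
          ring
  have := hS.sub hE
  rw [sub_zero] at this
  refine this.congr fun n => ?_
  rw [hG n]
  ring

/-! ### Comparison of `θ₄(q)` with `θ₄(‖q‖)` -/

/-- The Taylor series of `log ((1 + x) / (1 - x))` has nonnegative coefficients, the first of which
is `2`. Hence passing from `x` to `‖x‖` increases its real part by at least `2 (‖x‖ - re x)`. -/
theorem log_ratio_sub_le {x : ℂ} (hx : ‖x‖ < 1) :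
    Real.log ‖1 + x‖ - Real.log ‖1 - x‖ + 2 * (‖x‖ - x.re)
      ≤ Real.log (1 + ‖x‖) - Real.log (1 - ‖x‖) := by
  have key (y : ℂ) (hy : ‖y‖ < 1) :
      HasSum (fun n : ℕ => (((-1) ^ (n + 1) * y ^ n / n + y ^ n / n : ℂ)).re)
      (Real.log ‖1 + y‖ - Real.log ‖1 - y‖) := by
    have := ((Complex.hasSum_taylorSeries_log hy).add (Complex.hasSum_taylorSeries_neg_log hy))
    have := Complex.hasSum_re this
    simpa [Complex.log_re, sub_eq_add_neg] using this
  have h1 := key x hx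
  have h2 := key (‖x‖ : ℂ) (by simpa using hx)
  have h3 := h2.sub h1
  have e1 : ‖(1 : ℂ) + (‖x‖ : ℂ)‖ = 1 + ‖x‖ := by
    rw [← Complex.ofReal_one, ← Complex.ofReal_add, Complex.norm_real, Real.norm_of_nonneg]
    positivity
  have e2 : ‖(1 : ℂ) - (‖x‖ : ℂ)‖ = 1 - ‖x‖ := by
    rw [← Complex.ofReal_one, ← Complex.ofReal_sub, Complex.norm_real, Real.norm_of_nonneg]
    linarith
  rw [e1, e2] at h3
  have fac (y : ℂ) (n : ℕ) : (-1) ^ (n + 1) * y ^ n / n + y ^ n / n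
      = ((((-1) ^ (n + 1) + 1) / n : ℝ) : ℂ) * y ^ n := by
    push_cast
    ring
  have h4 := le_hasSum h3 1 fun n _ => by
    rw [fac, fac, Complex.re_ofReal_mul, Complex.re_ofReal_mul, ← mul_sub]
    refine mul_nonneg (div_nonneg ?_ (by positivity)) ?_
    · rcases neg_one_pow_eq_or ℝ (n + 1) with h | h <;> rw [h] <;> norm_num
    · rw [sub_nonneg, ← Complex.ofReal_pow, Complex.ofReal_re, ← norm_pow]
      exact Complex.re_le_norm _
  norm_num at h4
  linarith

theorem factor_lower_bound {x : ℂ} (hx : ‖x‖ < 1) :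
    ‖(1 - (‖x‖ : ℂ)) * (1 + (‖x‖ : ℂ))⁻¹‖ * Real.exp (2 * (‖x‖ - x.re))
      ≤ ‖(1 - x) * (1 + x)⁻¹‖ := by
  have h0 := norm_nonneg x
  have e1 : ‖(1 : ℂ) + (‖x‖ : ℂ)‖ = 1 + ‖x‖ := by
    rw [← Complex.ofReal_one, ← Complex.ofReal_add, Complex.norm_real, Real.norm_of_nonneg]
    positivity
  have e2 : ‖(1 : ℂ) - (‖x‖ : ℂ)‖ = 1 - ‖x‖ := by
    rw [← Complex.ofReal_one, ← Complex.ofReal_sub, Complex.norm_real, Real.norm_of_nonneg]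
    linarith
  have h := log_ratio_sub_le hx
  have p1 : 0 < ‖1 + x‖ := norm_pos_iff.2 (by simpa using one_add_pow_ne_zero hx (k := 1) le_rfl)
  have p2 : 0 < ‖1 - x‖ := norm_pos_iff.2 (by
    simpa [sub_eq_add_neg] using one_add_pow_ne_zero (q := -x) (by simpa using hx) (k := 1) le_rfl)
  rw [norm_mul, norm_inv, norm_mul, norm_inv, e1, e2]
  have p3 : 0 < 1 - ‖x‖ := by linarith
  have p4 : 0 < 1 + ‖x‖ := by linarith
  rw [← Real.log_le_log_iff (by positivity) (by positivity), Real.log_mul (by positivity)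
    (Real.exp_ne_zero _), Real.log_mul p3.ne' (by positivity), Real.log_mul p2.ne' (by positivity),
    Real.log_exp, Real.log_inv, Real.log_inv]
  linarith

/-- Off the positive real axis `θ₄` is larger by a factor that is exponential in the gap between
`∑ ‖q‖ ^ k` and `∑ re (q ^ k)`. -/
theorem theta4_lower_bound {q : ℂ} (hq : ‖q‖ < 1) :
    ‖theta4 (‖q‖ : ℂ)‖ * Real.exp (2 * (‖q‖ / (1 - ‖q‖) - (q / (1 - q)).re)) ≤ ‖theta4 q‖ := by
  have hr : ‖(‖q‖ : ℂ)‖ < 1 := by simpa using hq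
  have t1 := (tendsto_prod_theta4 hq).norm
  have t2 := (tendsto_prod_theta4 hr).norm
  have s1 : Tendsto (fun n => ∑ k ∈ Finset.range n, ‖q‖ ^ (k + 1)) atTop
      (𝓝 (‖q‖ / (1 - ‖q‖))) := by
    have := ((hasSum_geometric_of_lt_one (norm_nonneg q) hq).mul_left ‖q‖).tendsto_sum_nat
    simpa only [pow_succ', div_eq_mul_inv] using this
  have s2 : Tendsto (fun n => ∑ k ∈ Finset.range n, (q ^ (k + 1)).re) atTop
      (𝓝 (q / (1 - q)).re) := by
    have := (Complex.hasSum_re ((hasSum_geometric_of_norm_lt_one hq).mul_left q)).tendsto_sum_nat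
    simpa only [pow_succ', div_eq_mul_inv] using this
  refine le_of_tendsto_of_tendsto' (t2.mul
    (((s1.sub s2).const_mul 2).rexp)) t1 fun n => ?_
  have hI (f : ℕ → ℝ) : ∑ k ∈ Finset.range n, f (k + 1) = ∑ k ∈ Finset.Ioc 0 n, f k := by
    rw [Finset.range_eq_Ico, Finset.sum_Ico_add' f 0 n 1]
    rfl
  rw [hI (fun k => ‖q‖ ^ k), hI (fun k => (q ^ k).re), ← Finset.sum_sub_distrib, Finset.mul_sum,
    Real.exp_sum, norm_prod, norm_prod, ← Finset.prod_mul_distrib]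
  refine Finset.prod_le_prod (fun _ _ => by positivity) fun k hk => ?_
  have hk' : ‖q ^ k‖ < 1 := by
    rw [norm_pow]
    exact pow_lt_one₀ (norm_nonneg _) hq (by have := (Finset.mem_Ioc.1 hk).1; omega)
  have := factor_lower_bound hk'
  rw [norm_pow] at this
  push_cast at this
  exact this

/-! ### Modular transformation of `θ₄` -/

/-- The correction in the transformed theta function, `∑ exp (-π² (j + 1) (j + 2) / t)` over
`j ≥ 0`: all terms but the leading pair, relative to the leading one. -/
noncomputable def thetaTail (t : ℂ) : ℂ :=
  ∑' j : ℕ, Complex.exp (-(Real.pi ^ 2 * ((j + 1) * (j + 2))) / t)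

theorem jacobiTheta₂_eq_nat_sums (z : ℂ) {τ : ℂ} (hτ : 0 < τ.im) :
    jacobiTheta₂ z τ = (jacobiTheta₂_term 0 z τ + ∑' n : ℕ, jacobiTheta₂_term (n + 1 : ℕ) z τ)
      + ∑' n : ℕ, jacobiTheta₂_term (-(n + 1)) z τ := by
  have hs := (summable_jacobiTheta₂_term_iff z τ).2 hτ
  have h1 : Summable fun n : ℕ => jacobiTheta₂_term n z τ := hs.comp_injective Nat.cast_injective
  have h2 : Summable fun n : ℕ => jacobiTheta₂_term (-(n + 1)) z τ :=
    hs.comp_injective (i := fun n : ℕ => -((n : ℤ) + 1)) fun a b h => by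
      simp only at h; omega
  have h3 := tsum_of_nat_of_neg_add_one (f := fun n : ℤ => jacobiTheta₂_term n z τ) h1
    (by simpa only [Int.cast_add, Int.cast_natCast] using h2)
  rw [h1.tsum_eq_zero_add] at h3
  exact h3

theorem thetaTail_exponent_re {t : ℂ} (j : ℕ) :
    (-(Real.pi ^ 2 * (((j : ℂ) + 1) * (j + 2))) / t).re
      = -(Real.pi ^ 2 * (((j : ℝ) + 1) * (j + 2)) * (1 / t).re) := by
  have : -(Real.pi ^ 2 * (((j : ℂ) + 1) * (j + 2))) / t
      = ((-(Real.pi ^ 2 * (((j : ℝ) + 1) * (j + 2))) : ℝ) : ℂ) * (1 / t) := by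
    push_cast
    ring
  rw [this, Complex.re_ofReal_mul, neg_mul]

theorem norm_thetaTail_term_le {t : ℂ} (ht : 0 < (1 / t).re) (j : ℕ) :
    ‖Complex.exp (-(Real.pi ^ 2 * (((j : ℂ) + 1) * (j + 2))) / t)‖
      ≤ Real.exp (-(2 * Real.pi ^ 2 * (1 / t).re)) ^ (j + 1) := by
  rw [Complex.norm_exp, thetaTail_exponent_re, ← Real.exp_nat_mul]
  gcongr
  have : 0 ≤ Real.pi ^ 2 * (1 / t).re * (((j : ℝ) + 1) * j) := by positivity
  push_cast
  nlinarith

theorem re_one_div_pos {t : ℂ} (ht : 0 < t.re) : 0 < (1 / t).re := by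
  rw [one_div, Complex.inv_re]
  exact div_pos ht (Complex.normSq_pos.2 (by rintro rfl; simp at ht))

theorem exp_neg_re_lt_one {t : ℂ} (ht : 0 < (1 / t).re) :
    Real.exp (-(2 * Real.pi ^ 2 * (1 / t).re)) < 1 := by
  rw [Real.exp_lt_one_iff, neg_lt_zero]
  have := Real.pi_pos
  positivity

theorem summable_thetaTail {t : ℂ} (ht : 0 < (1 / t).re) :
    Summable fun j : ℕ => Complex.exp (-(Real.pi ^ 2 * (((j : ℂ) + 1) * (j + 2))) / t) := by
  refine Summable.of_norm_bounded ?_ (norm_thetaTail_term_le ht)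
  exact (summable_nat_add_iff 1).2
    (summable_geometric_of_lt_one (Real.exp_pos _).le (exp_neg_re_lt_one ht))

theorem norm_thetaTail_le {t : ℂ} (ht : 0 < (1 / t).re)
    (hx : Real.exp (-(2 * Real.pi ^ 2 * (1 / t).re)) ≤ 1 / 2) :
    ‖thetaTail t‖ ≤ 2 * Real.exp (-(2 * Real.pi ^ 2 * (1 / t).re)) := by
  set x := Real.exp (-(2 * Real.pi ^ 2 * (1 / t).re)) with hxdef
  have hx0 : 0 < x := Real.exp_pos _
  have hg := (hasSum_geometric_of_lt_one hx0.le (exp_neg_re_lt_one ht)).mul_left x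
  simp only [← pow_succ'] at hg
  refine (tsum_of_norm_bounded hg (norm_thetaTail_term_le ht)).trans ?_
  rw [mul_comm]
  gcongr
  rw [inv_le_comm₀ (by linarith) (by norm_num)]
  linarith

open Real in
/-- The functional equation of `jacobiTheta₂` at `z = 1 / 2`, with `τ = I * t / π`. -/
theorem theta4_exp_neg {t : ℂ} (ht : 0 < t.re) :
    theta4 (Complex.exp (-t)) = 2 * (1 / (t / π) ^ (1 / 2 : ℂ)) * Complex.exp (-(π ^ 2 / 4) / t)
      * (1 + thetaTail t) := by
  have hπ : (π : ℂ) ≠ 0 := by exact_mod_cast pi_ne_zero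
  have ht0 : t ≠ 0 := by rintro rfl; simp at ht
  have hI := Complex.I_mul_I
  have hI0 := Complex.I_ne_zero
  set τ : ℂ := Complex.I * t / π with hτ
  have hτim : 0 < τ.im := by
    have : τ = Complex.I * (((1 / π : ℝ) : ℂ) * t) := by rw [hτ]; push_cast; ring
    rw [this, Complex.I_mul_im, Complex.re_ofReal_mul]
    have := Real.pi_pos
    positivity
  have hτim' : 0 < (-1 / τ).im := by
    have : -1 / τ = Complex.I * ((π : ℝ) * (1 / t)) := by
      rw [hτ]; field_simp; linear_combination -hI
    rw [this, Complex.I_mul_im, Complex.re_ofReal_mul]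
    exact mul_pos Real.pi_pos (re_one_div_pos ht)
  have hq : ‖Complex.exp (-t)‖ < 1 := by
    rw [Complex.norm_exp]; simpa using ht
  have h1 : jacobiTheta₂ (1 / 2) τ = theta4 (Complex.exp (-t)) := by
    have term (n : ℤ) (m : ℕ) (h : n.natAbs = m) : jacobiTheta₂_term n (1 / 2) τ
        = (-1) ^ m * Complex.exp (-t) ^ (m ^ 2) := by
      have e1 : 2 * π * Complex.I * n * (1 / 2) + π * Complex.I * n ^ 2 * τ
          = n * (π * Complex.I) + ((m ^ 2 : ℕ) : ℂ) * (-t) := by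
        have : ((m ^ 2 : ℕ) : ℂ) = (n : ℂ) ^ 2 := by
          rw [← h, Nat.cast_pow, ← Int.cast_natCast n.natAbs, ← Int.cast_pow, Int.natAbs_sq,
            Int.cast_pow]
        rw [this, hτ]
        field_simp
        linear_combination (n : ℂ) ^ 2 * t * hI
      rw [jacobiTheta₂_term, e1, Complex.exp_add, Complex.exp_nat_mul, Complex.exp_int_mul,
        Complex.exp_pi_mul_I]
      congr 1
      rcases Int.natAbs_eq n with h' | h' <;> rw [h', h]
      · simp
      · rw [zpow_neg, zpow_natCast, ← inv_pow]
        norm_num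
    rw [jacobiTheta₂_eq_nat_sums _ hτim, term 0 0 rfl,
      tsum_congr fun n : ℕ => term (n + 1 : ℕ) (n + 1) (by omega),
      tsum_congr fun n : ℕ => term (-(n + 1)) (n + 1) (by omega), theta4]
    simp only [pow_zero, one_mul, ne_eq, OfNat.ofNat_ne_zero, not_false_eq_true, zero_pow]
    ring
  have h2 : jacobiTheta₂ (1 / 2 / τ) (-1 / τ) = 2 * (1 + thetaTail t) := by
    have term (n : ℤ) : jacobiTheta₂_term n (1 / 2 / τ) (-1 / τ)
        = Complex.exp (-(π ^ 2 * ((n - 1) * n)) / t) := by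
      rw [jacobiTheta₂_term]
      congr 1
      rw [hτ]
      field_simp
      ring
    have hs := summable_thetaTail (re_one_div_pos ht)
    rw [jacobiTheta₂_eq_nat_sums _ hτim']
    simp only [term]
    have e1 : ∑' n : ℕ, Complex.exp (-(π ^ 2 * ((((n + 1 : ℕ) : ℤ) - 1) * ((n + 1 : ℕ) : ℤ))) / t)
        = 1 + thetaTail t := by
      have e (n : ℕ) :
          Complex.exp (-(π ^ 2 * ((((n + 1 + 1 : ℕ) : ℤ) - 1) * ((n + 1 + 1 : ℕ) : ℤ))) / t)
          = Complex.exp (-(Real.pi ^ 2 * (((n : ℂ) + 1) * (n + 2))) / t) := by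
        congr 3
        push_cast
        ring
      rw [((summable_nat_add_iff 1).1 (by simpa only [e] using hs)).tsum_eq_zero_add,
        tsum_congr e, thetaTail]
      simp
    have e2 :
        ∑' n : ℕ, Complex.exp (-(π ^ 2 * (((-((n : ℤ) + 1) : ℤ) - 1) * (-((n : ℤ) + 1) : ℤ))) / t)
        = thetaTail t := by
      refine tsum_congr fun n => ?_
      congr 3
      push_cast
      ring
    rw [e1, e2]
    simp
    ring
  rw [← h1, jacobiTheta₂_functional_equation, h2]
  have e1 : -Complex.I * τ = t / π := by
    rw [hτ]; field_simp; linear_combination -hI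
  have e2 : -π * Complex.I * (1 / 2) ^ 2 / τ = -(π ^ 2 / 4) / t := by
    rw [hτ]; field_simp; ring
  rw [e1, e2]
  ring

open Real in
theorem le_norm_theta4_exp_neg {σ : ℝ} (hσ : 0 < σ) :
    2 * (1 / √(σ / π)) * Real.exp (-(π ^ 2 / 4) / σ) ≤ ‖theta4 (Real.exp (-σ) : ℂ)‖ := by
  have h := theta4_exp_neg (t := (σ : ℂ)) (by simpa using hσ)
  rw [Complex.ofReal_exp, Complex.ofReal_neg, h, norm_mul, norm_mul, norm_mul]
  have hπ := Real.pi_pos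
  have e1 : ‖(1 : ℂ) / ((σ : ℂ) / π) ^ (1 / 2 : ℂ)‖ = 1 / √(σ / π) := by
    rw [norm_div, norm_one, ← Complex.ofReal_div,
      Complex.norm_cpow_eq_rpow_re_of_pos (by positivity), Real.sqrt_eq_rpow]
    norm_num
  have e2 : ‖Complex.exp (-((π : ℂ) ^ 2 / 4) / σ)‖ = Real.exp (-(π ^ 2 / 4) / σ) := by
    rw [← Complex.norm_of_nonneg (Real.exp_pos _).le]
    push_cast
    rfl
  have e3 : thetaTail σ = ((∑' j : ℕ, Real.exp (-(π ^ 2 * ((j + 1) * (j + 2))) / σ) : ℝ) : ℂ) := by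
    rw [thetaTail]
    push_cast
    rfl
  have e4 : 1 ≤ ‖1 + thetaTail σ‖ := by
    have h0 : 0 ≤ ∑' j : ℕ, Real.exp (-(π ^ 2 * ((j + 1) * (j + 2))) / σ) :=
      tsum_nonneg fun _ => (Real.exp_pos _).le
    rw [e3, ← Complex.ofReal_one, ← Complex.ofReal_add, Complex.norm_of_nonneg (by positivity)]
    linarith
  rw [e1, e2, Complex.norm_ofNat]
  exact le_mul_of_one_le_right (by positivity) e4

/-! ### Overpartition numbers as Cauchy integrals -/

theorem theta4_ne_zero {q : ℂ} (hq : ‖q‖ < 1) : theta4 q ≠ 0 := by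
  have h := theta4_lower_bound hq
  have h0 : 0 < ‖theta4 (‖q‖ : ℂ)‖ := by
    rcases (norm_nonneg q).eq_or_lt with h0 | h0
    · rw [← h0]
      simp [theta4]
    · have e := le_norm_theta4_exp_neg (σ := -Real.log ‖q‖) (by
        have := Real.log_neg h0 hq
        linarith)
      rw [neg_neg, Real.exp_log h0] at e
      refine lt_of_lt_of_le ?_ e
      have := Real.log_neg h0 hq
      have : 0 < -Real.log ‖q‖ := by linarith
      have := Real.pi_pos
      positivity
  rw [← norm_pos_iff]
  exact lt_of_lt_of_le (by positivity) h

theorem differentiableOn_theta4 : DifferentiableOn ℂ theta4 (Metric.ball 0 1) := by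
  intro q hq
  rw [mem_ball_zero_iff] at hq
  obtain ⟨r, hqr, hr1⟩ := exists_between hq
  have hr0 : 0 ≤ r := (norm_nonneg q).trans hqr.le
  have hd : DifferentiableOn ℂ (fun z : ℂ => ∑' s : ℕ, (-1) ^ (s + 1) * z ^ ((s + 1) ^ 2))
      (Metric.ball 0 r) := by
    refine Complex.differentiableOn_tsum_of_summable_norm (u := fun s => r ^ s)
      (summable_geometric_of_lt_one hr0 hr1) (fun s => by fun_prop) Metric.isOpen_ball
      fun s w hw => ?_
    rw [mem_ball_zero_iff] at hw
    rw [norm_mul, norm_pow, norm_neg, norm_one, one_pow, one_mul, norm_pow]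
    calc ‖w‖ ^ ((s + 1) ^ 2) ≤ r ^ ((s + 1) ^ 2) := by gcongr
      _ ≤ r ^ s := pow_le_pow_of_le_one hr0 hr1.le (by nlinarith)
  have := (hd.differentiableAt (Metric.isOpen_ball.mem_nhds (mem_ball_zero_iff.2 hqr)))
  exact ((this.const_mul 2).const_add 1).differentiableWithinAt

theorem hasSum_thetaSeries {z : ℂ} (hz : ‖z‖ < 1) :
    HasSum (fun m : ℕ => z ^ m * ((PowerSeries.coeff m PowerSeries.thetaSeries : ℤ) : ℂ))
      (theta4 z) := by
  have hinj : Function.Injective fun s : ℕ => (s + 1) ^ 2 := fun a b h => by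
    have := Nat.pow_left_injective (n := 2) (by norm_num) h
    omega
  set g : ℕ → ℂ := fun m =>
    if m = 0 then 0 else z ^ m * ((PowerSeries.coeff m PowerSeries.thetaSeries : ℤ) : ℂ) with hg
  have h1 : HasSum g (2 * ∑' s : ℕ, (-1) ^ (s + 1) * z ^ ((s + 1) ^ 2)) := by
    rw [← hinj.hasSum_iff]
    · have : (g ∘ fun s : ℕ => (s + 1) ^ 2)
          = fun s => 2 * ((-1) ^ (s + 1) * z ^ ((s + 1) ^ 2)) := by
        funext s
        have hpar : ((-1 : ℤ)) ^ ((s + 1) ^ 2) = (-1) ^ (s + 1) := by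
          rcases Nat.even_or_odd (s + 1) with h | h
          · rw [h.neg_one_pow, (h.pow_of_ne_zero two_ne_zero).neg_one_pow]
          · rw [h.neg_one_pow, h.pow.neg_one_pow]
        have h0 : (s + 1) ^ 2 ≠ 0 := by positivity
        have hsq : IsSquare ((s + 1) ^ 2) := ⟨s + 1, sq _⟩
        simp only [hg, Function.comp_apply, h0, PowerSeries.thetaSeries, PowerSeries.coeff_mk,
          hsq, hpar, if_true, if_false]
        push_cast
        ring
      rw [this]
      exact (summable_theta4 hz).hasSum.mul_left 2
    · intro m hm
      simp only [hg]
      split_ifs with h0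
      · rfl
      · rw [PowerSeries.thetaSeries, PowerSeries.coeff_mk, if_neg h0, if_neg]
        · simp
        · rintro ⟨r, rfl⟩
          obtain ⟨r, rfl⟩ : ∃ k, r = k + 1 :=
            Nat.exists_eq_succ_of_ne_zero (by rintro rfl; simp at h0)
          exact hm ⟨r, sq _⟩
  have h2 := (hasSum_ite_eq (0 : ℕ) (1 : ℂ)).add h1
  rw [theta4]
  have e : (fun m : ℕ => z ^ m * ((PowerSeries.coeff m PowerSeries.thetaSeries : ℤ) : ℂ))
      = fun m => (if m = 0 then (1 : ℂ) else 0) + g m := by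
    funext m
    by_cases h : m = 0
    · subst h
      simp [hg, PowerSeries.thetaSeries]
    · simp [hg, h]
  rw [e]
  exact h2

/-- Any power series that represents `1 / θ₄` near the origin has the overpartition numbers as its
coefficients. -/
theorem eq_overpartitionCount_of_hasSum {a : ℕ → ℂ}
    (h : ∀ᶠ z : ℂ in 𝓝 0, HasSum (fun n => z ^ n * a n) (theta4 z)⁻¹) (n : ℕ) :
    a n = overpartitionCount n := by
  set A : PowerSeries ℂ := PowerSeries.mk a with hA
  set Θ : PowerSeries ℂ := PowerSeries.map (Int.castRingHom ℂ) PowerSeries.thetaSeries with hΘ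
  set P : PowerSeries ℂ :=
    PowerSeries.map (Int.castRingHom ℂ) PowerSeries.overpartitionSeries with hP
  have hPΘ : P * Θ = 1 := by
    rw [hP, hΘ, ← map_mul, PowerSeries.overpartitionSeries_mul_thetaSeries, map_one]
  have hball : ∀ᶠ z : ℂ in 𝓝 0, ‖z‖ < 1 := by
    filter_upwards [Metric.ball_mem_nhds (0 : ℂ) one_pos] with z hz
    exact mem_ball_zero_iff.1 hz
  have h1 : ∀ᶠ z : ℂ in 𝓝 0, HasSum (fun n => z ^ n • PowerSeries.coeff n (A * Θ)) 1 := by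
    filter_upwards [h, hball] with z hz hz1
    have hs := hasSum_thetaSeries hz1
    have e : (fun n => z ^ n • PowerSeries.coeff n (A * Θ)) = fun n =>
        ∑ kl ∈ Finset.HasAntidiagonal.antidiagonal n, (z ^ kl.1 * a kl.1) *
          (z ^ kl.2 * ((PowerSeries.coeff kl.2 PowerSeries.thetaSeries : ℤ) : ℂ)) := by
      funext n
      rw [PowerSeries.coeff_mul, smul_eq_mul, Finset.mul_sum]
      refine Finset.sum_congr rfl fun kl hkl => ?_
      rw [← Finset.HasAntidiagonal.mem_antidiagonal.1 hkl, pow_add]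
      simp only [hA, hΘ, PowerSeries.coeff_mk, PowerSeries.coeff_map, eq_intCast]
      ring
    have hn1 := hz.summable.norm
    have hn2 := hs.summable.norm
    rw [e, ← inv_mul_cancel₀ (theta4_ne_zero hz1), ← hz.tsum_eq, ← hs.tsum_eq,
      tsum_mul_tsum_eq_tsum_sum_antidiagonal_of_summable_norm hn1 hn2]
    exact (summable_norm_sum_mul_antidiagonal_of_summable_norm hn1 hn2).of_norm.hasSum
  have h2 : HasFPowerSeriesAt (fun _ : ℂ => (1 : ℂ))
      (FormalMultilinearSeries.ofScalars ℂ fun n => PowerSeries.coeff n (A * Θ)) 0 := by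
    rw [hasFPowerSeriesAt_iff]
    simpa only [FormalMultilinearSeries.coeff_ofScalars] using h1
  have h3 := h2.eq_formalMultilinearSeries hasFPowerSeriesAt_const
  have h4 : A * Θ = 1 := by
    ext k
    have := congrArg (fun p => FormalMultilinearSeries.coeff p k) h3
    simp only [FormalMultilinearSeries.coeff_ofScalars] at this
    rw [this, PowerSeries.coeff_one]
    rcases k with _ | k
    · simp [FormalMultilinearSeries.coeff, constFormalMultilinearSeries]
    · simp [FormalMultilinearSeries.coeff, constFormalMultilinearSeries]
  have h5 : A = P := by
    calc A = A * (P * Θ) := by rw [hPΘ, mul_one]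
      _ = (A * Θ) * P := by ring
      _ = P := by rw [h4, one_mul]
  have h6 := congrArg (PowerSeries.coeff n) h5
  simpa [hA, hP, PowerSeries.overpartitionSeries] using h6

open Real in
/-- Cauchy's formula on the circle of radius `exp (-σ)`, written in the variable `t = -log q`. -/
theorem overpartitionCount_eq_integral (n : ℕ) {σ : ℝ} (hσ : 0 < σ) :
    (overpartitionCount n : ℂ) = (1 / (2 * π)) * ∫ θ in -π..π,
      Complex.exp (n * (σ + θ * Complex.I)) / theta4 (Complex.exp (-(σ + θ * Complex.I))) := by
  obtain ⟨R, hR⟩ : ∃ R : NNReal, (R : ℝ) = Real.exp (-σ) :=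
    ⟨(Real.exp (-σ)).toNNReal, Real.coe_toNNReal _ (Real.exp_pos _).le⟩
  have hR0 : 0 < R := by
    rw [← NNReal.coe_pos, hR]
    exact Real.exp_pos _
  have hR1 : (R : ℝ) < 1 := by
    rw [hR, Real.exp_lt_one_iff]
    linarith
  have hd : DifferentiableOn ℂ (fun q => (theta4 q)⁻¹) (Metric.closedBall 0 R) := by
    refine (differentiableOn_theta4.mono (Metric.closedBall_subset_ball hR1)).inv fun q hq => ?_
    exact theta4_ne_zero (lt_of_le_of_lt (mem_closedBall_zero_iff.1 hq) hR1)
  have hps := (hd.hasFPowerSeriesOnBall hR0).hasFPowerSeriesAt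
  rw [hasFPowerSeriesAt_iff] at hps
  simp only [zero_add, smul_eq_mul] at hps
  rw [← eq_overpartitionCount_of_hasSum hps n, FormalMultilinearSeries.coeff]
  have := cauchyPowerSeries_apply (fun q => (theta4 q)⁻¹) 0 R n 1
  rw [show (cauchyPowerSeries (fun q => (theta4 q)⁻¹) 0 R n 1)
    = (cauchyPowerSeries (fun q => (theta4 q)⁻¹) 0 R n fun _ => 1) from rfl, this, circleIntegral]
  set g : ℝ → ℂ := fun θ =>
    Complex.exp (n * (σ + θ * Complex.I)) / theta4 (Complex.exp (-(σ + θ * Complex.I))) with hg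
  have hper : Function.Periodic g (2 * π) := by
    intro θ
    have e1 : (n : ℂ) * (σ + ((θ + 2 * π : ℝ) : ℂ) * Complex.I)
        = n * (σ + θ * Complex.I) + n * (2 * π * Complex.I) := by push_cast; ring
    have e2 : -((σ : ℂ) + ((θ + 2 * π : ℝ) : ℂ) * Complex.I)
        = -(σ + θ * Complex.I) - (2 * π * Complex.I) := by push_cast; ring
    simp only [hg]
    rw [e1, e2, Complex.exp_add, Complex.exp_nat_mul_two_pi_mul_I, mul_one, Complex.exp_sub,
      Complex.exp_two_pi_mul_I, div_one]
  have hint (θ : ℝ) : deriv (circleMap 0 R) θ • ((1 / (circleMap 0 R θ - 0)) ^ n •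
      (circleMap 0 R θ - 0)⁻¹ • (theta4 (circleMap 0 R θ))⁻¹) = Complex.I * g (-θ) := by
    have hz : circleMap 0 R θ = Complex.exp (-(σ + ((-θ : ℝ) : ℂ) * Complex.I)) := by
      rw [circleMap_zero, hR, Complex.ofReal_exp, ← Complex.exp_add]
      congr 1
      push_cast
      ring
    have hne : Complex.exp (-(σ + ((-θ : ℝ) : ℂ) * Complex.I)) ≠ 0 := Complex.exp_ne_zero _
    have e3 : (1 / Complex.exp (-(σ + ((-θ : ℝ) : ℂ) * Complex.I))) ^ n
        = Complex.exp (n * (σ + ((-θ : ℝ) : ℂ) * Complex.I)) := by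
      rw [one_div, ← Complex.exp_neg, neg_neg, ← Complex.exp_nat_mul]
    rw [deriv_circleMap, sub_zero, hz, e3]
    simp only [hg, smul_eq_mul]
    field_simp
  simp_rw [hint]
  rw [intervalIntegral.integral_const_mul, smul_eq_mul, intervalIntegral.integral_comp_neg,
    neg_zero]
  have := hper.intervalIntegral_add_eq (-(2 * π)) (-π)
  rw [show -(2 * π) + 2 * π = 0 by ring, show -π + 2 * π = π by ring] at this
  rw [this]
  have hπ : (π : ℂ) ≠ 0 := by exact_mod_cast pi_ne_zero
  field_simp

/-! ### The principal square root -/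

/-- The principal branch of the complex square root. -/
noncomputable def csqrt (t : ℂ) : ℂ := t ^ (1 / 2 : ℂ)

theorem csqrt_sq (t : ℂ) : csqrt t ^ 2 = t := by
  have := Complex.cpow_nat_inv_pow t two_ne_zero
  rw [csqrt, one_div]
  exact_mod_cast this

theorem csqrt_ne_zero {t : ℂ} (ht : t ≠ 0) : csqrt t ≠ 0 := by
  intro h
  have := csqrt_sq t
  rw [h] at this
  exact ht (by simpa using this.symm)

theorem norm_csqrt (t : ℂ) : ‖csqrt t‖ = √‖t‖ := by
  have := congrArg norm (csqrt_sq t)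
  rw [norm_pow] at this
  rw [← this, Real.sqrt_sq (norm_nonneg _)]

theorem csqrt_real_mul {r : ℝ} (hr : 0 < r) {t : ℂ} (ht : t ≠ 0) :
    csqrt (r * t) = √r * csqrt t := by
  have hr' : (r : ℂ) ≠ 0 := by exact_mod_cast hr.ne'
  rw [csqrt, csqrt, Complex.cpow_def_of_ne_zero (mul_ne_zero hr' ht),
    Complex.cpow_def_of_ne_zero ht, Complex.log_ofReal_mul hr ht, add_mul, Complex.exp_add,
    Real.sqrt_eq_rpow, Real.rpow_def_of_pos hr]
  push_cast
  rfl

theorem csqrt_inv {t : ℂ} (ht : 0 < t.re) : csqrt t⁻¹ = (csqrt t)⁻¹ := by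
  rw [csqrt, Complex.inv_cpow, csqrt]
  rw [Ne, Complex.arg_eq_pi_iff, not_and_or, not_lt]
  exact Or.inl ht.le

theorem ne_zero_of_re_pos {t : ℂ} (ht : 0 < t.re) : t ≠ 0 := by rintro rfl; simp at ht

/-! ### Moments of the Gaussian -/

section Gaussian

theorem integrable_gaussian_linear {t : ℂ} (ht : 0 < t.re) (c : ℝ) :
    Integrable fun y : ℝ => Complex.exp (-t * y ^ 2 + c * y) := by
  simpa using integrable_cexp_quadratic ht (c : ℂ) 0

theorem integral_gaussian_linear {t : ℂ} (ht : 0 < t.re) (c : ℝ) :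
    ∫ y : ℝ, Complex.exp (-t * y ^ 2 + c * y)
      = √Real.pi / csqrt t * Complex.exp (c ^ 2 / (4 * t)) := by
  have := integral_cexp_quadratic (b := -t) (by simpa using ht) (c : ℂ) 0
  simp only [add_zero, neg_neg, zero_sub] at this
  rw [this]
  have e : ((Real.pi : ℂ) / t) ^ (1 / 2 : ℂ) = √Real.pi / csqrt t := by
    have := csqrt_real_mul Real.pi_pos (inv_ne_zero (ne_zero_of_re_pos ht))
    rw [csqrt_inv ht] at this
    exact this
  rw [e]
  congr 2
  rw [mul_neg, div_neg, neg_neg]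

theorem norm_gaussian_linear (t : ℂ) (c y : ℝ) :
    ‖Complex.exp (-t * y ^ 2 + c * y)‖ = Real.exp (-t.re * y ^ 2 + c * y) := by
  rw [Complex.norm_exp, ← Complex.ofReal_pow]
  congr 1
  rw [Complex.add_re, mul_comm (-t), Complex.re_ofReal_mul, ← Complex.ofReal_mul,
    Complex.ofReal_re, Complex.neg_re]
  ring

/-- The factor `y ^ k` is absorbed by a change of the linear term by `± 1`. -/
theorem integrable_pow_mul_gaussian_linear {t : ℂ} (ht : 0 < t.re) (c : ℝ) {k : ℕ} (hk : k ≤ 2) :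
    Integrable fun y : ℝ => (y : ℂ) ^ k * Complex.exp (-t * y ^ 2 + c * y) := by
  have h1 := (integrable_gaussian_linear ht (c + 1)).norm
  have h2 := (integrable_gaussian_linear ht (c - 1)).norm
  refine ((h1.add h2).const_mul 2).mono' (by fun_prop) (Eventually.of_forall fun y => ?_)
  simp only [Pi.add_apply, norm_mul, norm_pow, Complex.norm_real, norm_gaussian_linear]
  have e1 : -t.re * y ^ 2 + (c + 1) * y = (-t.re * y ^ 2 + c * y) + y := by ring
  have e2 : -t.re * y ^ 2 + (c - 1) * y = (-t.re * y ^ 2 + c * y) + (-y) := by ring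
  rw [e1, e2]
  generalize -t.re * y ^ 2 + c * y = A
  rw [Real.exp_add, Real.exp_add, ← mul_add, mul_left_comm, mul_comm]
  gcongr
  have hy2 : y ^ 2 / 2 ≤ Real.exp y + Real.exp (-y) - 1 := by
    have h1 := Real.quadratic_le_exp_of_nonneg (abs_nonneg y)
    have h2 : Real.exp |y| ≤ Real.exp y + Real.exp (-y) := by
      rcases abs_choice y with h | h <;> rw [h] <;> linarith [Real.exp_pos y, Real.exp_pos (-y)]
    rw [sq_abs] at h1
    linarith [abs_nonneg y]
  have hpow : ‖y‖ ^ k ≤ 1 + y ^ 2 := by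
    rw [Real.norm_eq_abs, ← sq_abs y]
    have := abs_nonneg y
    interval_cases k <;> nlinarith [sq_nonneg (|y| - 1)]
  nlinarith [sq_nonneg y]

theorem hasDerivAt_gaussian_linear (t : ℂ) (c y : ℝ) :
    HasDerivAt (fun y : ℝ => Complex.exp (-t * y ^ 2 + c * y))
      ((-2 * t * y + c) * Complex.exp (-t * y ^ 2 + c * y)) y := by
  have h0 : HasDerivAt (fun y : ℝ => (y : ℂ)) 1 y := Complex.ofRealCLM.hasDerivAt
  have h1 : HasDerivAt (fun y : ℝ => -t * (y : ℂ) ^ 2 + c * y) (-2 * t * y + c) y := by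
    convert! ((h0.pow 2).const_mul (-t)).add (h0.const_mul (c : ℂ)) using 1
    simp
    ring
  convert! h1.cexp using 1
  ring

/-- The integral of the derivative of the Gaussian vanishes; this gives the first moment. -/
theorem integral_mul_gaussian_linear {t : ℂ} (ht : 0 < t.re) (c : ℝ) :
    ∫ y : ℝ, (y : ℂ) * Complex.exp (-t * y ^ 2 + c * y)
      = c / (2 * t) * (√Real.pi / csqrt t * Complex.exp (c ^ 2 / (4 * t))) := by
  have ht0 := ne_zero_of_re_pos ht
  have i0 := integrable_gaussian_linear ht c
  have i1 : Integrable fun y : ℝ => (y : ℂ) * Complex.exp (-t * y ^ 2 + c * y) := by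
    simpa using integrable_pow_mul_gaussian_linear ht c (k := 1) (by norm_num)
  have e : (fun y : ℝ => (-2 * t * y + c) * Complex.exp (-t * y ^ 2 + c * y)) = fun y : ℝ =>
      -2 * t * ((y : ℂ) * Complex.exp (-t * y ^ 2 + c * y))
        + c * Complex.exp (-t * y ^ 2 + c * y) := by
    funext y; ring
  have h := integral_eq_zero_of_hasDerivAt_of_integrable (hasDerivAt_gaussian_linear t c)
    (by rw [e]; exact (i1.const_mul _).add (i0.const_mul _)) i0
  rw [e, integral_add (i1.const_mul _) (i0.const_mul _), integral_const_mul, integral_const_mul,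
    integral_gaussian_linear ht] at h
  generalize (∫ y : ℝ, (y : ℂ) * Complex.exp (-t * y ^ 2 + c * y)) = J at *
  generalize (√Real.pi / csqrt t * Complex.exp (c ^ 2 / (4 * t))) = K at *
  field_simp
  linear_combination -h

theorem integral_sq_mul_gaussian_linear {t : ℂ} (ht : 0 < t.re) (c : ℝ) :
    ∫ y : ℝ, (y : ℂ) ^ 2 * Complex.exp (-t * y ^ 2 + c * y)
      = (1 / (2 * t) + c ^ 2 / (4 * t ^ 2))
        * (√Real.pi / csqrt t * Complex.exp (c ^ 2 / (4 * t))) := by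
  have ht0 := ne_zero_of_re_pos ht
  have i0 := integrable_gaussian_linear ht c
  have i1 : Integrable fun y : ℝ => (y : ℂ) * Complex.exp (-t * y ^ 2 + c * y) := by
    simpa using integrable_pow_mul_gaussian_linear ht c (k := 1) (by norm_num)
  have i2 := integrable_pow_mul_gaussian_linear ht c (k := 2) le_rfl
  have hd (y : ℝ) : HasDerivAt (fun y : ℝ => (y : ℂ) * Complex.exp (-t * y ^ 2 + c * y))
      (1 * Complex.exp (-t * y ^ 2 + c * y)
        + y * ((-2 * t * y + c) * Complex.exp (-t * y ^ 2 + c * y))) y :=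
    (Complex.ofRealCLM.hasDerivAt (x := y)).mul (hasDerivAt_gaussian_linear t c y)
  have e : (fun y : ℝ => 1 * Complex.exp (-t * y ^ 2 + c * y)
        + y * ((-2 * t * y + c) * Complex.exp (-t * y ^ 2 + c * y))) = fun y : ℝ =>
      Complex.exp (-t * y ^ 2 + c * y) + (-2 * t * ((y : ℂ) ^ 2 * Complex.exp (-t * y ^ 2 + c * y))
        + c * (y * Complex.exp (-t * y ^ 2 + c * y))) := by
    funext y; ring
  have i3 : Integrable fun y : ℝ => -2 * t * ((y : ℂ) ^ 2 * Complex.exp (-t * y ^ 2 + c * y))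
      + c * (y * Complex.exp (-t * y ^ 2 + c * y)) :=
    (i2.const_mul (-2 * t)).add (i1.const_mul (c : ℂ))
  have h := integral_eq_zero_of_hasDerivAt_of_integrable hd (by rw [e]; exact i0.add i3) i1
  rw [e, integral_add i0 i3, integral_add (i2.const_mul _) (i1.const_mul _), integral_const_mul,
    integral_const_mul, integral_gaussian_linear ht, integral_mul_gaussian_linear ht] at h
  generalize (∫ y : ℝ, (y : ℂ) ^ 2 * Complex.exp (-t * y ^ 2 + c * y)) = J at *
  generalize (√Real.pi / csqrt t * Complex.exp (c ^ 2 / (4 * t))) = K at *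
  have h' : 2 * t * J = K + c * (c / (2 * t) * K) := by linear_combination -h
  have : J = (K + c * (c / (2 * t) * K)) / (2 * t) := by rw [← h']; field_simp
  rw [this]
  field_simp
  ring

end Gaussian

/-! ### Laplace transforms of `sinh (2 α √x)` and `√x cosh (2 α √x)` -/

theorem integral_eq_integral_Ioi_add_neg {h : ℝ → ℂ} (hh : Integrable h) :
    ∫ y in Set.Ioi (0 : ℝ), (h y + h (-y)) = ∫ y, h y := by
  have h2 : IntegrableOn (fun y => h (-y)) (Set.Ioi 0) := hh.comp_neg.integrableOn
  rw [integral_add hh.integrableOn h2, integral_comp_neg_Ioi, neg_zero, add_comm,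
    ← setIntegral_union (Set.Iic_disjoint_Ioi le_rfl) measurableSet_Ioi hh.integrableOn
      hh.integrableOn, Set.Iic_union_Ioi, Measure.restrict_univ]

theorem integral_comp_sq {g : ℝ → ℂ} :
    ∫ y in Set.Ioi (0 : ℝ), (2 * y : ℂ) * g (y ^ 2) = ∫ x in Set.Ioi 0, g x := by
  rw [← integral_comp_rpow_Ioi_of_pos (g := g) two_pos]
  refine setIntegral_congr_fun measurableSet_Ioi fun y _ => ?_
  norm_num

theorem integrableOn_comp_sq_iff {g : ℝ → ℂ} :
    IntegrableOn (fun y : ℝ => (2 * y : ℂ) * g (y ^ 2)) (Set.Ioi 0)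
      ↔ IntegrableOn g (Set.Ioi 0) := by
  rw [← integrableOn_Ioi_comp_rpow_iff g two_ne_zero]
  refine integrableOn_congr_fun (fun y _ => ?_) measurableSet_Ioi
  norm_num

section Laplace

theorem laplace_sinh_sqrt_aux (t : ℂ) (α y : ℝ) (hy : 0 < y) :
    (2 * y : ℂ) * (Real.sinh (2 * α * √(y ^ 2)) * Complex.exp (-t * (y ^ 2 : ℝ)))
      = (fun y : ℝ => (y : ℂ) * Complex.exp (-t * y ^ 2 + (2 * α : ℝ) * y)) y
        + (fun y : ℝ => (y : ℂ) * Complex.exp (-t * y ^ 2 + (2 * α : ℝ) * y)) (-y) := by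
  rw [Real.sqrt_sq hy.le, Real.sinh_eq]
  push_cast
  have e1 : -t * (-(y : ℂ)) ^ 2 + 2 * α * -y = -t * y ^ 2 + -(2 * α * y) := by ring
  rw [e1, Complex.exp_add, Complex.exp_add]
  ring

theorem laplace_cosh_sqrt_aux (t : ℂ) (α y : ℝ) (hy : 0 < y) :
    (2 * y : ℂ) * ((√(y ^ 2) * Real.cosh (2 * α * √(y ^ 2)) : ℝ) * Complex.exp (-t * (y ^ 2 : ℝ)))
      = (fun y : ℝ => (y : ℂ) ^ 2 * Complex.exp (-t * y ^ 2 + (2 * α : ℝ) * y)) y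
        + (fun y : ℝ => (y : ℂ) ^ 2 * Complex.exp (-t * y ^ 2 + (2 * α : ℝ) * y)) (-y) := by
  rw [Real.sqrt_sq hy.le, Real.cosh_eq]
  push_cast
  have e1 : -t * (-(y : ℂ)) ^ 2 + 2 * α * -y = -t * y ^ 2 + -(2 * α * y) := by ring
  rw [e1, Complex.exp_add, Complex.exp_add]
  ring

theorem integrableOn_sinh_sqrt {t : ℂ} (ht : 0 < t.re) (α : ℝ) :
    IntegrableOn (fun x : ℝ => Real.sinh (2 * α * √x) * Complex.exp (-t * x)) (Set.Ioi 0) := by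
  have i1 : Integrable fun y : ℝ => (y : ℂ) * Complex.exp (-t * y ^ 2 + (2 * α : ℝ) * y) := by
    simpa using integrable_pow_mul_gaussian_linear ht (2 * α) (k := 1) (by norm_num)
  rw [← integrableOn_comp_sq_iff]
  exact ((i1.add i1.comp_neg).integrableOn).congr_fun
    (fun y hy => (laplace_sinh_sqrt_aux t α y hy).symm) measurableSet_Ioi

theorem integral_sinh_sqrt {t : ℂ} (ht : 0 < t.re) (α : ℝ) :
    ∫ x in Set.Ioi (0 : ℝ), Real.sinh (2 * α * √x) * Complex.exp (-t * x)
      = √Real.pi * (α / (t * csqrt t)) * Complex.exp (α ^ 2 / t) := by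
  have i1 : Integrable fun y : ℝ => (y : ℂ) * Complex.exp (-t * y ^ 2 + (2 * α : ℝ) * y) := by
    simpa using integrable_pow_mul_gaussian_linear ht (2 * α) (k := 1) (by norm_num)
  have ht0 := ne_zero_of_re_pos ht
  have hw0 := csqrt_ne_zero ht0
  rw [← integral_comp_sq, setIntegral_congr_fun measurableSet_Ioi
    (fun y hy => laplace_sinh_sqrt_aux t α y hy), integral_eq_integral_Ioi_add_neg i1,
    integral_mul_gaussian_linear ht]
  have : ((2 * α : ℝ) : ℂ) ^ 2 / (4 * t) = α ^ 2 / t := by push_cast; field_simp; ring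
  rw [this]
  push_cast
  field_simp

theorem integrableOn_cosh_sqrt {t : ℂ} (ht : 0 < t.re) (α : ℝ) :
    IntegrableOn (fun x : ℝ => ((√x * Real.cosh (2 * α * √x) : ℝ) : ℂ) * Complex.exp (-t * x))
      (Set.Ioi 0) := by
  have i2 := integrable_pow_mul_gaussian_linear ht (2 * α) (k := 2) le_rfl
  rw [← integrableOn_comp_sq_iff]
  exact ((i2.add i2.comp_neg).integrableOn).congr_fun
    (fun y hy => (laplace_cosh_sqrt_aux t α y hy).symm) measurableSet_Ioi

theorem integral_cosh_sqrt {t : ℂ} (ht : 0 < t.re) (α : ℝ) :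
    ∫ x in Set.Ioi (0 : ℝ), ((√x * Real.cosh (2 * α * √x) : ℝ) : ℂ) * Complex.exp (-t * x)
      = √Real.pi * (1 / (2 * t * csqrt t) + α ^ 2 / (t ^ 2 * csqrt t))
        * Complex.exp (α ^ 2 / t) := by
  have i2 := integrable_pow_mul_gaussian_linear ht (2 * α) (k := 2) le_rfl
  have ht0 := ne_zero_of_re_pos ht
  have hw0 := csqrt_ne_zero ht0
  rw [← integral_comp_sq, setIntegral_congr_fun measurableSet_Ioi
    (fun y hy => laplace_cosh_sqrt_aux t α y hy), integral_eq_integral_Ioi_add_neg i2,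
    integral_sq_mul_gaussian_linear ht]
  have : ((2 * α : ℝ) : ℂ) ^ 2 / (4 * t) = α ^ 2 / t := by push_cast; field_simp; ring
  rw [this]
  push_cast
  field_simp
  ring

end Laplace

/-! ### Laplace inversion along a vertical line -/

section Inversion

open scoped FourierTransform

open Real in
/-- Laplace inversion: the transform along the line `re t = σ` is the Fourier transform of
`f x * exp (-σ x)` on the half-line, so the inversion formula of Fourier applies. -/
theorem laplace_inversion {f : ℝ → ℂ} {σ ν : ℝ} (hν : 0 < ν) {F : ℂ → ℂ}
    (hint : IntegrableOn (fun x : ℝ => f x * Complex.exp (-(σ : ℂ) * x)) (Set.Ioi 0))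
    (hL : ∀ ω : ℝ, ∫ x in Set.Ioi (0 : ℝ), f x * Complex.exp (-(σ + ω * Complex.I) * x)
      = F (σ + ω * Complex.I))
    (hF : Integrable fun ω : ℝ => F (σ + ω * Complex.I)) (hc : ContinuousAt f ν) :
    ∫ ω : ℝ, F (σ + ω * Complex.I) * Complex.exp (ν * (σ + ω * Complex.I)) = 2 * π * f ν := by
  set φ : ℝ → ℂ := Set.indicator (Set.Ioi 0) fun x => f x * Complex.exp (-(σ : ℂ) * x) with hφ
  have hφi : Integrable φ := (integrable_indicator_iff measurableSet_Ioi).2 hint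
  have hFT (w : ℝ) : 𝓕 φ w = F (σ + ((2 * π * w : ℝ) : ℂ) * Complex.I) := by
    rw [Real.fourier_real_eq_integral_exp_smul, ← hL, ← integral_indicator measurableSet_Ioi]
    congr 1
    funext v
    by_cases hv : v ∈ Set.Ioi (0 : ℝ)
    · simp only [hφ, Set.indicator_of_mem hv, smul_eq_mul]
      rw [mul_left_comm, ← Complex.exp_add]
      congr 2
      push_cast
      ring
    · simp only [hφ, Set.indicator_of_notMem hv, smul_zero]
  have h2π : (2 * π : ℝ) ≠ 0 := by positivity
  have hFTi : Integrable (𝓕 φ) := by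
    rw [show 𝓕 φ = fun w : ℝ => (fun ω : ℝ => F (σ + ω * Complex.I)) (2 * π * w) from
      funext hFT]
    exact hF.comp_mul_left' h2π
  have hφc : ContinuousAt φ ν := by
    have h1 : ContinuousAt (fun x : ℝ => f x * Complex.exp (-(σ : ℂ) * x)) ν :=
      hc.mul (by fun_prop)
    refine h1.congr ?_
    filter_upwards [Ioi_mem_nhds hν] with x hx
    rw [hφ, Set.indicator_of_mem (Set.mem_Ioi.2 hx)]
  have hinv := hφi.fourierInv_fourier_eq hFTi hφc
  rw [Real.fourierInv_eq'] at hinv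
  have e (v : ℝ) : Complex.exp (((2 * π * inner ℝ v ν : ℝ) : ℂ) * Complex.I) • 𝓕 φ v
      = (fun ω : ℝ => F (σ + ω * Complex.I) * Complex.exp (ν * (ω * Complex.I))) (2 * π * v) := by
    simp only [hFT, smul_eq_mul]
    rw [mul_comm]
    congr 2
    simp
    ring
  simp_rw [e] at hinv
  rw [Measure.integral_comp_mul_left (fun ω : ℝ =>
    F (σ + ω * Complex.I) * Complex.exp (ν * (ω * Complex.I))), hφ,
    Set.indicator_of_mem (Set.mem_Ioi.2 hν)] at hinv
  have e2 (ω : ℝ) : F (σ + ω * Complex.I) * Complex.exp (ν * (σ + ω * Complex.I))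
      = Complex.exp (σ * ν) *
        (F (σ + ω * Complex.I) * Complex.exp (ν * (ω * Complex.I))) := by
    rw [mul_add, Complex.exp_add, mul_comm (σ : ℂ)]
    ring
  simp_rw [e2]
  rw [integral_const_mul]
  have h3 : ∫ ω : ℝ, F (σ + ω * Complex.I) * Complex.exp (ν * (ω * Complex.I))
      = 2 * π * (f ν * Complex.exp (-σ * ν)) := by
    rw [← hinv, abs_of_pos (by positivity), Complex.real_smul]
    have : (π : ℂ) ≠ 0 := by exact_mod_cast pi_ne_zero
    push_cast
    rw [← mul_assoc, mul_inv_cancel₀ (mul_ne_zero two_ne_zero this), one_mul]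
  rw [h3, neg_mul, Complex.exp_neg]
  have := Complex.exp_ne_zero (σ * ν)
  field_simp

end Inversion

theorem re_line (σ ω : ℝ) : ((σ : ℂ) + ω * Complex.I).re = σ := by simp

theorem hasDerivAt_csqrt {t : ℂ} (ht : 0 < t.re) : HasDerivAt csqrt (1 / (2 * csqrt t)) t := by
  have ht0 := ne_zero_of_re_pos ht
  have h := (hasDerivAt_id t).cpow_const (c := (1 / 2 : ℂ)) (Or.inl ht)
  have e : (1 / 2 : ℂ) * t ^ ((1 / 2 : ℂ) - 1) * 1 = 1 / (2 * csqrt t) := by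
    have hw0 := csqrt_ne_zero ht0
    have hs := csqrt_sq t
    rw [Complex.cpow_sub _ _ ht0, Complex.cpow_one]
    change (1 / 2 : ℂ) * (csqrt t / t) * 1 = 1 / (2 * csqrt t)
    field_simp
    exact hs
  simp only [id] at h
  rw [e] at h
  exact h

theorem continuous_csqrt_line {σ : ℝ} (hσ : 0 < σ) :
    Continuous fun ω : ℝ => csqrt (σ + ω * Complex.I) := by
  rw [continuous_iff_continuousAt]
  intro ω
  have h := (hasDerivAt_csqrt (t := σ + ω * Complex.I) (by rwa [re_line])).continuousAt
  exact ContinuousAt.comp (g := csqrt) h (by fun_prop)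

theorem line_ne_zero {σ : ℝ} (hσ : 0 < σ) (ω : ℝ) : (σ : ℂ) + ω * Complex.I ≠ 0 :=
  ne_zero_of_re_pos (by rwa [re_line])

theorem norm_exp_div_line_le {a σ : ℝ} (ha : 0 ≤ a) (hσ : 0 < σ) (ω : ℝ) :
    ‖Complex.exp (a / (σ + ω * Complex.I))‖ ≤ Real.exp (a / σ) := by
  rw [Complex.norm_exp]
  gcongr
  refine (Complex.re_le_norm _).trans ?_
  rw [norm_div, Complex.norm_of_nonneg ha]
  gcongr
  have := Complex.re_le_norm (σ + ω * Complex.I)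
  rwa [re_line] at this

theorem integrable_line_kernel {a σ : ℝ} (ha : 0 ≤ a) (hσ : 0 < σ) (A B : ℂ) :
    Integrable fun ω : ℝ => (A / ((σ + ω * Complex.I) * csqrt (σ + ω * Complex.I))
      + B / ((σ + ω * Complex.I) ^ 2 * csqrt (σ + ω * Complex.I)))
      * Complex.exp (a / (σ + ω * Complex.I)) := by
  have hj : Integrable fun ω : ℝ => (1 + ‖ω‖) ^ (-(3 / 2 : ℝ)) :=
    integrable_one_add_norm (by simp; norm_num)
  have hcont : Continuous fun ω : ℝ => (A / ((σ + ω * Complex.I) * csqrt (σ + ω * Complex.I))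
      + B / ((σ + ω * Complex.I) ^ 2 * csqrt (σ + ω * Complex.I)))
      * Complex.exp (a / (σ + ω * Complex.I)) := by
    have h1 := continuous_csqrt_line hσ
    have h2 := line_ne_zero hσ
    have h3 (ω : ℝ) := csqrt_ne_zero (h2 ω)
    refine Continuous.mul (Continuous.add ?_ ?_) (Complex.continuous_exp.comp ?_)
    · exact continuous_const.div (by fun_prop) fun ω => mul_ne_zero (h2 ω) (h3 ω)
    · exact continuous_const.div (by fun_prop) fun ω => mul_ne_zero (pow_ne_zero 2 (h2 ω)) (h3 ω)
    · exact continuous_const.div (by fun_prop) h2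
  refine (hj.const_mul ((‖A‖ + ‖B‖ / σ) * (1 / σ + 1) ^ (3 / 2 : ℝ) * Real.exp (a / σ))).mono'
    hcont.aestronglyMeasurable (Eventually.of_forall fun ω => ?_)
  set t : ℂ := σ + ω * Complex.I with ht
  have hσt : σ ≤ ‖t‖ := by
    have := Complex.re_le_norm t
    rwa [ht, re_line] at this
  have hωt : ‖ω‖ ≤ ‖t‖ := by
    have := Complex.abs_im_le_norm t
    simpa [ht] using this
  have ht0 : 0 < ‖t‖ := hσ.trans_le hσt
  have hb : 1 + ‖ω‖ ≤ (1 / σ + 1) * ‖t‖ := by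
    have : 1 ≤ 1 / σ * ‖t‖ := by
      rw [one_div, inv_mul_eq_div, one_le_div hσ]
      exact hσt
    linarith
  have hpow : ‖t‖ * √‖t‖ = ‖t‖ ^ (3 / 2 : ℝ) := by
    rw [Real.sqrt_eq_rpow, ← Real.rpow_one_add' ht0.le (by norm_num)]
    norm_num
  have h32 : 1 / (‖t‖ * √‖t‖) ≤ (1 / σ + 1) ^ (3 / 2 : ℝ) * (1 + ‖ω‖) ^ (-(3 / 2 : ℝ)) := by
    rw [hpow, Real.rpow_neg (by positivity), ← div_eq_mul_inv, div_le_div_iff₀ (by positivity)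
      (by positivity), one_mul, ← Real.mul_rpow (by positivity) ht0.le]
    gcongr
  have hn : ‖A / (t * csqrt t) + B / (t ^ 2 * csqrt t)‖
      ≤ (‖A‖ + ‖B‖ / σ) * (1 / (‖t‖ * √‖t‖)) := by
    refine (norm_add_le _ _).trans ?_
    rw [norm_div, norm_div, norm_mul, norm_mul, norm_pow, norm_csqrt]
    calc ‖A‖ / (‖t‖ * √‖t‖) + ‖B‖ / (‖t‖ ^ 2 * √‖t‖)
        = (‖A‖ + ‖B‖ / ‖t‖) * (1 / (‖t‖ * √‖t‖)) := by
          have : √‖t‖ ≠ 0 := by positivity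
          field_simp
      _ ≤ _ := by gcongr
  rw [norm_mul]
  calc _ ≤ ((‖A‖ + ‖B‖ / σ) * ((1 / σ + 1) ^ (3 / 2 : ℝ) * (1 + ‖ω‖) ^ (-(3 / 2 : ℝ))))
        * Real.exp (a / σ) := by
        gcongr
        · exact hn.trans (by gcongr)
        · exact norm_exp_div_line_le ha hσ ω
    _ = _ := by ring

/-- The inverse Laplace transform of `(c₁ t ^ (-3/2) + c₂ t ^ (-5/2)) exp (α² / t)`. -/
theorem integral_line_kernel {σ ν : ℝ} (hσ : 0 < σ) (hν : 0 < ν) (α A B : ℝ) :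
    ∫ ω : ℝ, ((A * α + B / 2 : ℝ) / ((σ + ω * Complex.I) * csqrt (σ + ω * Complex.I))
        + (B * α ^ 2 : ℝ) / ((σ + ω * Complex.I) ^ 2 * csqrt (σ + ω * Complex.I)))
        * Complex.exp ((α ^ 2 : ℝ) / (σ + ω * Complex.I)) * Complex.exp (ν * (σ + ω * Complex.I))
      = 2 * Real.pi * ((A * Real.sinh (2 * α * √ν) + B * (√ν * Real.cosh (2 * α * √ν))) / √Real.pi
        : ℝ) := by
  have hre (ω : ℝ) : 0 < ((σ : ℂ) + ω * Complex.I).re := by rwa [re_line]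
  have hπ : (√Real.pi : ℂ) ≠ 0 := by
    exact_mod_cast (Real.sqrt_pos.2 Real.pi_pos).ne'
  set f : ℝ → ℂ := fun x =>
    ((A * Real.sinh (2 * α * √x) + B * (√x * Real.cosh (2 * α * √x))) / √Real.pi : ℝ) with hf
  have hfe (t : ℂ) : (fun x : ℝ => f x * Complex.exp (-t * x)) = fun x : ℝ =>
      (A / √Real.pi : ℂ) * (Real.sinh (2 * α * √x) * Complex.exp (-t * x))
      + (B / √Real.pi : ℂ) * (((√x * Real.cosh (2 * α * √x) : ℝ) : ℂ) * Complex.exp (-t * x)) := by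
    funext x
    simp only [hf]
    push_cast
    ring
  refine laplace_inversion (f := f) (F := fun t : ℂ => ((A * α + B / 2 : ℝ) / (t * csqrt t)
        + (B * α ^ 2 : ℝ) / (t ^ 2 * csqrt t)) * Complex.exp ((α ^ 2 : ℝ) / t)) hν ?_ ?_ ?_ ?_
  · have h0 : 0 < (σ : ℂ).re := by simpa using hσ
    rw [hfe]
    exact ((integrableOn_sinh_sqrt h0 α).const_mul _).add
      ((integrableOn_cosh_sqrt h0 α).const_mul _)
  · intro ω
    have h0 := hre ω
    generalize (σ : ℂ) + ω * Complex.I = t at *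
    rw [hfe, integral_add ((integrableOn_sinh_sqrt h0 α).const_mul _)
      ((integrableOn_cosh_sqrt h0 α).const_mul _), integral_const_mul, integral_const_mul,
      integral_sinh_sqrt h0, integral_cosh_sqrt h0]
    have ht0 := ne_zero_of_re_pos h0
    have hw0 := csqrt_ne_zero ht0
    push_cast
    field_simp
    ring
  · exact integrable_line_kernel (by positivity) hσ _ _
  · have : Continuous f := by
      simp only [hf]
      fun_prop
    exact this.continuousAt

/-! ### The reciprocal of `θ₄` near and away from the real axis -/

theorem inv_theta4_exp_neg {t : ℂ} (ht : 0 < t.re) :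
    (theta4 (Complex.exp (-t)))⁻¹ = csqrt t / (2 * √Real.pi)
      * Complex.exp ((Real.pi / 2 : ℝ) ^ 2 / t) * (1 + thetaTail t)⁻¹ := by
  have ht0 := ne_zero_of_re_pos ht
  have hπ := Real.pi_pos
  have hs : (√Real.pi : ℂ) ≠ 0 := by exact_mod_cast (Real.sqrt_pos.2 hπ).ne'
  have hw0 := csqrt_ne_zero ht0
  have e1 : (t / Real.pi) ^ (1 / 2 : ℂ) = csqrt t / √Real.pi := by
    have := csqrt_real_mul (r := 1 / Real.pi) (by positivity) ht0
    rw [show ((1 / Real.pi : ℝ) : ℂ) * t = t / Real.pi by push_cast; ring] at this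
    change csqrt (t / Real.pi) = _
    rw [this, one_div, Real.sqrt_inv]
    push_cast
    ring
  have e2 : -((Real.pi : ℂ) ^ 2 / 4) / t = -(((Real.pi / 2 : ℝ) : ℂ) ^ 2 / t) := by
    push_cast; ring
  rw [theta4_exp_neg ht, e1, e2, Complex.exp_neg, mul_inv, mul_inv, inv_inv]
  congr 2
  field_simp

/-- The growth of the leading term `exp ((π/2)² / t)` is compensated by the decay
`exp (-2 π² re (1 / t))` of the correction, so the error is bounded. -/
theorem norm_inv_theta4_sub_le {t : ℂ} (ht : 0 < t.re)
    (hx : Real.exp (-(2 * Real.pi ^ 2 * (1 / t).re)) ≤ 1 / 4) :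
    ‖(theta4 (Complex.exp (-t)))⁻¹ - csqrt t / (2 * √Real.pi)
      * Complex.exp ((Real.pi / 2 : ℝ) ^ 2 / t)‖ ≤ 2 * √‖t‖ / √Real.pi := by
  have hr := re_one_div_pos ht
  have hρ := norm_thetaTail_le hr (hx.trans (by norm_num))
  have hπ := Real.pi_pos
  have hsπ := Real.sqrt_pos.2 hπ
  set x := Real.exp (-(2 * Real.pi ^ 2 * (1 / t).re)) with hxd
  have hlow : 1 / 2 ≤ ‖1 + thetaTail t‖ := by
    have := norm_sub_norm_le (1 : ℂ) (-thetaTail t)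
    rw [norm_neg, norm_one, sub_neg_eq_add] at this
    linarith
  have hne : 1 + thetaTail t ≠ 0 := by
    rw [← norm_pos_iff]
    linarith
  have e : (1 + thetaTail t)⁻¹ - 1 = -thetaTail t * (1 + thetaTail t)⁻¹ := by
    field_simp
    ring
  have hexp : ‖Complex.exp (((Real.pi / 2 : ℝ) : ℂ) ^ 2 / t)‖ * x ≤ 1 := by
    have : ((Real.pi / 2 : ℝ) : ℂ) ^ 2 / t = (((Real.pi / 2) ^ 2 : ℝ) : ℂ) * (1 / t) := by
      push_cast; ring
    rw [Complex.norm_exp, this, Complex.re_ofReal_mul, hxd, ← Real.exp_add, Real.exp_le_one_iff]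
    nlinarith [mul_pos (pow_pos hπ 2) hr]
  rw [inv_theta4_exp_neg ht, ← mul_sub_one, e, norm_mul, norm_mul, norm_mul, norm_neg, norm_inv,
    norm_div, norm_mul, Complex.norm_ofNat, norm_csqrt, Complex.norm_of_nonneg hsπ.le]
  have h2 : ‖1 + thetaTail t‖⁻¹ ≤ 2 := by
    rw [inv_le_comm₀ (by linarith) two_pos]
    linarith
  calc √‖t‖ / (2 * √Real.pi) * ‖Complex.exp (((Real.pi / 2 : ℝ) : ℂ) ^ 2 / t)‖
        * (‖thetaTail t‖ * ‖1 + thetaTail t‖⁻¹)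
      ≤ √‖t‖ / (2 * √Real.pi) * ‖Complex.exp (((Real.pi / 2 : ℝ) : ℂ) ^ 2 / t)‖
        * ((2 * x) * 2) := by gcongr
    _ = 2 * √‖t‖ / √Real.pi * (‖Complex.exp (((Real.pi / 2 : ℝ) : ℂ) ^ 2 / t)‖ * x) := by
        field_simp
    _ ≤ 2 * √‖t‖ / √Real.pi * 1 := by gcongr
    _ = _ := mul_one _

/-- For arguments at least `10 σ` the nome `q = exp (-(σ + I θ))` is at least six times farther
from `1` than its modulus is. -/
theorem norm_one_sub_exp_neg_ge {σ θ : ℝ} (hσ : 0 < σ) (hσ' : σ ≤ 1 / 20) (h1 : 10 * σ ≤ |θ|)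
    (h2 : |θ| ≤ Real.pi) :
    6 * (1 - Real.exp (-σ)) ≤ ‖1 - Complex.exp (-(σ + θ * Complex.I))‖ := by
  have hr1 : 1 - σ ≤ Real.exp (-σ) := by linarith [Real.add_one_le_exp (-σ)]
  have hr2 : Real.exp (-σ) ≤ 1 := Real.exp_le_one_iff.2 (by linarith)
  set r := Real.exp (-σ) with hr
  have hcos := Real.cos_le_one_sub_mul_cos_sq h2
  have hz : Complex.exp (-(σ + θ * Complex.I)) = r * Complex.exp (((-θ : ℝ) : ℂ) * Complex.I) := by
    rw [hr, Complex.ofReal_exp, ← Complex.exp_add]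
    congr 1
    push_cast
    ring
  have hsq : ‖1 - Complex.exp (-(σ + θ * Complex.I))‖ ^ 2
      = (1 - r) ^ 2 + 2 * r * (1 - Real.cos θ) := by
    rw [hz, Complex.sq_norm, Complex.normSq_apply]
    simp only [Complex.sub_re, Complex.one_re, Complex.re_ofReal_mul, Complex.exp_ofReal_mul_I_re,
      Complex.sub_im, Complex.one_im, Complex.im_ofReal_mul, Complex.exp_ofReal_mul_I_im,
      Real.cos_neg, Real.sin_neg]
    nlinarith [Real.sin_sq_add_cos_sq θ]
  refine le_of_sq_le_sq ?_ (norm_nonneg _)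
  rw [hsq]
  have hπ : Real.pi ^ 2 ≤ 10 := by nlinarith [Real.pi_lt_d2, Real.pi_pos]
  have hθ : 100 * σ ^ 2 ≤ θ ^ 2 := by
    rw [← sq_abs θ]
    nlinarith [abs_nonneg θ]
  have h3 : 20 * σ ^ 2 ≤ 1 - Real.cos θ := by
    have : 2 / 10 * θ ^ 2 ≤ 2 / Real.pi ^ 2 * θ ^ 2 := by gcongr
    nlinarith
  have h4 : (1 - r) ^ 2 ≤ σ ^ 2 := by
    apply sq_le_sq'
    · linarith
    · linarith
  nlinarith [sq_nonneg σ]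

theorem norm_inv_theta4_minor_le {σ θ : ℝ} (hσ : 0 < σ) (hσ' : σ ≤ 1 / 20) (h1 : 10 * σ ≤ |θ|)
    (h2 : |θ| ≤ Real.pi) :
    ‖(theta4 (Complex.exp (-(σ + θ * Complex.I))))⁻¹‖ ≤ √(σ / Real.pi) / 2 *
      Real.exp ((Real.pi / 2) ^ 2 / σ) * Real.exp (-(5 / 3 * (1 / σ - 1))) := by
  set q := Complex.exp (-(σ + θ * Complex.I)) with hq
  have hqn : ‖q‖ = Real.exp (-σ) := by
    rw [hq, Complex.norm_exp]
    simp
  have hr1 : 1 - σ ≤ Real.exp (-σ) := by linarith [Real.add_one_le_exp (-σ)]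
  have hr2 : Real.exp (-σ) < 1 := Real.exp_lt_one_iff.2 (by linarith)
  have hπ := Real.pi_pos
  have hA := theta4_lower_bound (q := q) (by rw [hqn]; exact hr2)
  have hB := le_norm_theta4_exp_neg hσ
  have hC := norm_one_sub_exp_neg_ge hσ hσ' h1 h2
  rw [hqn] at hA
  -- The constant is `5 / 3 = 2 * (1 - 1 / 6)`, with the `6` of `norm_one_sub_exp_neg_ge`.
  have hD : 5 / 3 * (1 / σ - 1)
      ≤ 2 * (Real.exp (-σ) / (1 - Real.exp (-σ)) - (q / (1 - q)).re) := by
    have hu : 0 < 1 - Real.exp (-σ) := by linarith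
    have d1 : (q / (1 - q)).re ≤ Real.exp (-σ) / (6 * (1 - Real.exp (-σ))) := by
      refine (Complex.re_le_norm _).trans ?_
      rw [norm_div, hqn]
      gcongr
    have d2 : 1 / σ - 1 ≤ Real.exp (-σ) / (1 - Real.exp (-σ)) := by
      have : Real.exp (-σ) / (1 - Real.exp (-σ)) = 1 / (1 - Real.exp (-σ)) - 1 := by
        field_simp
        ring
      rw [this]
      gcongr
      linarith
    have d3 : Real.exp (-σ) / (6 * (1 - Real.exp (-σ)))
        = 1 / 6 * (Real.exp (-σ) / (1 - Real.exp (-σ))) := by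
      field_simp
    rw [d3] at d1
    linarith
  have hE : 2 * (1 / √(σ / Real.pi)) * Real.exp (-(Real.pi ^ 2 / 4) / σ)
      * Real.exp (5 / 3 * (1 / σ - 1)) ≤ ‖theta4 q‖ := by
    refine le_trans ?_ hA
    gcongr
  rw [norm_inv]
  have hs : 0 < √(σ / Real.pi) := Real.sqrt_pos.2 (by positivity)
  refine (inv_anti₀ (by positivity) hE).trans_eq ?_
  rw [mul_inv, mul_inv, ← Real.exp_neg, ← Real.exp_neg]
  congr 2
  · field_simp
  · congr 1
    ring

/-! ### The main integral -/

theorem norm_integral_sub_interval_le {f : ℝ → ℂ} (hf : Integrable f) {T c : ℝ} (hT : 0 < T)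
    (hb : ∀ ω : ℝ, T ≤ |ω| → ‖f ω‖ ≤ c * |ω| ^ (-(3 / 2) : ℝ)) :
    ‖(∫ ω, f ω) - ∫ ω in -T..T, f ω‖ ≤ 4 * c / √T := by
  have half (h : ℝ → ℂ) (hb : ∀ ω : ℝ, T ≤ |ω| → ‖h ω‖ ≤ c * |ω| ^ (-(3 / 2) : ℝ)) :
      ‖∫ ω in Set.Ioi T, h ω‖ ≤ 2 * c / √T := by
    have hi : IntegrableOn (fun ω : ℝ => c * ω ^ (-(3 / 2) : ℝ)) (Set.Ioi T) :=
      (integrableOn_Ioi_rpow_of_lt (by norm_num) hT).const_mul c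
    refine (norm_integral_le_of_norm_le hi ?_).trans_eq ?_
    · filter_upwards [ae_restrict_mem measurableSet_Ioi] with ω hω
      have h0 : T < ω := hω
      have := hb ω (h0.le.trans (le_abs_self ω))
      rwa [abs_of_pos (hT.trans h0)] at this
    · rw [integral_const_mul, integral_Ioi_rpow_of_lt (by norm_num) hT, Real.sqrt_eq_rpow,
        show (-(3 / 2) + 1 : ℝ) = -(1 / 2) by norm_num, Real.rpow_neg hT.le]
      field_simp
  have e1 : (∫ ω, f ω) = (∫ ω in Set.Iic (-T), f ω) + ((∫ ω in -T..T, f ω)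
      + ∫ ω in Set.Ioi T, f ω) := by
    rw [intervalIntegral.integral_of_le (by linarith), ← setIntegral_union
      (Set.Ioc_disjoint_Ioi le_rfl) measurableSet_Ioi hf.integrableOn hf.integrableOn,
      Set.Ioc_union_Ioi_eq_Ioi (by linarith), ← setIntegral_union (Set.Iic_disjoint_Ioi le_rfl)
      measurableSet_Ioi hf.integrableOn hf.integrableOn, Set.Iic_union_Ioi, Measure.restrict_univ]
  have e2 : (∫ ω, f ω) - ∫ ω in -T..T, f ω
      = (∫ ω in Set.Ioi T, f (-ω)) + ∫ ω in Set.Ioi T, f ω := by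
    rw [e1, integral_comp_neg_Ioi]
    ring
  rw [e2]
  refine (norm_add_le _ _).trans ?_
  have h1 := half f hb
  have h2 := half (fun ω => f (-ω)) fun ω hω => by
    have := hb (-ω) (by rwa [abs_neg])
    rwa [abs_neg] at this
  calc _ ≤ 2 * c / √T + 2 * c / √T := add_le_add h2 h1
    _ = _ := by ring

/-- The exponential `exp (a / t + ν t)`, with its saddle point at `t = √(a / ν)`. -/
noncomputable def saddleExp (a ν : ℝ) (t : ℂ) : ℂ := Complex.exp (a / t) * Complex.exp (ν * t)

theorem norm_saddleExp_line_le {a ν σ T ω : ℝ} (ha : 0 ≤ a) (hσ : 0 < σ) (hT : 0 ≤ T)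
    (hω : T ≤ |ω|) :
    ‖saddleExp a ν (σ + ω * Complex.I)‖ ≤ Real.exp (a * σ / (σ ^ 2 + T ^ 2) + ν * σ) := by
  rw [saddleExp, norm_mul, Complex.norm_exp, Complex.norm_exp, ← Real.exp_add]
  gcongr
  · rw [Complex.div_re, Complex.normSq_apply]
    simp only [Complex.ofReal_re, Complex.add_re, Complex.mul_re, Complex.I_re, mul_zero,
      Complex.ofReal_im, Complex.I_im, mul_one, sub_self, add_zero, Complex.add_im, Complex.mul_im,
      zero_add, zero_mul, zero_div]
    rw [← sq, ← sq]
    have := pow_le_pow_left₀ hT hω 2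
    rw [sq_abs] at this
    exact div_le_div_of_nonneg_left (by positivity) (by positivity) (by linarith)
  · rw [Complex.re_ofReal_mul, re_line]

/-- Modulo an exact derivative, `√t exp (a / t + ν t)` equals a combination of
`t ^ (-3/2) exp (a / t + ν t)` and `t ^ (-5/2) exp (a / t + ν t)`, which are integrable over the
whole vertical line. -/
theorem hasDerivAt_saddle {a ν : ℝ} (hν : ν ≠ 0) {t : ℂ} (ht : 0 < t.re) :
    HasDerivAt (fun t => (csqrt t / ν - 1 / (2 * ν ^ 2 * csqrt t)) * saddleExp a ν t)
      (csqrt t * saddleExp a ν t - ((a / ν - 1 / (4 * ν ^ 2) : ℝ) / (t * csqrt t)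
        + (-(a / (2 * ν ^ 2)) : ℝ) / (t ^ 2 * csqrt t)) * saddleExp a ν t) t := by
  have ht0 := ne_zero_of_re_pos ht
  have hw0 := csqrt_ne_zero ht0
  have hν' : (ν : ℂ) ≠ 0 := by exact_mod_cast hν
  have hw := hasDerivAt_csqrt ht
  have h1 : HasDerivAt (fun t => csqrt t / ν - 1 / (2 * ν ^ 2 * csqrt t))
      (1 / (2 * csqrt t) / ν - (0 * (2 * ν ^ 2 * csqrt t) - 1 * (2 * ν ^ 2 * (1 / (2 * csqrt t))))
        / (2 * ν ^ 2 * csqrt t) ^ 2) t :=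
    (hw.div_const _).sub ((hasDerivAt_const t (1 : ℂ)).div (hw.const_mul _)
      (mul_ne_zero (mul_ne_zero two_ne_zero (pow_ne_zero _ hν')) hw0))
  have h2 : HasDerivAt (saddleExp a ν)
      (Complex.exp (a / t) * ((0 * t - a * 1) / t ^ 2) * Complex.exp (ν * t)
        + Complex.exp (a / t) * (Complex.exp (ν * t) * (ν * 1))) t :=
    (((hasDerivAt_const t (a : ℂ)).div (hasDerivAt_id t) ht0).cexp).mul
      (((hasDerivAt_id t).const_mul (ν : ℂ)).cexp)
  refine (h1.mul h2).congr_deriv ?_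
  have hs := csqrt_sq t
  simp only [saddleExp]
  generalize csqrt t = w at *
  subst hs
  push_cast
  field_simp
  ring

theorem continuous_saddleExp_line {a ν σ : ℝ} (hσ : 0 < σ) :
    Continuous fun ω : ℝ => saddleExp a ν (σ + ω * Complex.I) := by
  refine Continuous.mul (Complex.continuous_exp.comp ?_) (by fun_prop)
  exact continuous_const.div (by fun_prop) (line_ne_zero hσ)

/-- The integrable function that remains of `√t exp (a / t + ν t)` in `hasDerivAt_saddle`. -/
noncomputable def saddleKernel (a ν : ℝ) (t : ℂ) : ℂ :=
  ((a / ν - 1 / (4 * ν ^ 2) : ℝ) / (t * csqrt t)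
        + (-(a / (2 * ν ^ 2)) : ℝ) / (t ^ 2 * csqrt t)) * saddleExp a ν t

theorem integrable_saddleKernel {a ν σ : ℝ} (ha : 0 ≤ a) (hσ : 0 < σ) :
    Integrable fun ω : ℝ => saddleKernel a ν (σ + ω * Complex.I) := by
  have h := integrable_line_kernel ha hσ (a / ν - 1 / (4 * ν ^ 2) : ℝ) (-(a / (2 * ν ^ 2)) : ℝ)
  have hb : ∀ ω : ℝ, ‖Complex.exp (ν * (σ + ω * Complex.I))‖ ≤ Real.exp (ν * σ) := fun ω => by
    rw [Complex.norm_exp, Complex.re_ofReal_mul, re_line]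
  have hm : Continuous fun ω : ℝ => Complex.exp (ν * (σ + ω * Complex.I)) := by fun_prop
  have := h.mul_bdd (c := Real.exp (ν * σ)) hm.aestronglyMeasurable (Eventually.of_forall hb)
  refine this.congr (Eventually.of_forall fun ω => ?_)
  simp only [saddleKernel, saddleExp]
  ring

theorem integral_csqrt_saddleExp {a ν σ : ℝ} (hν : ν ≠ 0) (ha : 0 ≤ a) (hσ : 0 < σ) (T : ℝ) :
    ∫ ω in -T..T, csqrt (σ + ω * Complex.I) * saddleExp a ν (σ + ω * Complex.I)
      = (∫ ω in -T..T, saddleKernel a ν (σ + ω * Complex.I))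
        + (-Complex.I * ((csqrt (σ + (T : ℝ) * Complex.I) / ν
            - 1 / (2 * ν ^ 2 * csqrt (σ + (T : ℝ) * Complex.I)))
            * saddleExp a ν (σ + (T : ℝ) * Complex.I))
          - -Complex.I * ((csqrt (σ + (-T : ℝ) * Complex.I) / ν
            - 1 / (2 * ν ^ 2 * csqrt (σ + (-T : ℝ) * Complex.I)))
            * saddleExp a ν (σ + (-T : ℝ) * Complex.I))) := by
  have hI := Complex.I_mul_I
  have c1 : Continuous fun ω : ℝ => csqrt (σ + ω * Complex.I) * saddleExp a ν (σ + ω * Complex.I) :=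
    (continuous_csqrt_line hσ).mul (continuous_saddleExp_line hσ)
  have i2 : IntervalIntegrable (fun ω : ℝ => saddleKernel a ν (σ + ω * Complex.I)) volume (-T) T :=
    (integrable_saddleKernel ha hσ).intervalIntegrable
  have i1 := c1.intervalIntegrable (μ := volume) (-T) T
  have hd (ω : ℝ) : HasDerivAt (fun ω : ℝ => -Complex.I * ((csqrt (σ + ω * Complex.I) / ν
            - 1 / (2 * ν ^ 2 * csqrt (σ + ω * Complex.I))) * saddleExp a ν (σ + ω * Complex.I)))
      (csqrt (σ + ω * Complex.I) * saddleExp a ν (σ + ω * Complex.I)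
        - saddleKernel a ν (σ + ω * Complex.I)) ω := by
    have h1 := hasDerivAt_saddle (a := a) hν (t := σ + ω * Complex.I) (by rwa [re_line])
    have h2 : HasDerivAt (fun ω : ℝ => (σ : ℂ) + ω * Complex.I) (1 * Complex.I) ω :=
      ((Complex.ofRealCLM.hasDerivAt (x := ω)).mul_const Complex.I).const_add _
    have h3 := (HasDerivAt.comp ω h1 h2).const_mul (-Complex.I)
    refine h3.congr_deriv ?_
    rw [saddleKernel]
    linear_combination (-(csqrt (σ + ω * Complex.I) * saddleExp a ν (σ + ω * Complex.I)
      - ((a / ν - 1 / (4 * ν ^ 2) : ℝ) / ((σ + ω * Complex.I) * csqrt (σ + ω * Complex.I))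
        + (-(a / (2 * ν ^ 2)) : ℝ) / ((σ + ω * Complex.I) ^ 2 * csqrt (σ + ω * Complex.I)))
          * saddleExp a ν (σ + ω * Complex.I))) * hI
  have h := intervalIntegral.integral_eq_sub_of_hasDerivAt (a := -T) (b := T)
    (fun ω _ => hd ω) (i1.sub i2)
  rw [intervalIntegral.integral_sub i1 i2, sub_eq_iff_eq_add] at h
  rw [h, add_comm]

theorem norm_saddleKernel_le {a ν σ T ω : ℝ} (ha : 0 ≤ a) (hσ : 0 < σ) (hT : 0 < T)
    (hω : T ≤ |ω|) :
    ‖saddleKernel a ν (σ + ω * Complex.I)‖ ≤ ((|a / ν - 1 / (4 * ν ^ 2)| + a / (2 * ν ^ 2) / T)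
      * Real.exp (a * σ / (σ ^ 2 + T ^ 2) + ν * σ)) * |ω| ^ (-(3 / 2) : ℝ) := by
  have hE := norm_saddleExp_line_le (ν := ν) ha hσ hT.le hω
  rw [saddleKernel, norm_mul, mul_right_comm]
  gcongr
  set t : ℂ := σ + ω * Complex.I with ht
  have hωt : |ω| ≤ ‖t‖ := by
    have := Complex.abs_im_le_norm t
    simpa [ht] using this
  have hω0 : 0 < |ω| := hT.trans_le hω
  have ht0 : 0 < ‖t‖ := hω0.trans_le hωt
  have hpow : |ω| ^ (-(3 / 2) : ℝ) = 1 / (|ω| * √|ω|) := by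
    rw [Real.sqrt_eq_rpow, ← Real.rpow_one_add' hω0.le (by norm_num), Real.rpow_neg hω0.le]
    norm_num
  refine (norm_add_le _ _).trans ?_
  rw [norm_div, norm_div, norm_mul, norm_mul, norm_pow, norm_csqrt, Complex.norm_real,
    Complex.norm_real, Real.norm_eq_abs, Real.norm_eq_abs, abs_neg,
    abs_of_nonneg (by positivity : 0 ≤ a / (2 * ν ^ 2)), hpow, add_mul]
  have hs : √|ω| ≤ √‖t‖ := Real.sqrt_le_sqrt hωt
  have hs0 : 0 < √|ω| := Real.sqrt_pos.2 hω0
  gcongr ?_ + ?_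
  · rw [mul_one_div]
    gcongr
  · rw [mul_one_div, div_div (a / (2 * ν ^ 2))]
    have : T * (|ω| * √|ω|) ≤ ‖t‖ ^ 2 * √‖t‖ := by
      calc T * (|ω| * √|ω|) ≤ ‖t‖ * (‖t‖ * √‖t‖) := by
            gcongr
            exact hω.trans hωt
        _ = _ := by ring
    gcongr

/-- The integral of `√t exp (α² / t + ν t)` over a segment of the line `re t = σ`, up to the tails
of the integral of `saddleKernel` and the boundary terms of the integration by parts. -/
theorem norm_integral_csqrt_sub_le {α ν σ T : ℝ} (hν : 0 < ν) (hσ : 0 < σ) (hT : 0 < T) :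
    ‖(∫ ω in -T..T, csqrt (σ + ω * Complex.I) * saddleExp (α ^ 2) ν (σ + ω * Complex.I))
      - (2 * Real.pi * ((α / ν * Real.sinh (2 * α * √ν)
        - √ν * Real.cosh (2 * α * √ν) / (2 * ν ^ 2)) / √Real.pi) : ℝ)‖
      ≤ (4 * (|α ^ 2 / ν - 1 / (4 * ν ^ 2)| + α ^ 2 / (2 * ν ^ 2) / T) / √T
          + 2 * (√(σ + T) / ν + 1 / (2 * ν ^ 2 * √T)))
        * Real.exp (α ^ 2 * σ / (σ ^ 2 + T ^ 2) + ν * σ) := by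
  have ha : 0 ≤ α ^ 2 := sq_nonneg α
  have hfull : ∫ ω : ℝ, saddleKernel (α ^ 2) ν (σ + ω * Complex.I)
      = (2 * Real.pi * ((α / ν * Real.sinh (2 * α * √ν)
        - √ν * Real.cosh (2 * α * √ν) / (2 * ν ^ 2)) / √Real.pi) : ℝ) := by
    have h := integral_line_kernel hσ hν α (α / ν) (-(1 / (2 * ν ^ 2)))
    have e1 : α / ν * α + -(1 / (2 * ν ^ 2)) / 2 = α ^ 2 / ν - 1 / (4 * ν ^ 2) := by
      field_simp; ring
    have e2 : -(1 / (2 * ν ^ 2)) * α ^ 2 = -(α ^ 2 / (2 * ν ^ 2)) := by ring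
    rw [e1, e2] at h
    simp only [saddleKernel, saddleExp, ← mul_assoc]
    rw [h]
    push_cast
    ring
  have htail := norm_integral_sub_interval_le (integrable_saddleKernel (ν := ν) ha hσ) hT
    (fun ω hω => norm_saddleKernel_le ha hσ hT hω)
  rw [hfull] at htail
  have hbd (ω : ℝ) (hω : |ω| = T) : ‖-Complex.I * ((csqrt (σ + ω * Complex.I) / ν
            - 1 / (2 * ν ^ 2 * csqrt (σ + ω * Complex.I)))
            * saddleExp (α ^ 2) ν (σ + ω * Complex.I))‖
      ≤ (√(σ + T) / ν + 1 / (2 * ν ^ 2 * √T))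
        * Real.exp (α ^ 2 * σ / (σ ^ 2 + T ^ 2) + ν * σ) := by
    have hE := norm_saddleExp_line_le (ν := ν) ha hσ hT.le hω.ge
    have ht1 : ‖(σ : ℂ) + ω * Complex.I‖ ≤ σ + T := by
      refine (norm_add_le _ _).trans_eq ?_
      rw [norm_mul, Complex.norm_I, mul_one, Complex.norm_of_nonneg hσ.le, Complex.norm_real,
        Real.norm_eq_abs, hω]
    have ht2 : T ≤ ‖(σ : ℂ) + ω * Complex.I‖ := by
      have := Complex.abs_im_le_norm ((σ : ℂ) + ω * Complex.I)
      rw [← hω]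
      simpa using this
    rw [norm_mul, norm_mul, norm_neg, Complex.norm_I, one_mul]
    gcongr
    refine (norm_sub_le _ _).trans ?_
    rw [norm_div, norm_div, norm_mul, norm_mul, norm_pow, norm_csqrt, Complex.norm_of_nonneg hν.le,
      norm_one, Complex.norm_ofNat]
    have hs0 := Real.sqrt_pos.2 hT
    gcongr
  have h1 := hbd T (abs_of_pos hT)
  have h2 := hbd (-T) (by rw [abs_neg, abs_of_pos hT])
  rw [integral_csqrt_saddleExp hν.ne' ha hσ T, add_sub_right_comm]
  refine (norm_add_le _ _).trans ?_
  rw [norm_sub_rev] at htail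
  calc _ ≤ 4 * ((|α ^ 2 / ν - 1 / (4 * ν ^ 2)| + α ^ 2 / (2 * ν ^ 2) / T)
          * Real.exp (α ^ 2 * σ / (σ ^ 2 + T ^ 2) + ν * σ)) / √T
        + ((√(σ + T) / ν + 1 / (2 * ν ^ 2 * √T))
          * Real.exp (α ^ 2 * σ / (σ ^ 2 + T ^ 2) + ν * σ)
          + (√(σ + T) / ν + 1 / (2 * ν ^ 2 * √T))
          * Real.exp (α ^ 2 * σ / (σ ^ 2 + T ^ 2) + ν * σ)) :=
        add_le_add htail ((norm_sub_le _ _).trans (add_le_add h1 h2))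
    _ = _ := by ring

/-! ### The explicit approximation of the overpartition function -/

theorem continuous_inv_theta4_line {σ : ℝ} (hσ : 0 < σ) :
    Continuous fun θ : ℝ => (theta4 (Complex.exp (-(σ + θ * Complex.I))))⁻¹ := by
  have hq (θ : ℝ) : ‖Complex.exp (-(σ + θ * Complex.I))‖ < 1 := by
    rw [Complex.norm_exp, Complex.neg_re, re_line, Real.exp_lt_one_iff]
    linarith
  refine Continuous.inv₀ ?_ fun θ => theta4_ne_zero (hq θ)
  exact differentiableOn_theta4.continuousOn.comp_continuous (by fun_prop)
    fun θ => mem_ball_zero_iff.2 (hq θ)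

theorem re_one_div_line (σ θ : ℝ) :
    (1 / ((σ : ℂ) + θ * Complex.I)).re = σ / (σ ^ 2 + θ ^ 2) := by
  rw [one_div, Complex.inv_re, Complex.normSq_apply]
  simp [sq]

theorem norm_line_le {σ θ T : ℝ} (hσ : 0 < σ) (h : |θ| ≤ T) :
    ‖(σ : ℂ) + θ * Complex.I‖ ≤ σ + T := by
  refine (norm_add_le _ _).trans ?_
  rw [norm_mul, Complex.norm_I, mul_one, Complex.norm_of_nonneg hσ.le, Complex.norm_real,
    Real.norm_eq_abs]
  linarith

theorem exp_five_thirds_le : Real.exp (5 / 3) ≤ 6 := by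
  have h1 : Real.exp (5 / 3) ^ 3 = Real.exp 1 ^ 5 := by
    rw [← Real.exp_nat_mul, ← Real.exp_nat_mul]
    norm_num
  have h2 : Real.exp 1 ^ 5 ≤ (2.72 : ℝ) ^ 5 := by
    gcongr
    linarith [Real.exp_one_lt_d9]
  refine le_of_pow_le_pow_left₀ three_ne_zero (by norm_num) ?_
  rw [h1]
  refine h2.trans ?_
  norm_num

/-- On the major arc `|θ| ≤ 10 σ`, where `σ = π / (2 √n)` is the saddle point, the integrand is
close to its leading term. -/
theorem major_arc_bound {s θ : ℝ} {n : ℕ} (hs : s ^ 2 = n) (h34 : 34 ≤ s)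
    (hθ : |θ| ≤ 10 * (Real.pi / (2 * s))) :
    ‖Complex.exp (n * ((Real.pi / (2 * s) : ℝ) + θ * Complex.I)) *
        (theta4 (Complex.exp (-((Real.pi / (2 * s) : ℝ) + θ * Complex.I))))⁻¹
      - 1 / (2 * √Real.pi) * (csqrt ((Real.pi / (2 * s) : ℝ) + θ * Complex.I) *
        saddleExp ((Real.pi / 2) ^ 2) n ((Real.pi / (2 * s) : ℝ) + θ * Complex.I))‖
      ≤ 2 * Real.exp (Real.pi * s / 2) := by
  have hπ := Real.pi_pos
  have hπ3 := Real.pi_gt_three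
  have hπ4 := Real.pi_lt_d2
  have hs0 : 0 < s := by linarith
  set σ := Real.pi / (2 * s) with hσd
  have hσ : 0 < σ := by positivity
  have hσs : σ * s = Real.pi / 2 := by rw [hσd]; field_simp
  have hnσ : (n : ℝ) * σ = Real.pi * s / 2 := by rw [← hs, hσd]; field_simp
  have h11 : σ + 10 * σ ≤ 1 := by nlinarith
  set t : ℂ := σ + θ * Complex.I with ht
  have htre : t.re = σ := re_line σ θ
  have hnt : ‖t‖ ≤ 1 := (norm_line_le hσ hθ).trans h11
  have hθ2 : θ ^ 2 ≤ 100 * σ ^ 2 := by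
    have := pow_le_pow_left₀ (abs_nonneg θ) hθ 2
    rw [sq_abs] at this
    linarith
  have hx : Real.exp (-(2 * Real.pi ^ 2 * (1 / t).re)) ≤ 1 / 4 := by
    rw [ht, re_one_div_line]
    have h1 : 2 * s / (101 * Real.pi) ≤ σ / (σ ^ 2 + θ ^ 2) := by
      have : 2 * s / (101 * Real.pi) = σ / (101 * σ ^ 2) := by rw [hσd]; field_simp
      rw [this]
      gcongr
      linarith
    have h2 : (3 : ℝ) ≤ 2 * Real.pi ^ 2 * (σ / (σ ^ 2 + θ ^ 2)) := by
      calc (3 : ℝ) ≤ 4 * Real.pi * s / 101 := by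
            rw [le_div_iff₀ (by norm_num)]
            nlinarith
        _ = 2 * Real.pi ^ 2 * (2 * s / (101 * Real.pi)) := by field_simp; ring
        _ ≤ _ := by gcongr
    have h3 : (4 : ℝ) ≤ Real.exp (2 * Real.pi ^ 2 * (σ / (σ ^ 2 + θ ^ 2))) := by
      linarith [Real.add_one_le_exp (2 * Real.pi ^ 2 * (σ / (σ ^ 2 + θ ^ 2)))]
    rw [Real.exp_neg, one_div]
    exact inv_anti₀ (by norm_num) h3
  have hmain := norm_inv_theta4_sub_le (t := t) (by rwa [htre]) hx
  have e : Complex.exp (n * t) * (theta4 (Complex.exp (-t)))⁻¹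
      - 1 / (2 * √Real.pi) * (csqrt t * saddleExp ((Real.pi / 2) ^ 2) n t)
      = Complex.exp (n * t) * ((theta4 (Complex.exp (-t)))⁻¹ - csqrt t / (2 * √Real.pi)
      * Complex.exp ((Real.pi / 2 : ℝ) ^ 2 / t)) := by
    rw [saddleExp]
    push_cast
    ring
  rw [e, norm_mul, mul_comm]
  have e2 : ‖Complex.exp (n * t)‖ = Real.exp (Real.pi * s / 2) := by
    rw [Complex.norm_exp, ← hnσ, ← htre, ← Complex.ofReal_natCast, Complex.re_ofReal_mul]
  rw [e2]
  gcongr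
  refine hmain.trans ?_
  have h1 : √‖t‖ ≤ 1 := Real.sqrt_le_one.2 hnt
  have h2 : 1 ≤ √Real.pi := Real.one_le_sqrt.2 (by linarith)
  rw [div_le_iff₀ (by linarith)]
  linarith

/-- On the minor arcs the integrand is smaller than `p̄(n)` by a factor of about `exp (-√n)`. -/
theorem minor_arc_bound {s θ : ℝ} {n : ℕ} (hs : s ^ 2 = n) (h34 : 34 ≤ s)
    (h1 : 10 * (Real.pi / (2 * s)) ≤ |θ|) (h2 : |θ| ≤ Real.pi) :
    ‖Complex.exp (n * ((Real.pi / (2 * s) : ℝ) + θ * Complex.I)) *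
        (theta4 (Complex.exp (-((Real.pi / (2 * s) : ℝ) + θ * Complex.I))))⁻¹‖
      ≤ 3 / 8 * Real.exp ((Real.pi - 1) * s) := by
  have hπ := Real.pi_pos
  have hπ4 := Real.pi_lt_d2
  have hs0 : 0 < s := by linarith
  set σ := Real.pi / (2 * s) with hσd
  have hσ : 0 < σ := by positivity
  have hσs : σ * s = Real.pi / 2 := by rw [hσd]; field_simp
  have hnσ : (n : ℝ) * σ = Real.pi * s / 2 := by rw [← hs, hσd]; field_simp
  have hσ' : σ ≤ 1 / 20 := by nlinarith
  have hm := norm_inv_theta4_minor_le hσ hσ' h1 h2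
  have hsq : √(σ / Real.pi) ≤ 1 / 8 := by
    rw [Real.sqrt_le_left (by norm_num)]
    have : σ / Real.pi = 1 / (2 * s) := by rw [hσd]; field_simp
    rw [this, div_le_iff₀ (by positivity)]
    linarith
  have e1 : (Real.pi / 2) ^ 2 / σ = Real.pi * s / 2 := by rw [hσd]; field_simp
  have e2 : Real.exp (-(5 / 3 * (1 / σ - 1))) ≤ 6 * Real.exp (-s) := by
    have h3 : s ≤ 5 / 3 * (1 / σ) := by
      have : 5 / 3 * (1 / σ) = 10 * s / (3 * Real.pi) := by rw [hσd]; field_simp; norm_num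
      rw [this, le_div_iff₀ (by positivity)]
      nlinarith
    calc Real.exp (-(5 / 3 * (1 / σ - 1))) ≤ Real.exp (5 / 3 + -s) := by
          gcongr
          linarith
      _ = Real.exp (5 / 3) * Real.exp (-s) := Real.exp_add _ _
      _ ≤ _ := by gcongr; exact exp_five_thirds_le
  rw [norm_mul]
  have e3 : ‖Complex.exp (n * (σ + θ * Complex.I))‖ = Real.exp (Real.pi * s / 2) := by
    rw [Complex.norm_exp, ← hnσ, ← Complex.ofReal_natCast, Complex.re_ofReal_mul, re_line]
  rw [e3]
  rw [e1] at hm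
  calc _ ≤ Real.exp (Real.pi * s / 2) *
        (1 / 8 / 2 * Real.exp (Real.pi * s / 2) * (6 * Real.exp (-s))) := by
        gcongr
        refine hm.trans ?_
        gcongr
    _ = 3 / 8 * (Real.exp (Real.pi * s / 2) * Real.exp (Real.pi * s / 2) * Real.exp (-s)) := by ring
    _ = _ := by
        rw [← Real.exp_add, ← Real.exp_add]
        congr 2
        ring

/-- The error term of `norm_integral_csqrt_sub_le` for `α = π / 2`, `ν = s²`, `σ = π / (2 s)` and
`T = 10 σ`. -/
theorem saddle_error_le {s : ℝ} (h34 : 34 ≤ s) :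
    (4 * (|(Real.pi / 2) ^ 2 / s ^ 2 - 1 / (4 * (s ^ 2) ^ 2)|
        + (Real.pi / 2) ^ 2 / (2 * (s ^ 2) ^ 2) / (10 * (Real.pi / (2 * s))))
        / √(10 * (Real.pi / (2 * s)))
      + 2 * (√(Real.pi / (2 * s) + 10 * (Real.pi / (2 * s))) / s ^ 2
        + 1 / (2 * (s ^ 2) ^ 2 * √(10 * (Real.pi / (2 * s))))))
      * Real.exp ((Real.pi / 2) ^ 2 * (Real.pi / (2 * s)) / ((Real.pi / (2 * s)) ^ 2
        + (10 * (Real.pi / (2 * s))) ^ 2) + s ^ 2 * (Real.pi / (2 * s)))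
      ≤ Real.exp (8 / 5 * s) := by
  have hπ := Real.pi_pos
  have hπ3 := Real.pi_gt_three
  have hπ4 := Real.pi_lt_d2
  have hs0 : 0 < s := by linarith
  have hπ2 : (Real.pi / 2) ^ 2 ≤ 5 / 2 := by nlinarith
  have hπ2' : (9 / 4 : ℝ) ≤ (Real.pi / 2) ^ 2 := by nlinarith
  have hexp : (Real.pi / 2) ^ 2 * (Real.pi / (2 * s)) / ((Real.pi / (2 * s)) ^ 2
        + (10 * (Real.pi / (2 * s))) ^ 2) + s ^ 2 * (Real.pi / (2 * s)) ≤ 8 / 5 * s := by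
    have : (Real.pi / 2) ^ 2 * (Real.pi / (2 * s)) / ((Real.pi / (2 * s)) ^ 2
        + (10 * (Real.pi / (2 * s))) ^ 2) + s ^ 2 * (Real.pi / (2 * s))
        = Real.pi * (51 / 101) * s := by
      field_simp
      ring
    rw [this]
    nlinarith
  have hTge : (1 / s) ^ 2 ≤ 10 * (Real.pi / (2 * s)) := by
    rw [div_pow, one_pow, div_le_iff₀ (by positivity)]
    have : 10 * (Real.pi / (2 * s)) * s ^ 2 = 5 * Real.pi * s := by field_simp; norm_num
    rw [this]
    nlinarith
  have hsT : 1 / s ≤ √(10 * (Real.pi / (2 * s))) := Real.le_sqrt_of_sq_le hTge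
  have hs11 : √(Real.pi / (2 * s) + 10 * (Real.pi / (2 * s))) ≤ 1 := by
    rw [Real.sqrt_le_one]
    have : Real.pi / (2 * s) ≤ 1 / 20 := by
      rw [div_le_div_iff₀ (by positivity) (by norm_num)]
      linarith
    linarith
  have hk1 : |(Real.pi / 2) ^ 2 / s ^ 2 - 1 / (4 * (s ^ 2) ^ 2)| ≤ 5 / 2 / s ^ 2 := by
    have h1 : 0 ≤ 1 / (4 * (s ^ 2) ^ 2) := by positivity
    have h2 : (Real.pi / 2) ^ 2 / s ^ 2 ≤ 5 / 2 / s ^ 2 := by gcongr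
    have h3 : 1 / (4 * (s ^ 2) ^ 2) ≤ (Real.pi / 2) ^ 2 / s ^ 2 := by
      rw [div_le_div_iff₀ (by positivity) (by positivity)]
      have : 1 * s ^ 2 ≤ (Real.pi / 2) ^ 2 * (4 * (s ^ 2 * s ^ 2)) := by
        have : 1 ≤ (Real.pi / 2) ^ 2 * (4 * s ^ 2) := by nlinarith
        nlinarith [sq_nonneg s]
      linarith [sq (s ^ 2)]
    rw [abs_of_nonneg (by linarith)]
    linarith
  have hk2 : (Real.pi / 2) ^ 2 / (2 * (s ^ 2) ^ 2) / (10 * (Real.pi / (2 * s))) ≤ 1 / s ^ 2 := by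
    have : (Real.pi / 2) ^ 2 / (2 * (s ^ 2) ^ 2) / (10 * (Real.pi / (2 * s)))
        = (Real.pi / (40 * s)) / s ^ 2 := by field_simp; norm_num
    rw [this]
    gcongr
    rw [div_le_one (by positivity)]
    linarith
  have hcoef : 4 * (|(Real.pi / 2) ^ 2 / s ^ 2 - 1 / (4 * (s ^ 2) ^ 2)|
        + (Real.pi / 2) ^ 2 / (2 * (s ^ 2) ^ 2) / (10 * (Real.pi / (2 * s))))
        / √(10 * (Real.pi / (2 * s)))
      + 2 * (√(Real.pi / (2 * s) + 10 * (Real.pi / (2 * s))) / s ^ 2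
        + 1 / (2 * (s ^ 2) ^ 2 * √(10 * (Real.pi / (2 * s))))) ≤ 1 := by
    calc _ ≤ 4 * (5 / 2 / s ^ 2 + 1 / s ^ 2) / (1 / s)
          + 2 * (1 / s ^ 2 + 1 / (2 * (s ^ 2) ^ 2 * (1 / s))) := by gcongr
      _ = 14 * (1 / s) + 2 * (1 / s) ^ 2 + (1 / s) ^ 3 := by field_simp; ring
      _ ≤ 14 * (1 / 34) + 2 * (1 / 34) ^ 2 + (1 / 34) ^ 3 := by gcongr
      _ ≤ 1 := by norm_num
  calc _ ≤ 1 * Real.exp (8 / 5 * s) := by gcongr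
    _ = _ := one_mul _

/-- The circle method with explicit constants: `2 π p̄(n)` is approximated by the derivative of
`cosh (π √n) / √n` with respect to `n`. The minor arcs contribute the dominant part of the error. -/
theorem overpartitionCount_approx {s : ℝ} {n : ℕ} (hs : s ^ 2 = n) (h34 : 34 ≤ s) :
    |2 * Real.pi * overpartitionCount n - (Real.pi / 2 / s ^ 2 * Real.sinh (Real.pi * s)
      - s * Real.cosh (Real.pi * s) / (2 * (s ^ 2) ^ 2))| ≤ 3 * Real.exp ((Real.pi - 1) * s) := by
  have hπ := Real.pi_pos
  have hπ3 := Real.pi_gt_d2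
  have hπ4 := Real.pi_lt_d2
  have hs0 : 0 < s := by linarith
  have hA := saddle_error_le h34
  have hmaj (θ : ℝ) := major_arc_bound (θ := θ) hs h34
  have hmin (θ : ℝ) := minor_arc_bound (θ := θ) hs h34
  have hσs : Real.pi / (2 * s) * s = Real.pi / 2 := by field_simp
  have hT1 : 10 * (Real.pi / (2 * s)) ≤ 1 / 2 := by nlinarith
  have hσ : 0 < Real.pi / (2 * s) := by positivity
  have hint := overpartitionCount_eq_integral n hσ
  have hsad := norm_integral_csqrt_sub_le (α := Real.pi / 2) (ν := s ^ 2) (by positivity) hσ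
    (by positivity : 0 < 10 * (Real.pi / (2 * s)))
  replace hsad := hsad.trans hA
  have hsn : √(n : ℝ) = s := by rw [← hs, Real.sqrt_sq hs0.le]
  have h2π : 2 * (Real.pi / 2) * √(n : ℝ) = Real.pi * s := by rw [hsn]; ring
  rw [hs, h2π, hsn] at hsad
  rw [hs]
  set σ := Real.pi / (2 * s) with hσd
  set X : ℝ := Real.pi / 2 / n * Real.sinh (Real.pi * s)
    - s * Real.cosh (Real.pi * s) / (2 * (n : ℝ) ^ 2) with hX
  set g : ℝ → ℂ := fun θ => Complex.exp (n * (σ + θ * Complex.I)) *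
    (theta4 (Complex.exp (-(σ + θ * Complex.I))))⁻¹ with hg
  set k : ℝ → ℂ := fun θ => csqrt (σ + θ * Complex.I) *
    saddleExp ((Real.pi / 2) ^ 2) n (σ + θ * Complex.I) with hk
  have hgc : Continuous g := by
    have := continuous_inv_theta4_line hσ
    fun_prop
  have hkc : Continuous k := (continuous_csqrt_line hσ).mul (continuous_saddleExp_line hσ)
  have hgi (a b : ℝ) : IntervalIntegrable g volume a b := hgc.intervalIntegrable a b
  have hint' : ((2 * Real.pi * overpartitionCount n : ℝ) : ℂ)
      = (∫ θ in -Real.pi..-(10 * σ), g θ) + (∫ θ in -(10 * σ)..(10 * σ), g θ)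
        + ∫ θ in (10 * σ)..Real.pi, g θ := by
    rw [intervalIntegral.integral_add_adjacent_intervals (hgi _ _) (hgi _ _),
      intervalIntegral.integral_add_adjacent_intervals (hgi _ _) (hgi _ _)]
    push_cast
    rw [hint]
    simp only [div_eq_mul_inv, hg]
    have : (2 * Real.pi : ℂ) ≠ 0 := by exact_mod_cast (by positivity : 2 * Real.pi ≠ 0)
    rw [← mul_assoc, one_mul, mul_inv_cancel₀ this, one_mul]
  have hm1 : ‖∫ θ in -Real.pi..-(10 * σ), g θ‖
      ≤ 3 / 8 * Real.exp ((Real.pi - 1) * s) * |-(10 * σ) - -Real.pi| := by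
    refine intervalIntegral.norm_integral_le_of_norm_le_const fun θ hθ => ?_
    rw [Set.uIoc_of_le (by linarith)] at hθ
    rw [Set.mem_Ioc] at hθ
    have : |θ| = -θ := abs_of_nonpos (by linarith)
    exact hmin θ (by rw [this]; linarith) (by rw [this]; linarith)
  have hm2 : ‖∫ θ in (10 * σ)..Real.pi, g θ‖
      ≤ 3 / 8 * Real.exp ((Real.pi - 1) * s) * |Real.pi - 10 * σ| := by
    refine intervalIntegral.norm_integral_le_of_norm_le_const fun θ hθ => ?_
    rw [Set.uIoc_of_le (by linarith)] at hθ
    rw [Set.mem_Ioc] at hθ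
    have : |θ| = θ := abs_of_nonneg (by linarith)
    exact hmin θ (by rw [this]; linarith) (by rw [this]; linarith)
  have hM : ‖∫ θ in -(10 * σ)..(10 * σ), (g θ - 1 / (2 * √Real.pi) * k θ)‖
      ≤ 2 * Real.exp (Real.pi * s / 2) * |10 * σ - -(10 * σ)| := by
    refine intervalIntegral.norm_integral_le_of_norm_le_const fun θ hθ => ?_
    rw [Set.uIoc_of_le (by linarith)] at hθ
    rw [Set.mem_Ioc] at hθ
    exact hmaj θ (abs_le.2 ⟨hθ.1.le, hθ.2⟩)
  rw [intervalIntegral.integral_sub (hgi _ _) ((hkc.const_mul _).intervalIntegrable _ _),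
    intervalIntegral.integral_const_mul] at hM
  rw [abs_of_nonneg (by linarith)] at hm1 hm2 hM
  have hsπ : (1 : ℝ) ≤ √Real.pi := Real.one_le_sqrt.2 (by linarith)
  have hc : ‖(1 / (2 * √Real.pi) : ℂ)‖ ≤ 1 / 2 := by
    rw [norm_div, norm_one, norm_mul, Complex.norm_ofNat, Complex.norm_of_nonneg (by positivity)]
    gcongr
    linarith
  have hXe : (X : ℂ) = 1 / (2 * √Real.pi) * ((2 * Real.pi * (X / √Real.pi) : ℝ) : ℂ) := by
    have : X = 1 / (2 * √Real.pi) * (2 * Real.pi * (X / √Real.pi)) := by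
      have h := Real.mul_self_sqrt hπ.le
      field_simp
      rw [sq, h]
    exact_mod_cast this
  have htot : ‖((2 * Real.pi * overpartitionCount n : ℝ) : ℂ) - X‖
      ≤ 3 / 8 * Real.exp ((Real.pi - 1) * s) * (-(10 * σ) - -Real.pi)
        + 3 / 8 * Real.exp ((Real.pi - 1) * s) * (Real.pi - 10 * σ)
        + 2 * Real.exp (Real.pi * s / 2) * (10 * σ - -(10 * σ))
        + 1 / 2 * Real.exp (8 / 5 * s) := by
    have e : ((2 * Real.pi * overpartitionCount n : ℝ) : ℂ) - X
        = (∫ θ in -Real.pi..-(10 * σ), g θ) + (∫ θ in (10 * σ)..Real.pi, g θ)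
        + ((∫ θ in -(10 * σ)..(10 * σ), g θ)
          - 1 / (2 * √Real.pi) * ∫ θ in -(10 * σ)..(10 * σ), k θ)
        + 1 / (2 * √Real.pi) * ((∫ θ in -(10 * σ)..(10 * σ), k θ)
          - ((2 * Real.pi * (X / √Real.pi) : ℝ) : ℂ)) := by
      rw [hint', mul_sub, ← hXe]
      ring
    rw [e]
    refine norm_add_le_of_le (norm_add_le_of_le (norm_add_le_of_le hm1 hm2) hM) ?_
    rw [norm_mul]
    gcongr
  rw [← Complex.ofReal_sub, Complex.norm_real, Real.norm_eq_abs] at htot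
  have h1 : Real.exp (Real.pi * s / 2) ≤ Real.exp (8 / 5 * s) := by
    gcongr
    nlinarith
  have h2 : Real.exp (8 / 5 * s) ≤ Real.exp ((Real.pi - 1) * s) / 19 := by
    rw [le_div_iff₀ (by norm_num)]
    have h3 : (19 : ℝ) ≤ Real.exp ((Real.pi - 13 / 5) * s) := by
      have := Real.add_one_le_exp ((Real.pi - 13 / 5) * s)
      nlinarith
    calc Real.exp (8 / 5 * s) * 19 ≤ Real.exp (8 / 5 * s) * Real.exp ((Real.pi - 13 / 5) * s) := by
          gcongr
      _ = _ := by
          rw [← Real.exp_add]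
          congr 1
          ring
  have h4 := Real.exp_pos ((Real.pi - 1) * s)
  have h5 := Real.exp_pos (Real.pi * s / 2)
  refine htot.trans ?_
  nlinarith

/-! ### The logarithm of the overpartition function -/

theorem overpartitionCount_pos (n : ℕ) : 0 < overpartitionCount n := by
  refine Fintype.card_pos_iff.2 ⟨⟨default, ∅, by simp⟩⟩

theorem exp_ge_const_mul_pow_seven {s : ℝ} (h34 : 34 ≤ s) : 1800 * s ^ 7 ≤ Real.exp s := by
  have h1 : (s / 34) ^ 7 ≤ Real.exp (s - 34) := by
    calc (s / 34) ^ 7 ≤ Real.exp (s / 34 - 1) ^ 7 := by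
          gcongr
          linarith [Real.add_one_le_exp (s / 34 - 1)]
      _ = Real.exp (7 * (s / 34 - 1)) := by
          rw [← Real.exp_nat_mul]
          norm_num
      _ ≤ _ := by
          gcongr
          linarith
  have h2 : (2.7 : ℝ) ^ 34 ≤ Real.exp 34 := by
    calc (2.7 : ℝ) ^ 34 ≤ Real.exp 1 ^ 34 := by
          gcongr
          linarith [Real.exp_one_gt_d9]
      _ = _ := by
          rw [← Real.exp_nat_mul]
          norm_num
  calc 1800 * s ^ 7 = 1800 * 34 ^ 7 * (s / 34) ^ 7 := by ring
    _ ≤ 2.7 ^ 34 * (s / 34) ^ 7 := by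
        gcongr
        norm_num
    _ ≤ Real.exp 34 * Real.exp (s - 34) := by gcongr
    _ = Real.exp s := by
        rw [← Real.exp_add]
        congr 1
        ring

theorem abs_log_le_two_mul {x δ : ℝ} (h : |x - 1| ≤ δ) (hδ : δ ≤ 1 / 2) : |Real.log x| ≤ 2 * δ := by
  rw [abs_le] at h
  have hx : 1 / 2 ≤ x := by linarith
  have hδ0 : 0 ≤ δ := by linarith
  rw [abs_le]
  constructor
  · have h1 := Real.one_sub_inv_le_log_of_pos (x := x) (by linarith)
    have h2 : x⁻¹ ≤ 1 + 2 * δ := by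
      rw [inv_le_iff_one_le_mul₀ (by linarith)]
      nlinarith
    linarith
  · linarith [Real.log_le_sub_one_of_pos (x := x) (by linarith)]

/-- The approximation with the exponentially small parts of `sinh` and `cosh` removed. -/
theorem overpartitionCount_sub_le {s : ℝ} {n : ℕ} (hs : s ^ 2 = n) (h34 : 34 ≤ s) :
    |overpartitionCount n - Real.exp (Real.pi * s) * (Real.pi * s - 1) / (8 * Real.pi * s ^ 3)|
      ≤ 1 / 2 * Real.exp ((Real.pi - 1) * s) := by
  have hπ := Real.pi_pos
  have hπ3 := Real.pi_gt_d2
  have hs0 : 0 < s := by linarith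
  have h := overpartitionCount_approx hs h34
  set p : ℝ := (overpartitionCount n : ℝ)
  set F := Real.exp (Real.pi * s) * (Real.pi * s - 1) / (8 * Real.pi * s ^ 3) with hF
  set Y := Real.pi / 2 / s ^ 2 * Real.sinh (Real.pi * s)
      - s * Real.cosh (Real.pi * s) / (2 * (s ^ 2) ^ 2) with hY
  have e : 2 * Real.pi * F - Y
      = Real.exp (-(Real.pi * s)) * ((Real.pi * s + 1) / (4 * s ^ 3)) := by
    rw [hF, hY, Real.sinh_eq, Real.cosh_eq]
    field_simp
    ring
  have h1 : (Real.pi * s + 1) / (4 * s ^ 3) ≤ 1 / 10 := by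
    rw [div_le_div_iff₀ (by positivity) (by norm_num)]
    nlinarith [Real.pi_lt_d2, pow_pos hs0 2, pow_pos hs0 3, mul_pos hs0 hs0]
  have h2 : Real.exp (-(Real.pi * s)) ≤ Real.exp ((Real.pi - 1) * s) := by
    gcongr
    nlinarith
  have h3 : |2 * Real.pi * F - Y| ≤ 1 / 10 * Real.exp ((Real.pi - 1) * s) := by
    rw [e, abs_of_nonneg (by positivity), mul_comm]
    gcongr
  have h4 : 2 * Real.pi * |p - F| ≤ 3.1 * Real.exp ((Real.pi - 1) * s) := by
    rw [← abs_of_pos (by positivity : 0 < 2 * Real.pi), ← abs_mul,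
      show 2 * Real.pi * (p - F) = (2 * Real.pi * p - Y) - (2 * Real.pi * F - Y) by ring]
    refine (abs_sub _ _).trans ?_
    linarith
  have h5 := Real.exp_pos ((Real.pi - 1) * s)
  nlinarith [abs_nonneg (p - F)]

/-- The main term of `log p̄(n)`, up to a constant, as a function of `r = √n`. -/
noncomputable def logMain (r : ℝ) : ℝ := Real.pi * r + Real.log (Real.pi * r - 1) - 3 * Real.log r

theorem log_overpartitionCount_approx {n : ℕ} (hn : 1156 ≤ n) :
    |Real.log (overpartitionCount n) - (logMain √n - Real.log (8 * Real.pi))|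
      ≤ 1 / 100 * (1 / √n ^ 5) := by
  have hπ := Real.pi_pos
  have hπ3 := Real.pi_gt_d2
  have hs := Real.sq_sqrt (Nat.cast_nonneg (α := ℝ) n)
  have h34 : 34 ≤ √(n : ℝ) := by
    refine Real.le_sqrt_of_sq_le ?_
    norm_num
    exact_mod_cast hn
  set s := √(n : ℝ)
  have hs0 : 0 < s := by linarith
  have h := overpartitionCount_sub_le hs h34
  have hp : (0 : ℝ) < overpartitionCount n := by exact_mod_cast overpartitionCount_pos n
  have hv : 3 * s ≤ Real.pi * s - 1 := by nlinarith
  have hv0 : 0 < Real.pi * s - 1 := by linarith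
  set p : ℝ := (overpartitionCount n : ℝ)
  set F := Real.exp (Real.pi * s) * (Real.pi * s - 1) / (8 * Real.pi * s ^ 3) with hF
  have hF0 : 0 < F := by positivity
  have hlog : Real.log F = logMain s - Real.log (8 * Real.pi) := by
    rw [hF, logMain, Real.log_div (by positivity) (by positivity),
      Real.log_mul (by positivity) (by positivity), Real.log_mul (by positivity) (by positivity),
      Real.log_exp, Real.log_pow]
    push_cast
    ring
  rw [← hlog, ← Real.log_div hp.ne' hF0.ne']
  have hE := exp_ge_const_mul_pow_seven h34
  have hrel : 1 / 2 * Real.exp ((Real.pi - 1) * s) ≤ 1 / 200 * (1 / s ^ 5) * F := by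
    have hes : Real.exp (Real.pi * s) = Real.exp ((Real.pi - 1) * s) * Real.exp s := by
      rw [← Real.exp_add]
      congr 1
      ring
    rw [hF, hes]
    calc 1 / 2 * Real.exp ((Real.pi - 1) * s)
        ≤ Real.exp ((Real.pi - 1) * s) * (1800 * 3 / (1600 * Real.pi)) := by
          rw [mul_comm]
          refine mul_le_mul_of_nonneg_left ?_ (Real.exp_pos _).le
          rw [div_le_div_iff₀ (by norm_num) (by positivity)]
          linarith [Real.pi_lt_d2]
      _ = 1 / 200 * (1 / s ^ 5) * (Real.exp ((Real.pi - 1) * s) * (1800 * s ^ 7) * (3 * s)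
          / (8 * Real.pi * s ^ 3)) := by
          field_simp
          ring
      _ ≤ _ := by gcongr
  have hδ : |p / F - 1| ≤ 1 / 200 * (1 / s ^ 5) := by
    rw [div_sub_one hF0.ne', abs_div, abs_of_pos hF0, div_le_iff₀ hF0]
    exact h.trans hrel
  have h1 : 1 / s ^ 5 ≤ 1 := by
    rw [div_le_one (by positivity)]
    exact one_le_pow₀ (by linarith)
  have := abs_log_le_two_mul hδ (by linarith)
  linarith

theorem hasDerivAt_comp_sqrt {G : ℝ → ℝ} {g x : ℝ} (hx : 0 < x) (h : HasDerivAt G g √x) :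
    HasDerivAt (fun x => G √x) (g / (2 * √x)) x := by
  rw [← mul_one_div]
  exact h.comp x (Real.hasDerivAt_sqrt hx.ne')

/-- The derivative of `logMain √x` with respect to `x`, as a function of `r = √x`. -/
noncomputable def logMainDeriv (r : ℝ) : ℝ :=
  Real.pi / (2 * r) + Real.pi / (2 * (r * (Real.pi * r - 1))) - 3 / (2 * r ^ 2)

/-- The second derivative of `logMain √x` with respect to `x`, as a function of `r = √x`. -/
noncomputable def logMainDerivTwo (r : ℝ) : ℝ :=
  -(Real.pi / (4 * r ^ 3)) - Real.pi / 4 * ((2 * Real.pi * r - 1) / (r ^ 3 * (Real.pi * r - 1) ^ 2))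
    + 3 / (2 * r ^ 4)

/-- The third derivative of `logMain √x` with respect to `x`, as a function of `r = √x`. -/
noncomputable def logMainDerivThree (r : ℝ) : ℝ :=
  3 * Real.pi / (8 * r ^ 5) - 3 / r ^ 6 - Real.pi / (8 * r) *
    (2 * Real.pi / (r ^ 3 * (Real.pi * r - 1) ^ 2)
      - 3 * ((2 * Real.pi * r - 1) / (r ^ 4 * (Real.pi * r - 1) ^ 2))
      - 2 * Real.pi * ((2 * Real.pi * r - 1) / (r ^ 3 * (Real.pi * r - 1) ^ 3)))

theorem hasDerivAt_logMain {x : ℝ} (hx : 1 ≤ x) :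
    HasDerivAt (fun x => logMain √x) (logMainDeriv √x) x := by
  have hr : 1 ≤ √x := Real.one_le_sqrt.2 hx
  set r := √x with hrd
  have hv : 0 < Real.pi * r - 1 := by nlinarith [Real.pi_gt_three]
  have h1 : HasDerivAt (fun r : ℝ => Real.pi * r) (Real.pi * 1) r := (hasDerivAt_id r).const_mul _
  have h := hasDerivAt_comp_sqrt (G := logMain) (by linarith)
    ((h1.add ((h1.sub_const 1).log hv.ne')).sub ((Real.hasDerivAt_log (by linarith)).const_mul 3))
  convert h using 1
  rw [← hrd, logMainDeriv]
  field_simp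

theorem hasDerivAt_logMainDeriv {x : ℝ} (hx : 1 ≤ x) :
    HasDerivAt (fun x => logMainDeriv √x) (logMainDerivTwo √x) x := by
  have hr : 1 ≤ √x := Real.one_le_sqrt.2 hx
  set r := √x with hrd
  have hr0 : 0 < r := by linarith
  have hv : 0 < Real.pi * r - 1 := by nlinarith [Real.pi_gt_three]
  have h0 := hasDerivAt_id r
  have h1 : HasDerivAt (fun r : ℝ => Real.pi * r) (Real.pi * 1) r := h0.const_mul _
  have h2 := (hasDerivAt_const r Real.pi).div (h0.const_mul 2) (by simpa using hr0.ne')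
  have h3 := (hasDerivAt_const r Real.pi).div ((h0.mul (h1.sub_const 1)).const_mul 2)
    (by simpa using ⟨hr0.ne', hv.ne'⟩)
  have h4 := (hasDerivAt_const r (3 : ℝ)).div ((h0.pow 2).const_mul 2) (by simpa using hr0.ne')
  have h := hasDerivAt_comp_sqrt (G := logMainDeriv) (by linarith) ((h2.add h3).sub h4)
  convert h using 1
  rw [← hrd, logMainDerivTwo]
  simp
  field_simp
  ring

theorem hasDerivAt_logMainDerivTwo {x : ℝ} (hx : 1 ≤ x) :
    HasDerivAt (fun x => logMainDerivTwo √x) (logMainDerivThree √x) x := by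
  have hr : 1 ≤ √x := Real.one_le_sqrt.2 hx
  set r := √x with hrd
  have hr0 : 0 < r := by linarith
  have hv : 0 < Real.pi * r - 1 := by nlinarith [Real.pi_gt_three]
  have h0 := hasDerivAt_id r
  have h1 : HasDerivAt (fun r : ℝ => Real.pi * r) (Real.pi * 1) r := h0.const_mul _
  have h2 := (hasDerivAt_const r Real.pi).div ((h0.pow 3).const_mul 4) (by simpa using hr0.ne')
  have h3 := (((h0.const_mul (2 * Real.pi)).sub_const 1).div
    ((h0.pow 3).mul ((h1.sub_const 1).pow 2)) (by simpa using ⟨hr0.ne', hv.ne'⟩)).const_mul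
    (Real.pi / 4)
  have h4 := (hasDerivAt_const r (3 : ℝ)).div ((h0.pow 4).const_mul 2) (by simpa using hr0.ne')
  have h := hasDerivAt_comp_sqrt (G := logMainDerivTwo) (by linarith) ((h2.neg.sub h3).add h4)
  convert h using 1
  rw [← hrd, logMainDerivThree]
  simp
  field_simp
  ring

theorem logMainDerivTwo_le {r : ℝ} (hr : 34 ≤ r) : logMainDerivTwo r ≤ -(0.74 / r ^ 3) := by
  have hπ3 := Real.pi_gt_d2
  have hr0 : 0 < r := by linarith
  have hv : 0 < Real.pi * r - 1 := by nlinarith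
  have hw : 0 < 2 * Real.pi * r - 1 := by nlinarith
  have h1 : 0 ≤ Real.pi / 4 * ((2 * Real.pi * r - 1) / (r ^ 3 * (Real.pi * r - 1) ^ 2)) := by
    positivity
  have h2 : 3 / (2 * r ^ 4) ≤ 0.0442 / r ^ 3 := by
    rw [div_le_div_iff₀ (by positivity) (by positivity)]
    nlinarith [pow_pos hr0 3]
  have h3 : 0.785 / r ^ 3 ≤ Real.pi / (4 * r ^ 3) := by
    rw [div_le_div_iff₀ (by positivity) (by positivity)]
    nlinarith [pow_pos hr0 3]
  have h4 : (0.785 - 0.0442) / r ^ 3 ≥ 0.74 / r ^ 3 := by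
    gcongr
    norm_num
  rw [sub_div] at h4
  rw [logMainDerivTwo]
  linarith

theorem abs_logMainDerivThree_le {r : ℝ} (hr : 34 ≤ r) :
    |logMainDerivThree r| ≤ 2 * (1 / r ^ 5) := by
  have hπ := Real.pi_pos
  have hπ3 := Real.pi_gt_d2
  have hπ4 := Real.pi_lt_d2
  have hr0 : 0 < r := by linarith
  have hv : 3 * r ≤ Real.pi * r - 1 := by nlinarith
  have hv0 : 0 < Real.pi * r - 1 := by linarith
  have hw : 0 < 2 * Real.pi * r - 1 := by linarith
  have hw' : 2 * Real.pi * r - 1 ≤ 6.3 * r := by nlinarith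
  have a1 : 2 * Real.pi / (r ^ 3 * (Real.pi * r - 1) ^ 2) ≤ 1 / r ^ 5 := by
    calc _ ≤ 6.3 / (r ^ 3 * (3 * r) ^ 2) := by gcongr; linarith
      _ = 0.7 / r ^ 5 := by field_simp; norm_num
      _ ≤ _ := by gcongr; norm_num
  have a2 : (2 * Real.pi * r - 1) / (r ^ 4 * (Real.pi * r - 1) ^ 2) ≤ 1 / r ^ 5 := by
    calc _ ≤ 6.3 * r / (r ^ 4 * (3 * r) ^ 2) := by gcongr
      _ = 0.7 / r ^ 5 := by field_simp; norm_num
      _ ≤ _ := by gcongr; norm_num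
  have a3 : 2 * Real.pi * ((2 * Real.pi * r - 1) / (r ^ 3 * (Real.pi * r - 1) ^ 3))
      ≤ 2 * (1 / r ^ 5) := by
    calc _ ≤ 6.3 * (6.3 * r / (r ^ 3 * (3 * r) ^ 3)) := by gcongr; linarith
      _ = 1.47 / r ^ 5 := by field_simp; norm_num
      _ ≤ 2 / r ^ 5 := by gcongr; norm_num
      _ = _ := by ring
  have b1 : 0 ≤ 2 * Real.pi / (r ^ 3 * (Real.pi * r - 1) ^ 2) := by positivity
  have b2 : 0 ≤ (2 * Real.pi * r - 1) / (r ^ 4 * (Real.pi * r - 1) ^ 2) := by positivity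
  have b3 : 0 ≤ 2 * Real.pi * ((2 * Real.pi * r - 1) / (r ^ 3 * (Real.pi * r - 1) ^ 3)) := by
    positivity
  have c1 : |2 * Real.pi / (r ^ 3 * (Real.pi * r - 1) ^ 2)
      - 3 * ((2 * Real.pi * r - 1) / (r ^ 4 * (Real.pi * r - 1) ^ 2))
      - 2 * Real.pi * ((2 * Real.pi * r - 1) / (r ^ 3 * (Real.pi * r - 1) ^ 3))|
      ≤ 5 * (1 / r ^ 5) := by
    rw [abs_le]
    constructor <;> linarith
  have hq : 0 ≤ 1 / r ^ 5 := by positivity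
  have c2 : Real.pi / (8 * r) ≤ 1 / 50 := by
    rw [div_le_div_iff₀ (by positivity) (by norm_num)]
    linarith
  have c3 : 3 / r ^ 6 ≤ 0.1 * (1 / r ^ 5) := by
    calc 3 / r ^ 6 = 3 / r * (1 / r ^ 5) := by field_simp
      _ ≤ 3 / 34 * (1 / r ^ 5) := by gcongr
      _ ≤ _ := by gcongr; norm_num
  have c4 : 3 * Real.pi / (8 * r ^ 5) ≤ 1.2 * (1 / r ^ 5) := by
    calc 3 * Real.pi / (8 * r ^ 5) = 3 * Real.pi / 8 * (1 / r ^ 5) := by field_simp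
      _ ≤ _ := by gcongr; linarith
  have c5 : 0 ≤ 3 * Real.pi / (8 * r ^ 5) := by positivity
  have c6 : 0 ≤ 3 / r ^ 6 := by positivity
  rw [logMainDerivThree]
  refine (abs_sub _ _).trans ?_
  rw [abs_mul, abs_of_nonneg (by positivity : 0 ≤ Real.pi / (8 * r))]
  have c7 := mul_le_mul c2 c1 (abs_nonneg _) (by norm_num)
  have c8 : |3 * Real.pi / (8 * r ^ 5) - 3 / r ^ 6| ≤ 1.3 * (1 / r ^ 5) := by
    rw [abs_le]
    constructor <;> linarith
  linarith

/-! ### Finite differences and the Turán inequality for large arguments -/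

theorem sub_le_of_hasDerivAt_le {f f' : ℝ → ℝ} {a b K x : ℝ}
    (hf : ∀ y ∈ Set.Icc a b, HasDerivAt f (f' y) y) (hK : ∀ y ∈ Set.Icc a b, f' y ≤ K)
    (hax : a ≤ x) (hxb : x + 1 ≤ b) : f (x + 1) - f x ≤ K := by
  have hsub : Set.Icc x (x + 1) ⊆ Set.Icc a b := Set.Icc_subset_Icc hax hxb
  obtain ⟨c, hc, h⟩ := exists_hasDerivAt_eq_slope f f' (by linarith : x < x + 1)
    (fun y hy => (hf y (hsub hy)).continuousAt.continuousWithinAt)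
    (fun y hy => hf y (hsub (Set.Ioo_subset_Icc_self hy)))
  have := hK c (hsub (Set.Ioo_subset_Icc_self hc))
  rw [h, add_sub_cancel_left, div_one] at this
  exact this

theorem second_difference_le {f f' f'' : ℝ → ℝ} {a K : ℝ}
    (hf : ∀ y ∈ Set.Icc a (a + 2), HasDerivAt f (f' y) y)
    (hf' : ∀ y ∈ Set.Icc a (a + 2), HasDerivAt f' (f'' y) y)
    (hK : ∀ y ∈ Set.Icc a (a + 2), f'' y ≤ K) : f (a + 2) - 2 * f (a + 1) + f a ≤ K := by
  have h := sub_le_of_hasDerivAt_le (f := fun x => f (x + 1) - f x)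
    (f' := fun x => f' (x + 1) - f' x) (a := a) (b := a + 1) (K := K) (x := a) ?_ ?_ le_rfl le_rfl
  · have e : a + 1 + 1 = a + 2 := by ring
    rw [e] at h
    linarith
  · intro y hy
    rw [Set.mem_Icc] at hy
    exact ((hf (y + 1) ⟨by linarith, by linarith⟩).comp_add_const y 1).sub
      (hf y ⟨by linarith, by linarith⟩)
  · intro y hy
    rw [Set.mem_Icc] at hy
    exact sub_le_of_hasDerivAt_le hf' hK hy.1 (by linarith)

theorem third_difference_le {f f' f'' f''' : ℝ → ℝ} {a K : ℝ}
    (hf : ∀ y ∈ Set.Icc a (a + 3), HasDerivAt f (f' y) y)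
    (hf' : ∀ y ∈ Set.Icc a (a + 3), HasDerivAt f' (f'' y) y)
    (hf'' : ∀ y ∈ Set.Icc a (a + 3), HasDerivAt f'' (f''' y) y)
    (hK : ∀ y ∈ Set.Icc a (a + 3), f''' y ≤ K) :
    f (a + 3) - 3 * f (a + 2) + 3 * f (a + 1) - f a ≤ K := by
  have h := second_difference_le (f := fun x => f (x + 1) - f x)
    (f' := fun x => f' (x + 1) - f' x) (f'' := fun x => f'' (x + 1) - f'' x) (a := a) (K := K)
    ?_ ?_ ?_
  · have e : a + 1 + 1 = a + 2 := by ring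
    have e' : a + 2 + 1 = a + 3 := by ring
    rw [e, e'] at h
    linarith
  · intro y hy
    rw [Set.mem_Icc] at hy
    exact ((hf (y + 1) ⟨by linarith, by linarith⟩).comp_add_const y 1).sub
      (hf y ⟨by linarith, by linarith⟩)
  · intro y hy
    rw [Set.mem_Icc] at hy
    exact ((hf' (y + 1) ⟨by linarith, by linarith⟩).comp_add_const y 1).sub
      (hf' y ⟨by linarith, by linarith⟩)
  · intro y hy
    rw [Set.mem_Icc] at hy
    exact sub_le_of_hasDerivAt_le hf'' hK hy.1 (by linarith)

theorem logMain_second_difference_le {x : ℝ} (hx : 1156 ≤ x) :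
    logMain √(x + 2) - 2 * logMain √(x + 1) + logMain √x ≤ -(0.74 / √(x + 2) ^ 3) := by
  have h34 (y : ℝ) (hy : x ≤ y) : 34 ≤ √y :=
    Real.le_sqrt_of_sq_le (by linarith)
  refine second_difference_le (f := fun x => logMain √x)
    (fun y hy => hasDerivAt_logMain (by linarith [hy.1]))
    (fun y hy => hasDerivAt_logMainDeriv (by linarith [hy.1])) fun y hy => ?_
  refine (logMainDerivTwo_le (h34 y hy.1)).trans (neg_le_neg ?_)
  have := h34 y hy.1
  have := hy.2
  gcongr

theorem abs_logMain_third_difference_le {x : ℝ} (hx : 1156 ≤ x) :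
    |logMain √(x + 3) - 3 * logMain √(x + 2) + 3 * logMain √(x + 1) - logMain √x|
      ≤ 2 * (1 / √x ^ 5) := by
  have h34 (y : ℝ) (hy : x ≤ y) : 34 ≤ √y :=
    Real.le_sqrt_of_sq_le (by linarith)
  have hb (y : ℝ) (hy : y ∈ Set.Icc x (x + 3)) : |logMainDerivThree √y| ≤ 2 * (1 / √x ^ 5) := by
    refine (abs_logMainDerivThree_le (h34 y hy.1)).trans ?_
    have := h34 x le_rfl
    have := hy.1
    gcongr
  have h1 := third_difference_le (f := fun x => logMain √x)
    (fun y hy => hasDerivAt_logMain (by linarith [hy.1]))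
    (fun y hy => hasDerivAt_logMainDeriv (by linarith [hy.1]))
    (fun y hy => hasDerivAt_logMainDerivTwo (by linarith [hy.1]))
    fun y hy => (abs_le.1 (hb y hy)).2
  have h2 := third_difference_le (f := fun x => -logMain √x)
    (fun y hy => (hasDerivAt_logMain (by linarith [hy.1])).neg)
    (fun y hy => (hasDerivAt_logMainDeriv (by linarith [hy.1])).neg)
    (fun y hy => (hasDerivAt_logMainDerivTwo (by linarith [hy.1])).neg)
    fun y hy => neg_le.1 (abs_le.1 (hb y hy)).1
  rw [abs_le]
  constructor <;> linarith

theorem exp_neg_sub_exp_neg_le {A B : ℝ} (hA : 0 ≤ A) :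
    Real.exp (-A) - Real.exp (-B) ≤ |A - B| := by
  have h1 : Real.exp (-B) = Real.exp (-A) * Real.exp (A - B) := by
    rw [← Real.exp_add]
    congr 1
    ring
  have h2 : Real.exp (-A) ≤ 1 := Real.exp_le_one_iff.2 (by linarith)
  have h3 := Real.add_one_le_exp (A - B)
  have h4 := Real.exp_pos (-A)
  rw [h1]
  have h5 := neg_abs_le (A - B)
  nlinarith [abs_nonneg (A - B)]

/-- If `1 - u` and `1 - v` are at least `0.6 q` and differ by less than a small multiple of
`q ^ (3/2)`, the Turán expression is positive. -/
theorem turan_pos_of_close {u v q : ℝ} (hq : 0 < q) (hu : u ≤ 1 - 0.6 * q) (hv : v ≤ 1 - 0.6 * q)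
    (hu0 : 0 < u) (hv0 : 0 < v) (huv : (u - v) ^ 2 < 0.432 * q ^ 3) :
    0 < 4 * (1 - u) * (1 - v) - (1 - u * v) ^ 2 := by
  have e : 4 * (1 - u) * (1 - v) - (1 - u * v) ^ 2 = (1 - u) * (1 - v)
      * (2 * (1 - u) + (1 - v) * (1 + u)) - (u - v) ^ 2 := by ring
  have h1 : 0.6 * q * (0.6 * q) ≤ (1 - u) * (1 - v) := by
    gcongr <;> linarith
  have h2 : 2 * (0.6 * q) ≤ 2 * (1 - u) + (1 - v) * (1 + u) := by
    nlinarith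
  have h3 := mul_le_mul h1 h2 (by positivity) (by nlinarith)
  rw [e]
  nlinarith

theorem overpartitionRatio_eq_exp (n : ℕ) :
    overpartitionRatio (n + 1) = Real.exp (-(2 * Real.log (overpartitionCount (n + 1))
      - Real.log (overpartitionCount n) - Real.log (overpartitionCount (n + 2)))) := by
  have h (k : ℕ) : (0 : ℝ) < overpartitionCount k := by exact_mod_cast overpartitionCount_pos k
  rw [overpartitionRatio, ← Real.exp_log (div_pos (mul_pos (h _) (h _)) (pow_pos (h _) 2)),
    Real.log_div (mul_pos (h _) (h _)).ne' (pow_pos (h _) 2).ne', Real.log_mul (h _).ne' (h _).ne',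
    Real.log_pow]
  simp only [Nat.add_sub_cancel]
  push_cast
  congr 1
  ring

theorem overpartitionRatio_turan_of_large {m : ℕ} (hm : 1223 ≤ m) :
    0 < 4 * (1 - overpartitionRatio (m + 1)) * (1 - overpartitionRatio (m + 2))
      - (1 - overpartitionRatio (m + 1) * overpartitionRatio (m + 2)) ^ 2 := by
  have hmR : (1223 : ℝ) ≤ m := by exact_mod_cast hm
  have hr2 : √(m : ℝ) ^ 2 = m := Real.sq_sqrt (by linarith)
  have hr34 : 34 ≤ √(m : ℝ) := Real.le_sqrt_of_sq_le (by linarith)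
  have happ (i : ℕ) : |Real.log (overpartitionCount (m + i)) - (logMain √(m + i : ℝ)
      - Real.log (8 * Real.pi))| ≤ 1 / 100 * (1 / √(m : ℝ) ^ 5) := by
    have h := log_overpartitionCount_approx (n := m + i) (by omega)
    push_cast at h
    refine h.trans ?_
    gcongr
    simp
  have e0 := happ 0
  have e1 := happ 1
  have e2 := happ 2
  have e3 := happ 3
  have d1 := logMain_second_difference_le (x := m) (by linarith)
  have d2 := logMain_second_difference_le (x := m + 1) (by linarith)
  have d3 := abs_logMain_third_difference_le (x := m) (by linarith)
  simp only [Nat.cast_zero, Nat.cast_one, Nat.cast_ofNat, add_zero] at e0 e1 e2 e3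
  have s1 : (m : ℝ) + 1 + 1 = m + 2 := by ring
  have s2 : (m : ℝ) + 1 + 2 = m + 3 := by ring
  rw [s1, s2] at d2
  have hsq : √(m + 3 : ℝ) ≤ 1.002 * √m := by
    rw [Real.sqrt_le_left (by positivity), mul_pow, hr2]
    norm_num
    linarith
  have hsq' : √(m + 2 : ℝ) ≤ √(m + 3 : ℝ) := Real.sqrt_le_sqrt (by linarith)
  set r := √(m : ℝ)
  have hr0 : 0 < r := by linarith
  have hp2 : 0 < √(m + 2 : ℝ) := Real.sqrt_pos.2 (by linarith)
  set q := 1 / r ^ 3 with hq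
  have hq0 : 0 < q := by positivity
  have hq1 : q ≤ 1 / 34 ^ 3 := by rw [hq]; gcongr
  have hq5 : 1 / r ^ 5 ≤ 1 / 34 ^ 2 * q := by
    calc 1 / r ^ 5 = 1 / r ^ 2 * q := by rw [hq]; field_simp
      _ ≤ _ := by gcongr
  have b3 : 0.73 * q ≤ 0.74 / √(m + 3 : ℝ) ^ 3 := by
    calc 0.73 * q ≤ 0.74 / (1.002 * r) ^ 3 := by
          rw [hq, mul_one_div, mul_pow, ← div_div]
          gcongr
          norm_num
      _ ≤ _ := by gcongr
  have b2 : 0.74 / √(m + 3 : ℝ) ^ 3 ≤ 0.74 / √(m + 2 : ℝ) ^ 3 := by gcongr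
  have ratio1 := overpartitionRatio_eq_exp m
  have ratio2 := overpartitionRatio_eq_exp (m + 1)
  rw [abs_le] at e0 e1 e2 e3
  set A := 2 * Real.log (overpartitionCount (m + 1))
      - Real.log (overpartitionCount m) - Real.log (overpartitionCount (m + 2)) with hA
  rw [show m + 1 + 1 = m + 2 from rfl, show m + 1 + 2 = m + 3 from rfl] at ratio2
  set B := 2 * Real.log (overpartitionCount (m + 2))
      - Real.log (overpartitionCount (m + 1)) - Real.log (overpartitionCount (m + 3)) with hB
  have hAq : 0.7 * q ≤ A := by linarith
  have hBq : 0.7 * q ≤ B := by linarith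
  have hAB : |A - B| ≤ 3 * (1 / r ^ 5) := by
    rw [abs_le] at d3 ⊢
    constructor <;> linarith
  have hexp {C : ℝ} (hC : 0.7 * q ≤ C) : Real.exp (-C) ≤ 1 - 0.6 * q := by
    have h1 : Real.exp (-C) ≤ Real.exp (-(0.7 * q)) := by gcongr
    refine h1.trans ?_
    rw [Real.exp_neg, inv_le_iff_one_le_mul₀ (Real.exp_pos _)]
    have h2 := Real.add_one_le_exp (0.7 * q)
    nlinarith
  rw [ratio1, ratio2]
  refine turan_pos_of_close hq0 (hexp hAq) (hexp hBq) (Real.exp_pos _) (Real.exp_pos _) ?_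
  have h1 : |Real.exp (-A) - Real.exp (-B)| ≤ 3 * (1 / r ^ 5) := by
    refine (abs_le.2 ⟨?_, (exp_neg_sub_exp_neg_le (by linarith)).trans hAB⟩)
    have := exp_neg_sub_exp_neg_le (A := B) (B := A) (by linarith)
    rw [abs_sub_comm] at this
    linarith
  calc (Real.exp (-A) - Real.exp (-B)) ^ 2 ≤ (3 * (1 / r ^ 5)) ^ 2 := by
        rw [← sq_abs]
        gcongr
    _ = 9 / r * q ^ 3 := by rw [hq]; field_simp; norm_num
    _ < 0.432 * q ^ 3 := by
        gcongr
        rw [div_lt_iff₀ hr0]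
        linarith

/-! ### The theorem -/

theorem overpartitionRatio_turan {n : ℕ} (hn : 16 ≤ n) :
    0 < 4 * (1 - overpartitionRatio n) * (1 - overpartitionRatio (n + 1))
      - (1 - overpartitionRatio n * overpartitionRatio (n + 1)) ^ 2 := by
  have h (k : ℕ) : (0 : ℝ) < overpartitionCount k := by exact_mod_cast overpartitionCount_pos k
  rcases le_or_gt n 1223 with h1 | h1
  · simp only [overpartitionRatio]
    rw [Nat.add_sub_cancel, ratio_turan_eq (h n) (h (n + 1))]
    exact div_pos (overpartitionCount_turan_of_lt n hn h1)
      (mul_pos (pow_pos (h _) 2) (pow_pos (h _) 2))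
  · obtain ⟨m, rfl⟩ : ∃ m, n = m + 1 := ⟨n - 1, by omega⟩
    exact overpartitionRatio_turan_of_large (by omega)

theorem overpartitionRatio_turan_iff (m : ℕ) :
    0 < 4 * (1 - overpartitionRatio (m + 1)) * (1 - overpartitionRatio (m + 2))
        - (1 - overpartitionRatio (m + 1) * overpartitionRatio (m + 2)) ^ 2 ↔
      ∃ x y z : ℝ, x < y ∧ y < z ∧
        (jensenPolynomial (fun k => (overpartitionCount k : ℝ)) 3 m).IsRoot x ∧
        (jensenPolynomial (fun k => (overpartitionCount k : ℝ)) 3 m).IsRoot y ∧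
        (jensenPolynomial (fun k => (overpartitionCount k : ℝ)) 3 m).IsRoot z := by
  have h (k : ℕ) : (0 : ℝ) < overpartitionCount k := by exact_mod_cast overpartitionCount_pos k
  simp only [overpartitionRatio]
  rw [show m + 2 - 1 = m + 1 from rfl, Nat.add_sub_cancel, show m + 1 + 1 = m + 2 from rfl,
    show m + 2 + 1 = m + 3 from rfl, ratio_turan_eq (h (m + 1)) (h (m + 2)),
    div_pos_iff_of_pos_right (mul_pos (pow_pos (h _) 2) (pow_pos (h _) 2)),
    jensenPolynomial_three, ← disc_pos_iff_roots (h (m + 3)), ← mul_pos_iff_of_pos_left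
      (by norm_num : (0 : ℝ) < 27)]
  -- The discriminant of the Jensen polynomial is 27 times the Turán expression.
  refine iff_of_eq (congrArg (0 < ·) ?_)
  ring

theorem theorem1p2 :
    (∀ n : ℕ, 16 ≤ n →
      0 < 4 * (1 - overpartitionRatio n) * (1 - overpartitionRatio (n + 1))
        - (1 - overpartitionRatio n * overpartitionRatio (n + 1)) ^ 2) ∧
    (∀ n : ℕ, 1 ≤ n →
      (0 < 4 * (1 - overpartitionRatio n) * (1 - overpartitionRatio (n + 1))
          - (1 - overpartitionRatio n * overpartitionRatio (n + 1)) ^ 2 ↔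
        ∃ x y z : ℝ, x < y ∧ y < z ∧
          (jensenPolynomial (fun k => (overpartitionCount k : ℝ)) 3 (n - 1)).IsRoot x ∧
          (jensenPolynomial (fun k => (overpartitionCount k : ℝ)) 3 (n - 1)).IsRoot y ∧
          (jensenPolynomial (fun k => (overpartitionCount k : ℝ)) 3 (n - 1)).IsRoot z)) ∧
    (∀ n : ℕ, 16 ≤ n →
      IsHyperbolic (jensenPolynomial (fun k => (overpartitionCount k : ℝ)) 3 n)) := by
  refine ⟨fun n hn => overpartitionRatio_turan hn, fun n hn => ?_, fun n hn => ?_⟩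
  · obtain ⟨m, rfl⟩ : ∃ m, n = m + 1 := ⟨n - 1, by omega⟩
    exact overpartitionRatio_turan_iff m
  · obtain ⟨x, y, z, hxy, hyz, hx, hy, hz⟩ := (overpartitionRatio_turan_iff n).1
      (overpartitionRatio_turan (by omega))
    have h : (0 : ℝ) < overpartitionCount (n + 3) := by
      exact_mod_cast overpartitionCount_pos (n + 3)
    rw [jensenPolynomial_three] at hx hy hz ⊢
    exact isHyperbolic_of_roots h hxy hyz hx hy hz
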